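/- Let $n\ge 0$ and let $A\in\mathbb R^{n\times n}$, $B\in\mathbb R^{n\times 1}$, $C\in\mathbb R^{1\times n}$ be a minimal realization (i.e. $(A,B)$ is controllable and $(A,C)$ is observable) of the SISO plant $$\dot x=Ax+Bu,\qquad y=Cx,$$ and suppose that its transfer function $G(s)=C(sI-A)^{-1}B$ is negative imaginary (NI), i.e. (i) $G$ has no pole at the origin or in $\{\operatorname{Re}s>0\}$; (ii) $j\,(G(j\omega)-G(j\omega)^*)\ge 0$ for all $\omega>0$ such that $j\omega$ is not a pole of $G$; (iii) if $j\omega_0$ with $\omega_0>0$ is a pole of $G$, then it is simple and $\lim_{s\to j\omega_0}(s-j\omega_0)\,jG(s)$ is real and nonnegative. For $k_h>0$ and $\omega_h\ge0$, the hybrid integrator-gain system (HIGS) with input $e$, state $x_h$ and output $u_h$ is $$\begin{cases}\dot x_h=\omega_h e, & \text{if }(e,u_h,\dot e)\in\mathcal F_1,\\ x_h=k_h e, & \text{if }(e,u_h,\dot e)\in\mathcal F_2,\\ u_h=x_h,\end{cases}$$ operating under the sector constraint $(e,u_h,\dot e)\in\mathcal F=\{(e,u_h,\dot e)\in\mathbb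 R^3: e\,u_h\ge \tfrac1{k_h}u_h^2\}$, where $\mathcal F_2=\{(e,u_h,\dot e)\in\mathbb R^3: u_h=k_he,\ \omega_he^2>k_he\dot e\}$ and $\mathcal F_1=\mathcal F\setminus\mathcal F_2$. Then there exist $k_h>0$ and $\omega_h\ge 0$ such that the positive-feedback interconnection $e=y$, $u=u_h$ of the plant and the HIGS is asymptotically stable. Here trajectories on $[0,\infty)$ are understood in the sense of Carathéodory ($e$ and $x_h$ locally absolutely continuous, the HIGS equations holding for almost every $t$, the sector constraint for every $t$), and asymptotic stability means: from every initial state $(x_0,x_{h,0})$ with $Cx_0\,x_{h,0}\ge\tfrac1{k_h}x_{h,0}^2$ there is a trajectory on $[0,\infty)$; for every $\varepsilon>0$ there is $\delta>0$ such that every trajectory with $\|x(0)\|<\delta$ and $|x_h(0)|<\delta$ satisfies $\|x(t)\|<\varepsilon$ and $|x_h(t)|<\varepsilon$ for all $t\ge0$; and every trajectory satisfies $(x(t),x_h(t))\to(0,0)$ as $t\to\infty$. -/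

import Mathlib

open scoped ComplexOrder Matrix

namespace HIGS

noncomputable section

/-! ### Single-input single-output linear plants -/

/-- The transfer function `G(s) = C (s I - A)⁻¹ B` of the realization `ẋ = A x + B u`, `y = C x`.
(At the finitely many eigenvalues of `A` the value is immaterial.) -/
def transferFunction {n : ℕ} (A : Matrix (Fin n) (Fin n) ℝ) (B C : Fin n → ℝ) (s : ℂ) : ℂ :=
  (fun i => (C i : ℂ)) ⬝ᵥ
    ((s • (1 : Matrix (Fin n) (Fin n) ℂ) - A.map (fun a : ℝ => (a : ℂ)))⁻¹ *ᵥ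
      fun i => (B i : ℂ))

/-- `s₀` is a pole of `G`: `|G(s)| → ∞` as `s → s₀`, `s ≠ s₀`. -/
def IsPole (G : ℂ → ℂ) (s₀ : ℂ) : Prop :=
  Filter.Tendsto G (nhdsWithin s₀ {s₀}ᶜ) (Bornology.cobounded ℂ)

/-- Negative imaginary (scalar, real-rational, proper) transfer functions. In `ℂ` the relation
`0 ≤ z` says that `z` is real and nonnegative. -/
structure IsNegativeImaginary (G : ℂ → ℂ) : Prop where
  /-- no pole in the open right half-plane, and none at the origin -/
  poles : ∀ s : ℂ, IsPole G s → s.re ≤ 0 ∧ s ≠ 0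
  /-- `j (G(jω) - G(jω)^*) ≥ 0` for all frequencies `ω > 0` with `jω` not a pole -/
  imag_axis : ∀ ω : ℝ, 0 < ω → ¬ IsPole G (Complex.I * ω) →
    0 ≤ Complex.I * (G (Complex.I * ω) - (starRingEnd ℂ) (G (Complex.I * ω)))
  /-- a pole `jω`, `ω > 0`, is simple, and the residue of `j G` there is real and nonnegative -/
  residue : ∀ ω : ℝ, 0 < ω → IsPole G (Complex.I * ω) →
    ∃ K : ℂ, 0 ≤ K ∧
      Filter.Tendsto (fun s : ℂ => (s - Complex.I * ω) * (Complex.I * G s))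
        (nhdsWithin (Complex.I * (ω : ℂ)) {Complex.I * (ω : ℂ)}ᶜ) (nhds K)

/-- `(A, B)` is controllable: the matrix `[B, A B, …, Aⁿ⁻¹ B]` has rank `n`. -/
def IsControllable {n : ℕ} (A : Matrix (Fin n) (Fin n) ℝ) (B : Fin n → ℝ) : Prop :=
  (Matrix.of fun i j : Fin n => ((A ^ (j : ℕ)) *ᵥ B) i).rank = n

/-- `(A, C)` is observable: the matrix with rows `C, C A, …, C Aⁿ⁻¹` has rank `n`. -/
def IsObservable {n : ℕ} (A : Matrix (Fin n) (Fin n) ℝ) (C : Fin n → ℝ) : Prop :=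
  (Matrix.of fun i j : Fin n => (C ᵥ* (A ^ (i : ℕ))) j).rank = n

/-- A realization is minimal if it is controllable and observable. -/
def IsMinimalRealization {n : ℕ} (A : Matrix (Fin n) (Fin n) ℝ) (B C : Fin n → ℝ) : Prop :=
  IsControllable A B ∧ IsObservable A C

/-- `x` and `y` are a state trajectory and output on `[0, ∞)` of `ẋ = A x + B u`, `y = C x`. -/
structure IsPlantTrajectory {n : ℕ} (A : Matrix (Fin n) (Fin n) ℝ) (B C : Fin n → ℝ)
    (u : ℝ → ℝ) (x : ℝ → Fin n → ℝ) (y : ℝ → ℝ) : Prop where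
  state : ∀ t : ℝ, 0 ≤ t → HasDerivWithinAt x (A *ᵥ x t + u t • B) (Set.Ici 0) t
  output : ∀ t : ℝ, 0 ≤ t → y t = C ⬝ᵥ x t

/-! ### Hybrid integrator-gain systems -/

/-- The sector `𝓕 = {(e, u, ė) | e u ≥ u² / k}`. -/
def sector (k : ℝ) : Set (ℝ × ℝ × ℝ) :=
  {p | p.1 * p.2.1 ≥ 1 / k * p.2.1 ^ 2}

/-- The gain-mode region `𝓕₂ = {(e, u, ė) | u = k e and ω e² > k e ė}`. -/
def gainRegion (k ω : ℝ) : Set (ℝ × ℝ × ℝ) :=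
  {p | p.2.1 = k * p.1 ∧ ω * p.1 ^ 2 > k * p.1 * p.2.2}

/-- The integrator-mode region `𝓕₁ = 𝓕 \ 𝓕₂`. -/
def integratorRegion (k ω : ℝ) : Set (ℝ × ℝ × ℝ) :=
  sector k \ gainRegion k ω

/-- `xh` and `u` are a state trajectory and output on `[0, ∞)` of the HIGS with gain `k` and
integrator frequency `ω` driven by `e`, in the sense of Carathéodory: the signals are locally
absolutely continuous, the sector constraint holds at all times, and the differential-algebraic
equations hold at almost every time. -/
structure IsHIGSTrajectory (k ω : ℝ) (e xh u : ℝ → ℝ) : Prop where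
  input_ac : ∀ T : ℝ, 0 ≤ T → AbsolutelyContinuousOnInterval e 0 T
  state_ac : ∀ T : ℝ, 0 ≤ T → AbsolutelyContinuousOnInterval xh 0 T
  output : ∀ t : ℝ, 0 ≤ t → u t = xh t
  sector_mem : ∀ t : ℝ, 0 ≤ t → (e t, u t, deriv e t) ∈ sector k
  modes : ∀ᵐ t : ℝ, 0 < t →
    ((e t, u t, deriv e t) ∈ integratorRegion k ω → HasDerivAt xh (ω * e t) t) ∧
    ((e t, u t, deriv e t) ∈ gainRegion k ω → xh t = k * e t)

/-! ### The closed loop -/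

/-- `(x, xh)` is a trajectory on `[0, ∞)` of the positive-feedback interconnection, without
external reference: the HIGS input is the plant output and the plant input is the HIGS output. -/
def IsClosedLoopTrajectory {n : ℕ} (A : Matrix (Fin n) (Fin n) ℝ) (B C : Fin n → ℝ)
    (k ω : ℝ) (x : ℝ → Fin n → ℝ) (xh : ℝ → ℝ) : Prop :=
  ∃ u y : ℝ → ℝ, IsPlantTrajectory A B C u x y ∧ IsHIGSTrajectory k ω y xh u

/-- Asymptotic stability of the origin of the closed loop on its state set, which consists of
the `(x, xh)` with `(C x, xh)` in the sector. -/
structure IsAsymptoticallyStable {n : ℕ} (A : Matrix (Fin n) (Fin n) ℝ) (B C : Fin n → ℝ)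
    (k ω : ℝ) : Prop where
  /-- from every admissible initial state there is a trajectory for all future times -/
  complete : ∀ (x₀ : Fin n → ℝ) (h₀ : ℝ), (C ⬝ᵥ x₀) * h₀ ≥ 1 / k * h₀ ^ 2 →
    ∃ (x : ℝ → Fin n → ℝ) (xh : ℝ → ℝ),
      IsClosedLoopTrajectory A B C k ω x xh ∧ x 0 = x₀ ∧ xh 0 = h₀
  /-- Lyapunov stability -/
  stable : ∀ ε : ℝ, 0 < ε → ∃ δ : ℝ, 0 < δ ∧
    ∀ (x : ℝ → Fin n → ℝ) (xh : ℝ → ℝ), IsClosedLoopTrajectory A B C k ω x xh →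
      ‖x 0‖ < δ → |xh 0| < δ → ∀ t : ℝ, 0 ≤ t → ‖x t‖ < ε ∧ |xh t| < ε
  /-- attractivity -/
  attractive : ∀ (x : ℝ → Fin n → ℝ) (xh : ℝ → ℝ), IsClosedLoopTrajectory A B C k ω x xh →
    Filter.Tendsto x Filter.atTop (nhds 0) ∧ Filter.Tendsto xh Filter.atTop (nhds 0)

end

end HIGS

namespace HIGS

/-! ### Isometries and the frequency-domain inequality -/

noncomputable section

section Isometry

variable {E : Type*} [NormedAddCommGroup E] [InnerProductSpace ℂ E]

/-! The negative imaginary lemma supplies a symmetric `P > 0` and a vector `b` with `xᵀ P A x ≤ 0`,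
`B = -A b` and `P b = C`. Put `e = C x` and `V = ½ xᵀ P x + h² / (2k) - e h`. For small `k` the
cross term is dominated and `V` is positive definite. Along trajectories `V' = zᵀ P A z + (h/k - e)
h'` with `z = x - h b`; the first term is nonpositive, and in both modes the second is at most `-ω
g²`, where `g = |e| - |h|/k`. This gives Lyapunov stability and square integrability of `g`
(`storage_sub_le`).

Attractivity is shown by estimates instead of an invariance principle. There are arbitrarily long
windows on which `∫ g` is arbitrarily small. If `e` vanishes in such a window, then `h` vanishes
there too, and `|h|' ≤ ω |e|` with Grönwall bounds `∫ |e|` over the next unit of time by `∫ g`. If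
`e` never vanishes, `∫ |e| = |∫ e|` is bounded independently of the window length, because `A + k B
C` is invertible and `e` is therefore a derivative up to an error of size `g`; some unit subwindow
then has small `∫ |e|`. By observability (`norm_le_integral_output`) the state is small at the start
of that unit window, and stability keeps it small.

In the negative imaginary lemma, `P` comes from a Kalman–Yakubovich–Popov lemma proved by duality
(`sum_supply_nonneg`, `riesz_extension`). Its positivity comes from the residue conditions on the
imaginary axis and from decay of the remaining modes (`storage_nonneg`), its definiteness from
observability.

Existence of trajectories rests on an explicit HIGS output: the integral of `ω |e|`, reflected at
the barrier `k |e|` and given the sign of `e`. This operator is causal and Lipschitz, so Picard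
iteration applies. -/

open Module.End in
theorem _root_.LinearIsometry.maxGenEigenspace_eq_eigenspace (U : E →ₗᵢ[ℂ] E) (μ : ℂ) :
    maxGenEigenspace U.toLinearMap μ = eigenspace U.toLinearMap μ := by
  have key : ∀ v : E, ((U.toLinearMap - μ • 1 : Module.End ℂ E) ^ 2) v = 0 → (U.toLinearMap - μ • 1 : Module.End ℂ E) v = 0 := by
    intro v hv
    set y := (U.toLinearMap - μ • 1 : Module.End ℂ E) v with hy
    have h1 : U v = μ • v + y := by simp [hy]
    have h2 : U y = μ • y := by
      have : (U.toLinearMap - μ • 1 : Module.End ℂ E) y = 0 := by rw [hy, ← Module.End.mul_apply, ← sq, hv]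
      simpa [sub_eq_zero] using this
    by_contra hne
    have hn : ‖μ‖ = 1 := by
      have := U.norm_map y
      rw [h2, norm_smul] at this
      exact mul_right_cancel₀ (norm_ne_zero_iff.mpr hne) (by rw [this, one_mul])
    -- Expanding the left side with `|μ| = 1` leaves the surplus term `μ ⟪y, y⟫`, which must vanish:
    -- an isometry has no Jordan blocks.
    have h3 : inner ℂ (U v) (U y) = inner ℂ v y := U.inner_map_map v y
    rw [h1, h2, inner_add_left, inner_smul_left, inner_smul_right, inner_smul_right,
      ← mul_assoc, ← Complex.normSq_eq_conj_mul_self, Complex.normSq_eq_norm_sq, hn] at h3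
    have h4 : μ * inner ℂ y y = 0 := by simpa using h3
    rcases mul_eq_zero.mp h4 with h | h
    · simp [h] at hn
    · exact hne (inner_self_eq_zero.mp h)
  apply le_antisymm
  · intro v hv
    obtain ⟨k, hk⟩ := (mem_maxGenEigenspace _ _ _).mp hv
    have : ∀ k : ℕ, ∀ v : E, ((U.toLinearMap - μ • 1 : Module.End ℂ E) ^ (k + 1)) v = 0 →
        (U.toLinearMap - μ • 1 : Module.End ℂ E) v = 0 := by
      intro k
      induction k with
      | zero => intro v hv; simpa using hv
      | succ k ih =>
        intro v hv
        apply key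
        rw [pow_succ, Module.End.mul_apply] at hv
        rw [sq, Module.End.mul_apply]
        exact ih _ hv
    have h0 : (U.toLinearMap - μ • 1 : Module.End ℂ E) v = 0 := by
      apply this k
      rw [pow_succ', Module.End.mul_apply, hk, map_zero]
    rw [mem_eigenspace_iff]
    simpa [sub_eq_zero] using h0
  · intro v hv
    rw [mem_maxGenEigenspace]
    refine ⟨1, ?_⟩
    rw [mem_eigenspace_iff] at hv
    simp only [pow_one, LinearMap.sub_apply, hv]
    simp

theorem _root_.LinearIsometry.exists_sum_eigenvectors [FiniteDimensional ℂ E] (U : E →ₗᵢ[ℂ] E) (v : E) :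
    ∃ z : ℂ →₀ E, (∀ μ, U (z μ) = μ • z μ) ∧ (z.sum fun _ x => x) = v := by
  have h := Module.End.iSup_maxGenEigenspace_eq_top U.toLinearMap
  simp_rw [LinearIsometry.maxGenEigenspace_eq_eigenspace] at h
  have hv : v ∈ ⨆ μ, Module.End.eigenspace U.toLinearMap μ := by rw [h]; trivial
  obtain ⟨z, hz, hs⟩ := (Submodule.mem_iSup_iff_exists_finsupp _ _).mp hv
  exact ⟨z, fun μ => Module.End.mem_eigenspace_iff.mp (hz μ), hs⟩

theorem _root_.LinearIsometry.norm_eq_one_of_eigenvector (U : E →ₗᵢ[ℂ] E) {μ : ℂ} {z : E}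
    (hz : U z = μ • z) (h0 : z ≠ 0) : ‖μ‖ = 1 := by
  have := U.norm_map z
  rw [hz, norm_smul] at this
  exact mul_right_cancel₀ (norm_ne_zero_iff.mpr h0) (by rw [this, one_mul])

/-- In adjoint form this is `U* z = μ̄ z`. It is used to read an operator identity along one
eigenvector as a scalar identity. -/
theorem _root_.LinearIsometry.inner_eigenvector_map (U : E →ₗᵢ[ℂ] E) {μ : ℂ} {z : E}
    (hz : U z = μ • z) (g : E) : inner ℂ z (U g) = μ * inner ℂ z g := by
  by_cases h0 : z = 0
  · simp [h0]
  have hn := U.norm_eq_one_of_eigenvector hz h0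
  have h := U.inner_map_map z g
  rw [hz, inner_smul_left] at h
  rw [← h, ← mul_assoc, Complex.mul_conj, Complex.normSq_eq_norm_sq, hn]
  simp

theorem _root_.LinearIsometry.inner_eigenvectors_eq_zero (U : E →ₗᵢ[ℂ] E) {μ ν : ℂ} {z w : E}
    (hz : U z = μ • z) (hw : U w = ν • w) (h : μ ≠ ν) : inner ℂ z w = 0 := by
  have h1 := U.inner_eigenvector_map hz w
  rw [hw, inner_smul_right] at h1
  have : (ν - μ) * inner ℂ z w = 0 := by rw [sub_mul, h1, sub_self]
  rcases mul_eq_zero.mp this with h2 | h2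
  · exact absurd (sub_eq_zero.mp h2).symm h
  · exact h2

/-- Two linear maps with the same Gram form differ by an isometry of the target. -/
theorem exists_linearIsometry_comp_eq {V : Type*} [AddCommGroup V] [Module ℂ V]
    [FiniteDimensional ℂ E] (G H : V →ₗ[ℂ] E) (h : ∀ a, ‖G a‖ = ‖H a‖) :
    ∃ U : E →ₗᵢ[ℂ] E, ∀ a, U (H a) = G a := by
  have hle : LinearMap.ker H ≤ LinearMap.ker G := by
    intro a ha
    rw [LinearMap.mem_ker] at ha ⊢
    rw [← norm_eq_zero, h, ha, norm_zero]
  let L₀ : LinearMap.range H →ₗ[ℂ] E :=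
    (Submodule.liftQ (LinearMap.ker H) G hle).comp H.quotKerEquivRange.symm.toLinearMap
  have hL₀ : ∀ a, L₀ ⟨H a, LinearMap.mem_range_self H a⟩ = G a := by
    intro a
    simp only [L₀, LinearMap.comp_apply, LinearEquiv.coe_coe]
    rw [LinearMap.quotKerEquivRange_symm_apply_image]
    simp
  let L : LinearMap.range H →ₗᵢ[ℂ] E := ⟨L₀, by
    rintro ⟨_, a, rfl⟩
    rw [hL₀, h]; rfl⟩
  refine ⟨L.extend, fun a => ?_⟩
  have := L.extend_apply ⟨H a, LinearMap.mem_range_self H a⟩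
  exact this.trans (hL₀ a)

end Isometry

/-- The frequency-domain inequality `Re (ū C (jω x)) ≥ 0` on `jω x = A x + u B`. -/
def FrequencyInequality {n : ℕ} (A : Matrix (Fin n) (Fin n) ℝ) (B C : Fin n → ℝ) : Prop :=
  ∀ (ω : ℝ) (x : Fin n → ℂ) (u : ℂ),
    (Complex.I * ω) • x = A.map (fun a : ℝ => (a : ℂ)) *ᵥ x + u • (fun i => (B i : ℂ)) →
    0 ≤ ((starRingEnd ℂ) u * ((fun i => (C i : ℂ)) ⬝ᵥ ((Complex.I * ω) • x))).re

/-- A finite family with skew moment `∑ x fᵀ` behaves like a superposition of sinusoids. Skewness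
yields an isometry `U` with `U (f - x) = f + x`, a Cayley transform of differentiation. Its
eigenvectors split the family into single frequencies, and the frequency inequality applies to each.
-/
theorem sum_supply_nonneg {n : ℕ} {A : Matrix (Fin n) (Fin n) ℝ} {B C : Fin n → ℝ}
    (hfreq : FrequencyInequality A B C) (hCB : 0 ≤ C ⬝ᵥ B)
    {ι : Type*} [Fintype ι] (x f : ι → Fin n → ℝ) (u : ι → ℝ)
    (hf : ∀ i, f i = A *ᵥ x i + u i • B)
    (hskew : ∀ a b, ∑ i, (x i a * f i b + f i a * x i b) = 0) :
    0 ≤ ∑ i, u i * (C ⬝ᵥ f i) := by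
  have hin : ∀ z w : EuclideanSpace ℂ ι, inner ℂ z w = ∑ i, (starRingEnd ℂ) (z i) * w i := by
    intro z w
    simp only [PiLp.inner_apply, RCLike.inner_apply]
    exact Finset.sum_congr rfl fun i _ => mul_comm _ _
  let Φ : (ι → Fin n → ℝ) → (Fin n → ℂ) →ₗ[ℂ] EuclideanSpace ℂ ι := fun g =>
    (WithLp.linearEquiv 2 ℂ (ι → ℂ)).symm.toLinearMap.comp
      (Matrix.toLin' (Matrix.of fun i b => (g i b : ℂ)))
  have hΦ : ∀ g a i, Φ g a i = ∑ b, (g i b : ℂ) * a b := by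
    intro g a i
    simp [Φ, Matrix.mulVec, dotProduct]
  -- The difference of the squared norms is twice the form of `∑ (x fᵀ + f xᵀ)`, which vanishes by
  -- skewness.
  have hiso : ∀ a, ‖Φ (f + x) a‖ = ‖Φ (f - x) a‖ := by
    intro a
    rw [← sq_eq_sq₀ (norm_nonneg _) (norm_nonneg _), EuclideanSpace.norm_sq_eq,
      EuclideanSpace.norm_sq_eq]
    rw [← Complex.ofReal_inj]
    push_cast
    rw [← sub_eq_zero, ← Finset.sum_sub_distrib]
    have : ∀ i, ((‖Φ (f + x) a i‖ : ℂ) ^ 2 - (‖Φ (f - x) a i‖ : ℂ) ^ 2) =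
        2 * ∑ b, ∑ c, (((x i b * f i c + f i b * x i c : ℝ) : ℂ)) *
          (a b * (starRingEnd ℂ) (a c)) := by
      intro i
      rw [← Complex.mul_conj', ← Complex.mul_conj', hΦ, hΦ]
      simp only [Pi.add_apply, Pi.sub_apply, Complex.ofReal_add, Complex.ofReal_sub, add_mul,
        sub_mul, Finset.sum_add_distrib, Finset.sum_sub_distrib, map_add, map_sub, map_sum,
        map_mul, Complex.conj_ofReal]
      have e1 : ∀ p q : Fin n → ℝ, ∑ b, ∑ c, (((p b * q c : ℝ) : ℂ)) *
          (a b * (starRingEnd ℂ) (a c)) =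
          (∑ b, (p b : ℂ) * a b) * ∑ c, (q c : ℂ) * (starRingEnd ℂ) (a c) := by
        intro p q
        rw [Finset.sum_mul_sum]
        refine Finset.sum_congr rfl fun b _ => Finset.sum_congr rfl fun c _ => ?_
        push_cast; ring
      rw [e1, e1]
      ring
    rw [Finset.sum_congr rfl fun i _ => this i, ← Finset.mul_sum, Finset.sum_comm]
    have h0 : ∀ b, ∑ i, ∑ c, (((x i b * f i c + f i b * x i c : ℝ) : ℂ)) *
          (a b * (starRingEnd ℂ) (a c)) = 0 := by
      intro b
      rw [Finset.sum_comm]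
      refine Finset.sum_eq_zero fun c _ => ?_
      rw [← Finset.sum_mul, ← Complex.ofReal_sum, hskew]
      simp
    rw [Finset.sum_congr rfl fun b _ => h0 b]
    simp
  obtain ⟨U, hU⟩ := exists_linearIsometry_comp_eq (Φ (f + x)) (Φ (f - x)) hiso
  obtain ⟨z, hz, hzs⟩ := U.exists_sum_eigenvectors (WithLp.toLp 2 fun i => (u i : ℂ) : EuclideanSpace ℂ ι)
  let Y : EuclideanSpace ℂ ι := WithLp.toLp 2 fun i => ((C ⬝ᵥ f i : ℝ) : ℂ)
  have hgoal : ∑ i, u i * (C ⬝ᵥ f i) = ∑ μ ∈ z.support, (inner ℂ (z μ) Y).re := by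
    rw [← Complex.re_sum, ← sum_inner]
    have : ∑ μ ∈ z.support, z μ = (WithLp.toLp 2 fun i => (u i : ℂ) : EuclideanSpace ℂ ι) := hzs
    rw [this]
    simp only [Y, hin, Complex.re_sum, Complex.conj_ofReal]
    refine Finset.sum_congr rfl fun i _ => ?_
    rw [← Complex.ofReal_mul, Complex.ofReal_re]
  rw [hgoal]
  refine Finset.sum_nonneg fun μ hμ => ?_
  have hne : z μ ≠ 0 := Finsupp.mem_support_iff.mp hμ
  have hn := U.norm_eq_one_of_eigenvector (hz μ) hne
  set w := z μ with hw
  let av : (ι → Fin n → ℝ) → Fin n → ℂ := fun g b => ∑ i, (starRingEnd ℂ) (w i) * (g i b : ℂ)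
  have hav : ∀ g b, inner ℂ w (Φ g (Pi.single b 1)) = av g b := by
    intro g b
    simp only [hin, hΦ, av]
    refine Finset.sum_congr rfl fun i _ => ?_
    simp [Pi.single_apply, mul_comm]
  have hrel : ∀ b, av f b + av x b = μ * (av f b - av x b) := by
    intro b
    have h1 := U.inner_eigenvector_map (hz μ) (Φ (f - x) (Pi.single b 1))
    rw [hU, ← hw, hav, hav] at h1
    have e1 : av (f + x) b = av f b + av x b := by
      simp [av, mul_add, Finset.sum_add_distrib]
    have e2 : av (f - x) b = av f b - av x b := by
      simp [av, mul_sub, Finset.sum_sub_distrib]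
    rw [← e1, ← e2, h1]
  -- The input is the sum of the mutually orthogonal `z ν`, so pairing with `w = z μ` retains only
  -- `‖w‖²`.
  have hu : ∑ i, (starRingEnd ℂ) (w i) * (u i : ℂ) = ((‖w‖ ^ 2 : ℝ) : ℂ) := by
    have h1 : inner ℂ w (WithLp.toLp 2 fun i => (u i : ℂ) : EuclideanSpace ℂ ι) =
        ∑ i, (starRingEnd ℂ) (w i) * (u i : ℂ) := hin _ _
    rw [← h1, ← hzs, Finsupp.sum, inner_sum, Finset.sum_eq_single μ]
    · rw [← hw, inner_self_eq_norm_sq_to_K]; norm_cast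
    · intro ν _ hν
      exact U.inner_eigenvectors_eq_zero (hz μ) (hz ν) hν.symm
    · intro h; exact absurd hμ h
  have hdyn : av f = A.map (fun a : ℝ => (a : ℂ)) *ᵥ av x +
      (((‖w‖ ^ 2 : ℝ) : ℂ)) • (fun i => (B i : ℂ)) := by
    funext b
    rw [← hu]
    simp only [av, hf, Pi.add_apply, Matrix.mulVec, dotProduct, Matrix.map_apply, Pi.smul_apply,
      smul_eq_mul, Complex.ofReal_add, Complex.ofReal_sum, Complex.ofReal_mul, mul_add,
      Finset.sum_add_distrib, Finset.mul_sum, Finset.sum_mul]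
    rw [Finset.sum_comm]
    congr 1
    · exact Finset.sum_congr rfl fun c _ => Finset.sum_congr rfl fun i _ => by ring
    · exact Finset.sum_congr rfl fun i _ => by ring
  have hY : inner ℂ w Y = (fun i => (C i : ℂ)) ⬝ᵥ av f := by
    simp only [Y, hin, dotProduct, av, Complex.ofReal_sum,
      Complex.ofReal_mul, Finset.mul_sum]
    rw [Finset.sum_comm]
    exact Finset.sum_congr rfl fun c _ => Finset.sum_congr rfl fun i _ => by ring
  have hwpos : 0 < ‖w‖ ^ 2 := by positivity
  rw [hY]
  -- The eigenvalue `1` is infinite frequency: the state component vanishes and `0 ≤ C ⬝ᵥ B`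
  -- replaces the frequency inequality. Any other unimodular `μ` gives the purely imaginary quotient
  -- `(μ + 1) / (μ - 1)`.
  by_cases hμ1 : μ = 1
  · have hx0 : av x = 0 := by
      funext b
      have := hrel b
      rw [hμ1, one_mul] at this
      have h2 : (2 : ℂ) * av x b = 0 := by linear_combination this
      simpa using h2
    rw [hdyn, hx0, Matrix.mulVec_zero, zero_add, dotProduct_smul, smul_eq_mul]
    have : (fun i => (C i : ℂ)) ⬝ᵥ (fun i => (B i : ℂ)) = ((C ⬝ᵥ B : ℝ) : ℂ) := by
      simp [dotProduct]
    rw [this, ← Complex.ofReal_mul, Complex.ofReal_re]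
    positivity
  · have hμ1' : μ - 1 ≠ 0 := sub_ne_zero.mpr hμ1
    have hre : ((μ + 1) / (μ - 1)).re = 0 := by
      have h1 : Complex.normSq μ = 1 := by rw [Complex.normSq_eq_norm_sq, hn]; norm_num
      rw [Complex.div_re]
      simp only [Complex.add_re, Complex.sub_re, Complex.one_re, Complex.add_im, Complex.sub_im,
        Complex.one_im, add_zero, sub_zero]
      rw [← add_div, div_eq_zero_iff]
      left
      rw [Complex.normSq_apply] at h1
      linear_combination h1
    set ω := ((μ + 1) / (μ - 1)).im with hω
    have hquot : (μ + 1) / (μ - 1) = Complex.I * ω := by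
      apply Complex.ext <;> simp [hre, hω]
    have hfx : av f = (Complex.I * ω) • av x := by
      funext b
      rw [Pi.smul_apply, smul_eq_mul, ← hquot]
      field_simp
      linear_combination -(hrel b)
    have h1 := hfreq ω (av x) ((‖w‖ ^ 2 : ℝ) : ℂ) (by rw [← hfx, hdyn])
    rw [← hfx, Complex.conj_ofReal, Complex.re_ofReal_mul] at h1
    exact nonneg_of_mul_nonneg_right h1 hwpos

end

end HIGS

namespace HIGS

/-! ### Minimality and the Kalman–Yakubovich–Popov lemma -/

noncomputable section

theorem isUnit_of_rank_eq {n : ℕ} {M : Matrix (Fin n) (Fin n) ℝ} (h : M.rank = n) : IsUnit M := by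
  rw [← Matrix.mulVec_injective_iff_isUnit]
  have hr : LinearMap.range M.mulVecLin = ⊤ := by
    apply Submodule.eq_top_of_finrank_eq
    rw [← Matrix.rank, h]; simp
  have := LinearMap.injective_iff_surjective.mpr (LinearMap.range_eq_top.mp hr)
  exact this

theorem IsControllable.eq_zero {n : ℕ} {A : Matrix (Fin n) (Fin n) ℝ} {B : Fin n → ℝ}
    (h : IsControllable A B) {p : Fin n → ℝ} (hp : ∀ k : ℕ, p ⬝ᵥ ((A ^ k) *ᵥ B) = 0) : p = 0 := by
  have hu := isUnit_of_rank_eq h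
  apply Matrix.vecMul_injective_iff_isUnit.mpr hu
  funext j
  exact (hp j).trans (by simp)

theorem IsObservable.eq_zero {n : ℕ} {A : Matrix (Fin n) (Fin n) ℝ} {C : Fin n → ℝ}
    (h : IsObservable A C) {x : Fin n → ℝ} (hx : ∀ k : ℕ, C ⬝ᵥ ((A ^ k) *ᵥ x) = 0) : x = 0 := by
  have hu := isUnit_of_rank_eq h
  apply Matrix.mulVec_injective_iff_isUnit.mpr hu
  funext j
  have := hx j
  rw [Matrix.dotProduct_mulVec] at this
  exact this.trans (by simp)

/-- A nonnegative parabola through the origin is flat there; `t = -b / (|c| + 1)` refutes a nonzero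
slope for either sign of `c`. -/
theorem eq_zero_of_quadratic_nonneg {b c : ℝ} (h : ∀ t : ℝ, 0 ≤ t * b + t ^ 2 * c) : b = 0 := by
  by_contra hb
  have h1 := h (-b / (|c| + 1))
  have hc : 0 < |c| + 1 := by positivity
  have h2 : -b / (|c| + 1) * b + (-b / (|c| + 1)) ^ 2 * c = b ^ 2 * (c - |c| - 1) / (|c| + 1) ^ 2 := by
    field_simp; ring
  rw [h2] at h1
  have h3 : b ^ 2 * (c - |c| - 1) < 0 :=
    mul_neg_of_pos_of_neg (by positivity) (by linarith [le_abs_self c])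
  exact absurd h1 (not_le.mpr (div_neg_of_neg_of_pos h3 (by positivity)))

/-- A zero of a nonnegative quadratic form is a minimum, so the gradient vanishes there. -/
theorem mulVec_add_transpose_mulVec_eq_zero {n : ℕ} {M : Matrix (Fin n) (Fin n) ℝ}
    (h : ∀ x, 0 ≤ x ⬝ᵥ M *ᵥ x) {v : Fin n → ℝ} (hv : v ⬝ᵥ M *ᵥ v = 0) :
    M *ᵥ v + Mᵀ *ᵥ v = 0 := by
  rw [← dotProduct_eq_zero_iff]
  intro w
  apply eq_zero_of_quadratic_nonneg (c := w ⬝ᵥ M *ᵥ w)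
  intro t
  have h1 := h (v + t • w)
  have e : v ⬝ᵥ M *ᵥ w = w ⬝ᵥ Mᵀ *ᵥ v := by
    rw [Matrix.dotProduct_mulVec, dotProduct_comm, Matrix.mulVec_transpose]
  simp only [Matrix.mulVec_add, Matrix.mulVec_smul, add_dotProduct, dotProduct_add, smul_dotProduct,
    dotProduct_smul, smul_eq_mul, hv, e] at h1
  rw [add_dotProduct, dotProduct_comm (M *ᵥ v), dotProduct_comm (Mᵀ *ᵥ v)]
  linarith

/-- `∑ x (A x + u B)ᵀ` over a list of pairs `(x, u)`. -/
def moment {n : ℕ} (A : Matrix (Fin n) (Fin n) ℝ) (B : Fin n → ℝ) (l : List ((Fin n → ℝ) × ℝ)) :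
    Matrix (Fin n) (Fin n) ℝ :=
  (l.map fun p => Matrix.vecMulVec p.1 (A *ᵥ p.1 + p.2 • B)).sum

/-- `∑ u C (A x + u B)` over a list of pairs `(x, u)`. -/
def supply {n : ℕ} (A : Matrix (Fin n) (Fin n) ℝ) (B C : Fin n → ℝ) (l : List ((Fin n → ℝ) × ℝ)) :
    ℝ :=
  (l.map fun p => p.2 * (C ⬝ᵥ (A *ᵥ p.1 + p.2 • B))).sum

/-- Both quantities are quadratic in `(x, u)`, so scaling by `√c` suffices. With concatenation for
sums, the values attained by lists form a convex cone. -/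
theorem exists_list_smul {n : ℕ} (A : Matrix (Fin n) (Fin n) ℝ) (B C : Fin n → ℝ) {c : ℝ}
    (hc : 0 ≤ c) (l : List ((Fin n → ℝ) × ℝ)) :
    ∃ l', moment A B l' = c • moment A B l ∧ supply A B C l' = c * supply A B C l := by
  refine ⟨l.map fun p => (√c • p.1, √c * p.2), ?_, ?_⟩
  · simp only [moment, List.map_map, List.smul_sum]
    congr 1
    refine List.map_congr_left fun p _ => ?_
    simp only [Function.comp, Matrix.mulVec_smul, mul_smul, ← smul_add, Matrix.smul_vecMulVec,
      Matrix.vecMulVec_smul]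
    rw [← mul_smul, Real.mul_self_sqrt hc]
  · simp only [supply, List.map_map, ← List.sum_map_mul_left]
    congr 1
    refine List.map_congr_left fun p _ => ?_
    simp only [Function.comp, Matrix.mulVec_smul, mul_smul, ← smul_add, dotProduct_smul, smul_eq_mul]
    linear_combination (p.2 * C ⬝ᵥ (A *ᵥ p.1 + p.2 • B)) * Real.mul_self_sqrt hc

theorem linearMap_vecMulVec {n : ℕ} (φ : Matrix (Fin n) (Fin n) ℝ →ₗ[ℝ] ℝ) (x y : Fin n → ℝ) :
    φ (Matrix.vecMulVec x y) =
      x ⬝ᵥ (Matrix.of fun i j => φ (Matrix.single i j 1)) *ᵥ y := by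
  have h : Matrix.vecMulVec x y = ∑ i, ∑ j, (x i * y j) • Matrix.single i j (1 : ℝ) := by
    conv_lhs => rw [Matrix.matrix_eq_sum_single (Matrix.vecMulVec x y)]
    refine Finset.sum_congr rfl fun i _ => Finset.sum_congr rfl fun j _ => ?_
    rw [Matrix.smul_single]; simp [Matrix.vecMulVec]
  rw [h, map_sum]
  simp only [map_sum, map_smul, smul_eq_mul, dotProduct, Matrix.mulVec, Matrix.of_apply,
    Finset.mul_sum]
  exact Finset.sum_congr rfl fun i _ => Finset.sum_congr rfl fun j _ => by ring

/-- The functional is given by a matrix `P`, symmetric by the condition on skew matrices. Since `u`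
is free and enters linearly, `P B = 0`. If `P v = 0`, then `v` is a zero of the nonnegative form of
`P A`, whence `P A v = 0`. So `P` kills every `Aᵏ B`, and controllability finishes. -/
theorem functional_eq_zero {n : ℕ} {A : Matrix (Fin n) (Fin n) ℝ} {B : Fin n → ℝ}
    (hc : IsControllable A B) (φ : Matrix (Fin n) (Fin n) ℝ →ₗ[ℝ] ℝ)
    (hskew : ∀ Q : Matrix (Fin n) (Fin n) ℝ, Qᵀ = -Q → 0 ≤ φ Q)
    (hpos : ∀ (x : Fin n → ℝ) (u : ℝ), 0 ≤ φ (Matrix.vecMulVec x (A *ᵥ x + u • B))) : φ = 0 := by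
  set P : Matrix (Fin n) (Fin n) ℝ := Matrix.of fun i j => φ (Matrix.single i j 1) with hP
  have hPs : Pᵀ = P := by
    ext i j
    simp only [hP, Matrix.transpose_apply, Matrix.of_apply]
    have h1 := hskew (Matrix.single i j 1 - Matrix.single j i 1) (by simp [Matrix.transpose_single])
    have h2 := hskew (Matrix.single j i 1 - Matrix.single i j 1) (by simp [Matrix.transpose_single])
    rw [map_sub] at h1 h2
    linarith
  simp_rw [linearMap_vecMulVec, ← hP] at hpos
  have hA : ∀ x, 0 ≤ x ⬝ᵥ (P * A) *ᵥ x := by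
    intro x
    have := hpos x 0
    rwa [zero_smul, add_zero, Matrix.mulVec_mulVec] at this
  have hB : P *ᵥ B = 0 := by
    rw [← dotProduct_eq_zero_iff]
    intro x
    rw [dotProduct_comm]
    by_contra hne
    have h1 := hpos x (-(x ⬝ᵥ (P * A) *ᵥ x + 1) / (x ⬝ᵥ P *ᵥ B))
    rw [Matrix.mulVec_add, dotProduct_add, Matrix.mulVec_mulVec, Matrix.mulVec_smul,
      dotProduct_smul, smul_eq_mul, div_mul_cancel₀ _ hne] at h1
    linarith
  have hk : ∀ k : ℕ, P *ᵥ ((A ^ k) *ᵥ B) = 0 := by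
    intro k
    induction k with
    | zero => simpa using hB
    | succ k ih =>
      have h0 : (A ^ k *ᵥ B) ⬝ᵥ (P * A) *ᵥ (A ^ k *ᵥ B) = 0 := by
        rw [← Matrix.mulVec_mulVec, Matrix.dotProduct_mulVec, ← Matrix.mulVec_transpose, hPs, ih,
          zero_dotProduct]
      have h1 := mulVec_add_transpose_mulVec_eq_zero hA h0
      rw [Matrix.transpose_mul, hPs, ← Matrix.mulVec_mulVec, ← Matrix.mulVec_mulVec, ih,
        Matrix.mulVec_zero, add_zero] at h1
      rw [pow_succ', ← Matrix.mulVec_mulVec, h1]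
  have hP0 : ∀ i j, P i j = 0 := by
    intro i
    have : P i = 0 := hc.eq_zero fun k => congrFun (hk k) i
    intro j; rw [this]; rfl
  apply LinearMap.ext
  intro Q
  rw [Matrix.matrix_eq_sum_single Q, map_sum]
  refine Finset.sum_eq_zero fun i _ => ?_
  rw [map_sum]
  refine Finset.sum_eq_zero fun j _ => ?_
  have : Matrix.single i j (Q i j) = (Q i j) • Matrix.single i j (1 : ℝ) := by
    rw [Matrix.smul_single]; simp
  rw [this, map_smul]
  have := hP0 i j
  simp only [hP, Matrix.of_apply] at this
  rw [this, smul_zero]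

/-- A convex cone in a finite-dimensional space on which only the zero functional is nonnegative
is the whole space. -/
theorem pointedCone_eq_top {V : Type*} [NormedAddCommGroup V] [NormedSpace ℝ V]
    [FiniteDimensional ℝ V] (K : PointedCone ℝ V)
    (h : ∀ φ : V →ₗ[ℝ] ℝ, (∀ v ∈ K, 0 ≤ φ v) → φ = 0) (v : V) : v ∈ K := by
  have hconv : Convex ℝ (K : Set V) := by
    intro a ha b hb s t hs ht _
    exact K.add_mem (K.smul_mem hs ha) (K.smul_mem ht hb)
  have hspan : Submodule.span ℝ (K : Set V) = ⊤ := by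
    by_contra hne
    obtain ⟨f, hf0, hf⟩ := Submodule.exists_le_ker_of_lt_top _ (lt_top_iff_ne_top.mpr hne)
    refine hf0 (h f fun v hv => ?_)
    exact (LinearMap.mem_ker.mp (hf (Submodule.subset_span hv))).ge
  have haff : affineSpan ℝ (K : Set V) = ⊤ := by
    have h0 : (0 : V) ∈ (K : Set V) := K.zero_mem
    rw [← AffineSubspace.coe_eq_univ_iff, ← Set.insert_eq_of_mem h0, affineSpan_insert_zero, hspan]
    rfl
  obtain ⟨a, ha⟩ := hconv.interior_nonempty_iff_affineSpan_eq_top.mpr haff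
  by_contra hv
  obtain ⟨f, hf⟩ := geometric_hahn_banach_open_point hconv.interior isOpen_interior
    (fun hi => hv (interior_subset hi))
  -- The interior is stable under scaling by `c ≥ 1`, while `f` is bounded above on it by `f v`.
  have hint : ∀ w ∈ interior (K : Set V), f w ≤ 0 := by
    intro w hw
    by_contra hpos
    push Not at hpos
    have hc : ∀ c : ℝ, 1 ≤ c → c • w ∈ interior (K : Set V) := by
      intro c hc
      have hc0 : c ≠ 0 := by linarith
      have : (fun x : V => c • x) '' interior (K : Set V) ⊆ interior (K : Set V) := by
        apply interior_maximal
        · rintro _ ⟨x, hx, rfl⟩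
          exact K.smul_mem (by linarith) (interior_subset hx)
        · exact (isOpenMap_smul₀ hc0) _ isOpen_interior
      exact this ⟨w, hw, rfl⟩
    have h2 := hf _ (hc (max 1 (f v / f w)) (le_max_left _ _))
    rw [map_smul, smul_eq_mul] at h2
    have h3 : f v / f w * f w ≤ max 1 (f v / f w) * f w :=
      mul_le_mul_of_nonneg_right (le_max_right _ _) hpos.le
    rw [div_mul_cancel₀ _ hpos.ne'] at h3
    linarith
  have hall : ∀ w ∈ K, 0 ≤ (-f.toLinearMap) w := by
    intro w hw
    by_contra hneg
    have hneg' : 0 < f w := by simpa using hneg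
    -- Moving the interior point `a` along a cone direction `w` stays in the interior, so `f w > 0`
    -- would make `f` unbounded there.
    have hsum : ∀ c : ℝ, 0 ≤ c → f a + c * f w ≤ 0 := by
      intro c hc
      have hmem : a + c • w ∈ interior (K : Set V) := by
        have : (fun x : V => x + c • w) '' interior (K : Set V) ⊆ interior (K : Set V) := by
          apply interior_maximal
          · rintro _ ⟨x, hx, rfl⟩
            exact K.add_mem (interior_subset hx) (K.smul_mem hc hw)
          · exact (isOpenMap_add_right (c • w)) _ isOpen_interior
        exact this ⟨a, ha, rfl⟩
      simpa using hint _ hmem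
    have h1 := hsum ((|f a| + 1) / f w) (by positivity)
    rw [div_mul_cancel₀ _ hneg'.ne'] at h1
    linarith [neg_abs_le (f a)]
  have hz := h _ hall
  have hfz : ∀ w, f w = 0 := fun w => by
    have := congrArg (fun g : V →ₗ[ℝ] ℝ => g w) hz
    simpa using this
  have := hf a ha
  rw [hfz, hfz] at this
  exact lt_irrefl _ this

/-- Moments and skew matrices together generate the whole matrix space, by duality with
`functional_eq_zero`. This is the covering hypothesis of `riesz_extension`. -/
theorem exists_moment_sub_skew {n : ℕ} {A : Matrix (Fin n) (Fin n) ℝ} {B : Fin n → ℝ}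
    (hc : IsControllable A B) (Q : Matrix (Fin n) (Fin n) ℝ) :
    ∃ l, (Q - moment A B l)ᵀ = -(Q - moment A B l) := by
  let _ : NormedAddCommGroup (Matrix (Fin n) (Fin n) ℝ) := Matrix.normedAddCommGroup
  let _ : NormedSpace ℝ (Matrix (Fin n) (Fin n) ℝ) := Matrix.normedSpace
  let K : PointedCone ℝ (Matrix (Fin n) (Fin n) ℝ) :=
    { carrier := {Q | ∃ l, (Q - moment A B l)ᵀ = -(Q - moment A B l)}
      zero_mem' := ⟨[], by simp [moment]⟩
      add_mem' := by
        rintro Q R ⟨l, hl⟩ ⟨m, hm⟩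
        refine ⟨l ++ m, ?_⟩
        have : moment A B (l ++ m) = moment A B l + moment A B m := by simp [moment]
        rw [this, show Q + R - (moment A B l + moment A B m) =
          (Q - moment A B l) + (R - moment A B m) by abel, Matrix.transpose_add, hl, hm]
        abel
      smul_mem' := by
        rintro ⟨c, hc⟩ Q ⟨l, hl⟩
        obtain ⟨l', h1, -⟩ := exists_list_smul A B B hc l
        refine ⟨l', ?_⟩
        have : (⟨c, hc⟩ : {c : ℝ // 0 ≤ c}) • Q = c • Q := rfl
        rw [h1, this, ← smul_sub, Matrix.transpose_smul, hl, smul_neg] }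
  refine pointedCone_eq_top K (fun φ hφ => functional_eq_zero hc φ (fun R hR => hφ R ?_)
    (fun x u => hφ _ ?_)) Q
  · exact ⟨[], by simpa [moment] using hR⟩
  · exact ⟨[(x, u)], by simp [moment]⟩

/-- The Kalman–Yakubovich–Popov lemma for the supply rate `u · C ẋ`. -/
theorem kalman_yakubovich_popov {n : ℕ} {A : Matrix (Fin n) (Fin n) ℝ} {B C : Fin n → ℝ}
    (hc : IsControllable A B) (hfreq : FrequencyInequality A B C) (hCB : 0 ≤ C ⬝ᵥ B) :
    ∃ P : Matrix (Fin n) (Fin n) ℝ, Pᵀ = P ∧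
      ∀ x u, x ⬝ᵥ P *ᵥ (A *ᵥ x + u • B) ≤ u * (C ⬝ᵥ (A *ᵥ x + u • B)) := by
  -- The cone consists of moments modulo skew matrices, paired with upper bounds for the supply. The
  -- functional `(0, r) ↦ r` is nonnegative on it by `sum_supply_nonneg`; the matrix part of a
  -- positive extension is the storage matrix up to sign.
  let s : PointedCone ℝ (Matrix (Fin n) (Fin n) ℝ × ℝ) :=
    { carrier := {p | ∃ l, (p.1 - moment A B l)ᵀ = -(p.1 - moment A B l) ∧ supply A B C l ≤ p.2}
      zero_mem' := ⟨[], by simp [moment, supply]⟩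
      add_mem' := by
        rintro p q ⟨l, hl, hl'⟩ ⟨m, hm, hm'⟩
        refine ⟨l ++ m, ?_, ?_⟩
        · have : moment A B (l ++ m) = moment A B l + moment A B m := by simp [moment]
          rw [this, Prod.fst_add, show p.1 + q.1 - (moment A B l + moment A B m) =
            (p.1 - moment A B l) + (q.1 - moment A B m) by abel, Matrix.transpose_add, hl, hm]
          abel
        · have : supply A B C (l ++ m) = supply A B C l + supply A B C m := by simp [supply]
          rw [this]; exact add_le_add hl' hm'
      smul_mem' := by
        rintro ⟨c, hc⟩ p ⟨l, hl, hl'⟩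
        obtain ⟨l', h1, h2⟩ := exists_list_smul A B C hc l
        refine ⟨l', ?_, ?_⟩
        · have : ((⟨c, hc⟩ : {c : ℝ // 0 ≤ c}) • p).1 = c • p.1 := rfl
          rw [h1, this, ← smul_sub, Matrix.transpose_smul, hl, smul_neg]
        · have : ((⟨c, hc⟩ : {c : ℝ // 0 ≤ c}) • p).2 = c * p.2 := rfl
          rw [h2, this]
          exact mul_le_mul_of_nonneg_left hl' hc }
  let f : (Matrix (Fin n) (Fin n) ℝ × ℝ) →ₗ.[ℝ] ℝ :=
    ⟨LinearMap.ker (LinearMap.fst ℝ (Matrix (Fin n) (Fin n) ℝ) ℝ),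
      (LinearMap.snd ℝ (Matrix (Fin n) (Fin n) ℝ) ℝ).comp (Submodule.subtype _)⟩
  obtain ⟨g, hg, hgs⟩ := riesz_extension s f
    (by
      rintro ⟨⟨Q, r⟩, hQ⟩ ⟨l, hl, hl'⟩
      have hQ0 : Q = 0 := hQ
      subst hQ0
      refine le_trans ?_ hl'
      simp only [zero_sub, Matrix.transpose_neg, neg_neg, neg_eq_iff_eq_neg] at hl
      have := sum_supply_nonneg hfreq hCB (fun i : Fin l.length => l[i].1)
        (fun i => A *ᵥ l[i].1 + l[i].2 • B) (fun i => l[i].2) (fun i => rfl)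
        (by
          intro a b
          have hm : moment A B l = ∑ i : Fin l.length,
              Matrix.vecMulVec l[i].1 (A *ᵥ l[i].1 + l[i].2 • B) :=
            (Fin.sum_univ_fun_getElem l _).symm
          have h1 : ∀ a b, moment A B l a b =
              ∑ i : Fin l.length, l[i].1 a * (A *ᵥ l[i].1 + l[i].2 • B) b := by
            intro a b
            rw [hm, Matrix.sum_apply]; rfl
          have h2 := congrFun (congrFun hl a) b
          rw [Matrix.transpose_apply, Matrix.neg_apply, h1, h1] at h2
          rw [Finset.sum_add_distrib]
          have h3 : ∀ i : Fin l.length, (A *ᵥ l[i].1 + l[i].2 • B) a * l[i].1 b =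
            l[i].1 b * (A *ᵥ l[i].1 + l[i].2 • B) a := fun i => mul_comm _ _
          rw [Finset.sum_congr rfl fun i _ => h3 i, h2]
          ring)
      rw [supply, ← Fin.sum_univ_fun_getElem l]
      exact this)
    (by
      rintro ⟨Q, r⟩
      obtain ⟨l, hl⟩ := exists_moment_sub_skew hc Q
      refine ⟨⟨(0, supply A B C l - r), rfl⟩, l, ?_, ?_⟩
      · simpa using hl
      · simp)
  let φ : Matrix (Fin n) (Fin n) ℝ →ₗ[ℝ] ℝ := g.comp (LinearMap.inl ℝ _ ℝ)
  have hgφ : ∀ Q r, g (Q, r) = φ Q + r := by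
    intro Q r
    have h1 : g (0, r) = r := hg ⟨(0, r), rfl⟩
    have h2 : ((Q, r) : Matrix (Fin n) (Fin n) ℝ × ℝ) = (Q, 0) + (0, r) := by simp
    rw [h2, map_add, h1]; rfl
  set P : Matrix (Fin n) (Fin n) ℝ := Matrix.of fun i j => φ (Matrix.single i j 1) with hP
  have hskew : ∀ Q : Matrix (Fin n) (Fin n) ℝ, Qᵀ = -Q → 0 ≤ φ Q := by
    intro Q hQ
    have := hgs (Q, 0) ⟨[], by simpa [moment] using hQ, by simp [supply]⟩
    rwa [hgφ, add_zero] at this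
  have hPs : Pᵀ = P := by
    ext i j
    simp only [hP, Matrix.transpose_apply, Matrix.of_apply]
    have h1 := hskew (Matrix.single i j 1 - Matrix.single j i 1) (by simp [Matrix.transpose_single])
    have h2 := hskew (Matrix.single j i 1 - Matrix.single i j 1) (by simp [Matrix.transpose_single])
    rw [map_sub] at h1 h2
    linarith
  refine ⟨-P, by rw [Matrix.transpose_neg, hPs], fun x u => ?_⟩
  have := hgs (Matrix.vecMulVec x (A *ᵥ x + u • B), u * (C ⬝ᵥ (A *ᵥ x + u • B)))
    ⟨[(x, u)], by simp [moment], by simp [supply]⟩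
  rw [hgφ, linearMap_vecMulVec, ← hP] at this
  rw [Matrix.neg_mulVec, dotProduct_neg]
  linarith

end

end HIGS

namespace HIGS

/-! ### Complexification and poles -/

noncomputable section

open Filter Topology

/-- Complexification of a real vector. -/
abbrev cvec {n : ℕ} (x : Fin n → ℝ) : Fin n → ℂ := fun i => (x i : ℂ)

/-- Complexification of a real matrix. -/
abbrev cmat {n : ℕ} (A : Matrix (Fin n) (Fin n) ℝ) : Matrix (Fin n) (Fin n) ℂ :=
  A.map fun a : ℝ => (a : ℂ)

section Complexification

variable {n : ℕ} (A : Matrix (Fin n) (Fin n) ℝ)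

theorem cvec_dotProduct (x y : Fin n → ℝ) : cvec x ⬝ᵥ cvec y = ((x ⬝ᵥ y : ℝ) : ℂ) := by
  simp [dotProduct]

theorem cmat_mulVec_cvec (x : Fin n → ℝ) : cmat A *ᵥ cvec x = cvec (A *ᵥ x) := by
  funext i
  simp [cvec, Matrix.mulVec, dotProduct]

theorem cmat_pow_mulVec_cvec (k : ℕ) (x : Fin n → ℝ) :
    cmat A ^ k *ᵥ cvec x = cvec (A ^ k *ᵥ x) := by
  induction k with
  | zero => simp
  | succ k ih =>
    rw [pow_succ', ← Matrix.mulVec_mulVec, ih, cmat_mulVec_cvec, pow_succ', Matrix.mulVec_mulVec]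

theorem cmat_transpose : (cmat A)ᵀ = cmat Aᵀ := rfl

theorem re_dotProduct_cvec (x : Fin n → ℂ) (y : Fin n → ℝ) :
    (x ⬝ᵥ cvec y).re = (fun i => (x i).re) ⬝ᵥ y := by
  simp [dotProduct]

theorem im_dotProduct_cvec (x : Fin n → ℂ) (y : Fin n → ℝ) :
    (x ⬝ᵥ cvec y).im = (fun i => (x i).im) ⬝ᵥ y := by
  simp [dotProduct]

theorem re_cmat_mulVec (x : Fin n → ℂ) :
    (fun i => ((cmat A *ᵥ x) i).re) = A *ᵥ fun i => (x i).re := by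
  funext i
  simp [Matrix.mulVec, dotProduct]

theorem im_cmat_mulVec (x : Fin n → ℂ) :
    (fun i => ((cmat A *ᵥ x) i).im) = A *ᵥ fun i => (x i).im := by
  funext i
  simp [Matrix.mulVec, dotProduct]

theorem star_cmat_mulVec (x : Fin n → ℂ) : star (cmat A *ᵥ x) = cmat A *ᵥ star x := by
  funext i
  simp [Matrix.mulVec, dotProduct]

theorem star_cvec (x : Fin n → ℝ) : star (cvec x) = cvec x := by
  funext i
  simp

theorem ext_re_im {x y : Fin n → ℂ} (hr : (fun i => (x i).re) = fun i => (y i).re)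
    (hi : (fun i => (x i).im) = fun i => (y i).im) : x = y := by
  funext i
  exact Complex.ext (congrFun hr i) (congrFun hi i)

end Complexification

/-! ### Hautus tests, and eigenvalues of a minimal realization as poles. -/

section Eigenvalues

variable {n : ℕ} {A : Matrix (Fin n) (Fin n) ℝ} {B C : Fin n → ℝ}

theorem IsControllable.eq_zero_complex (h : IsControllable A B) {p : Fin n → ℂ}
    (hp : ∀ k : ℕ, p ⬝ᵥ (cmat A ^ k *ᵥ cvec B) = 0) : p = 0 := by
  simp_rw [cmat_pow_mulVec_cvec] at hp
  refine ext_re_im (h.eq_zero fun k => ?_) (h.eq_zero fun k => ?_)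
  · rw [← re_dotProduct_cvec, hp]; rfl
  · rw [← im_dotProduct_cvec, hp]; rfl

theorem IsObservable.eq_zero_complex (h : IsObservable A C) {x : Fin n → ℂ}
    (hx : ∀ k : ℕ, cvec C ⬝ᵥ (cmat A ^ k *ᵥ x) = 0) : x = 0 := by
  have hr : ∀ k, (fun i => ((cmat A ^ k *ᵥ x) i).re) = A ^ k *ᵥ fun i => (x i).re := by
    intro k
    induction k with
    | zero => simp
    | succ k ih =>
      rw [pow_succ', ← Matrix.mulVec_mulVec, re_cmat_mulVec, ih, pow_succ', Matrix.mulVec_mulVec]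
  have hi : ∀ k, (fun i => ((cmat A ^ k *ᵥ x) i).im) = A ^ k *ᵥ fun i => (x i).im := by
    intro k
    induction k with
    | zero => simp
    | succ k ih =>
      rw [pow_succ', ← Matrix.mulVec_mulVec, im_cmat_mulVec, ih, pow_succ', Matrix.mulVec_mulVec]
  refine ext_re_im (h.eq_zero fun k => ?_) (h.eq_zero fun k => ?_)
  · rw [← hr, dotProduct_comm, ← re_dotProduct_cvec, dotProduct_comm, hx]; rfl
  · rw [← hi, dotProduct_comm, ← im_dotProduct_cvec, dotProduct_comm, hx]; rfl

theorem pow_mulVec_eigenvector {M : Matrix (Fin n) (Fin n) ℂ} {v : Fin n → ℂ} {s : ℂ}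
    (hv : M *ᵥ v = s • v) (k : ℕ) : M ^ k *ᵥ v = s ^ k • v := by
  induction k with
  | zero => simp
  | succ k ih =>
    rw [pow_succ, ← Matrix.mulVec_mulVec, hv, Matrix.mulVec_smul, ih, smul_smul, pow_succ']

theorem dotProduct_pow_mulVec_of_left_eigenvector {M : Matrix (Fin n) (Fin n) ℂ} {p : Fin n → ℂ}
    {s : ℂ} (hp : p ᵥ* M = s • p) (k : ℕ) (x : Fin n → ℂ) :
    p ⬝ᵥ (M ^ k *ᵥ x) = s ^ k * (p ⬝ᵥ x) := by
  induction k with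
  | zero => simp
  | succ k ih =>
    rw [pow_succ', ← Matrix.mulVec_mulVec, Matrix.dotProduct_mulVec, hp, smul_dotProduct, ih,
      smul_eq_mul, pow_succ', mul_assoc]

theorem IsControllable.left_eigenvector_dotProduct_ne_zero (h : IsControllable A B)
    {p : Fin n → ℂ} {s : ℂ} (hp : p ᵥ* cmat A = s • p) (h0 : p ≠ 0) : p ⬝ᵥ cvec B ≠ 0 := by
  intro hB
  refine h0 (h.eq_zero_complex fun k => ?_)
  rw [dotProduct_pow_mulVec_of_left_eigenvector hp, hB, mul_zero]

theorem IsObservable.eigenvector_dotProduct_ne_zero (h : IsObservable A C)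
    {v : Fin n → ℂ} {s : ℂ} (hv : cmat A *ᵥ v = s • v) (h0 : v ≠ 0) : cvec C ⬝ᵥ v ≠ 0 := by
  intro hC
  refine h0 (h.eq_zero_complex fun k => ?_)
  rw [pow_mulVec_eigenvector hv, dotProduct_smul, hC, smul_zero]

theorem exists_left_eigenvector {s : ℂ} (hs : (s • (1 : Matrix (Fin n) (Fin n) ℂ) - cmat A).det = 0) :
    ∃ p : Fin n → ℂ, p ≠ 0 ∧ p ᵥ* cmat A = s • p := by
  obtain ⟨p, hp, h⟩ := Matrix.exists_vecMul_eq_zero_iff.mpr hs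
  refine ⟨p, hp, ?_⟩
  rw [Matrix.vecMul_sub, Matrix.vecMul_smul, Matrix.vecMul_one, sub_eq_zero] at h
  exact h.symm

theorem det_eq_zero_of_eigenvector {s : ℂ} {v : Fin n → ℂ} (hv : cmat A *ᵥ v = s • v)
    (h0 : v ≠ 0) : (s • (1 : Matrix (Fin n) (Fin n) ℂ) - cmat A).det = 0 := by
  refine Matrix.exists_mulVec_eq_zero_iff.mp ⟨v, h0, ?_⟩
  rw [Matrix.sub_mulVec, Matrix.smul_mulVec, Matrix.one_mulVec, hv, sub_self]

/-- The state response `(s I - A)⁻¹ B`. -/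
def stateResponse (A : Matrix (Fin n) (Fin n) ℝ) (B : Fin n → ℝ) (s : ℂ) : Fin n → ℂ :=
  (s • (1 : Matrix (Fin n) (Fin n) ℂ) - cmat A)⁻¹ *ᵥ cvec B

theorem transferFunction_eq (s : ℂ) :
    transferFunction A B C s = cvec C ⬝ᵥ stateResponse A B s := rfl

theorem stateResponse_spec {s : ℂ}
    (hs : (s • (1 : Matrix (Fin n) (Fin n) ℂ) - cmat A).det ≠ 0) :
    s • stateResponse A B s = cmat A *ᵥ stateResponse A B s + cvec B := by
  have : (s • (1 : Matrix (Fin n) (Fin n) ℂ) - cmat A) *ᵥ stateResponse A B s = cvec B := by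
    rw [stateResponse, Matrix.mulVec_mulVec, Matrix.mul_nonsing_inv _ (isUnit_iff_ne_zero.mpr hs),
      Matrix.one_mulVec]
  rw [Matrix.sub_mulVec, Matrix.smul_mulVec, Matrix.one_mulVec, sub_eq_iff_eq_add'] at this
  exact this

theorem eventually_det_ne_zero (A : Matrix (Fin n) (Fin n) ℝ) (s₀ : ℂ) :
    ∀ᶠ s in 𝓝[≠] s₀, (s • (1 : Matrix (Fin n) (Fin n) ℂ) - cmat A).det ≠ 0 := by
  have hfin : {s : ℂ | (cmat A).charpoly.IsRoot s}.Finite :=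
    Polynomial.finite_setOfPred_isRoot (Matrix.charpoly_monic _).ne_zero
  have hmem : ({s : ℂ | (cmat A).charpoly.IsRoot s} \ {s₀})ᶜ ∈ 𝓝 s₀ :=
    (hfin.subset Set.sdiff_subset).isClosed.isOpen_compl.mem_nhds (by simp)
  filter_upwards [mem_nhdsWithin_of_mem_nhds hmem, self_mem_nhdsWithin] with s hs hne hdet
  refine hs ⟨?_, hne⟩
  change Polynomial.eval s _ = 0
  rw [Matrix.eval_charpoly, ← hdet]
  congr 2
  ext i j
  simp [Matrix.scalar_apply, Matrix.diagonal_apply, Matrix.one_apply]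

theorem not_isPole_of_det_ne_zero {s : ℂ}
    (hs : (s • (1 : Matrix (Fin n) (Fin n) ℂ) - cmat A).det ≠ 0) :
    ¬ IsPole (transferFunction A B C) s := by
  intro hp
  have hM : Continuous fun s : ℂ => s • (1 : Matrix (Fin n) (Fin n) ℂ) - cmat A := by fun_prop
  have hcont : ContinuousAt (transferFunction A B C) s := by
    have hinv : ContinuousAt (fun s : ℂ => (s • (1 : Matrix (Fin n) (Fin n) ℂ) - cmat A)⁻¹) s := by
      simp_rw [Matrix.inv_def, Ring.inverse_eq_inv']
      exact (hM.matrix_det.continuousAt.inv₀ hs).smul hM.matrix_adjugate.continuousAt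
    have h1 : ContinuousAt (fun s : ℂ => stateResponse A B s) s :=
      (Continuous.matrix_mulVec continuous_id continuous_const).continuousAt.comp hinv
    exact (Continuous.dotProduct continuous_const continuous_id).continuousAt.comp h1
  have h2 : Tendsto (transferFunction A B C) (𝓝[≠] s) (𝓝 (transferFunction A B C s)) :=
    hcont.mono_left nhdsWithin_le_nhds
  have h3 := (tendsto_norm_cobounded_atTop.comp hp)
  exact not_tendsto_nhds_of_tendsto_atTop h3 _ h2.norm

/-- Convergence of the scaled output of a state response implies convergence of the scaled state. -/
theorem IsObservable.exists_tendsto_state (h : IsObservable A C) {F : Filter ℂ} {s₀ c₀ g : ℂ}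
    {c : ℂ → ℂ} {r : ℂ → Fin n → ℂ} (hF : Tendsto id F (𝓝 s₀)) (hc : Tendsto c F (𝓝 c₀))
    (hr : ∀ᶠ s in F, s • r s = cmat A *ᵥ r s + cvec B)
    (hg : Tendsto (fun s => c s * (cvec C ⬝ᵥ r s)) F (𝓝 g)) :
    ∃ x, Tendsto (fun s => c s • r s) F (𝓝 x) := by
  have hk : ∀ k : ℕ, ∃ y, Tendsto (fun s => c s * (cvec C ⬝ᵥ (cmat A ^ k *ᵥ r s))) F (𝓝 y) := by
    intro k
    induction k with
    | zero => exact ⟨g, by simpa using hg⟩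
    | succ k ih =>
      obtain ⟨y, hy⟩ := ih
      -- The resolvent equation gives `C Aᵏ⁺¹ r = s C Aᵏ r - C Aᵏ B`, so convergence passes from `k`
      -- to `k + 1`. The observability matrix, being injective, then recovers the state.
      refine ⟨_, ((hF.mul hy).sub (hc.mul_const (cvec C ⬝ᵥ (cmat A ^ k *ᵥ cvec B)))).congr' ?_⟩
      filter_upwards [hr] with s hs
      have : cmat A *ᵥ r s = s • r s - cvec B := by rw [hs]; abel
      rw [pow_succ, ← Matrix.mulVec_mulVec, this, Matrix.mulVec_sub, Matrix.mulVec_smul,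
        dotProduct_sub, dotProduct_smul, id, smul_eq_mul]
      ring
  choose y hy using hk
  let O : (Fin n → ℂ) →ₗ[ℂ] (Fin n → ℂ) :=
    (Matrix.of fun i j : Fin n => (cvec C ᵥ* (cmat A ^ (i : ℕ))) j).mulVecLin
  have hO : ∀ x i, O x i = cvec C ⬝ᵥ (cmat A ^ (i : ℕ) *ᵥ x) := by
    intro x i
    rw [Matrix.dotProduct_mulVec]; rfl
  have hu := isUnit_of_rank_eq h
  have hinj : LinearMap.ker O = ⊥ := by
    rw [LinearMap.ker_eq_bot']
    intro x hx
    have hre : ∀ i : Fin n, C ᵥ* (A ^ (i : ℕ)) ⬝ᵥ (fun i => (x i).re) = 0 ∧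
        C ᵥ* (A ^ (i : ℕ)) ⬝ᵥ (fun i => (x i).im) = 0 := by
      intro i
      have h1 := congrFun hx i
      have h2 : cvec C ᵥ* (cmat A ^ (i : ℕ)) = cvec (C ᵥ* (A ^ (i : ℕ))) := by
        have h3 : cmat A ^ (i : ℕ) = cmat (A ^ (i : ℕ)) :=
          (map_pow (RingHom.mapMatrix Complex.ofRealHom) A (i : ℕ)).symm
        rw [h3]
        funext j
        simp [cvec, Matrix.vecMul, dotProduct]
      rw [hO, Matrix.dotProduct_mulVec, h2, dotProduct_comm] at h1
      constructor
      · rw [dotProduct_comm, ← re_dotProduct_cvec, h1]; rfl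
      · rw [dotProduct_comm, ← im_dotProduct_cvec, h1]; rfl
    refine ext_re_im ?_ ?_
    · apply Matrix.mulVec_injective_iff_isUnit.mpr hu
      funext i
      exact (hre i).1.trans (congrFun (Matrix.mulVec_zero _) i).symm
    · apply Matrix.mulVec_injective_iff_isUnit.mpr hu
      funext i
      exact (hre i).2.trans (congrFun (Matrix.mulVec_zero _) i).symm
  obtain ⟨L, hL⟩ := O.exists_leftInverse_of_injective hinj
  refine ⟨L fun i => y i, ?_⟩
  have h1 : Tendsto (fun s => O (c s • r s)) F (𝓝 fun i : Fin n => y i) := by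
    rw [tendsto_pi_nhds]
    intro i
    refine (hy i).congr fun s => ?_
    rw [map_smul, Pi.smul_apply, hO, smul_eq_mul]
  have h2 := (LinearMap.continuous_of_finiteDimensional L).continuousAt.tendsto.comp h1
  refine h2.congr fun s => ?_
  exact congrArg (fun f : (Fin n → ℂ) →ₗ[ℂ] (Fin n → ℂ) => f (c s • r s)) hL

/-- If `G` did not blow up, it would converge along some ultrafilter, and by observability so would
the state response, to a solution of `s₀ x = A x + B`. Pairing with a left eigenvector `p` gives `p
B = 0`, against controllability. -/
theorem IsMinimalRealization.isPole (h : IsMinimalRealization A B C) {s₀ : ℂ}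
    (hs : (s₀ • (1 : Matrix (Fin n) (Fin n) ℂ) - cmat A).det = 0) :
    IsPole (transferFunction A B C) s₀ := by
  by_contra hp
  have hfreq : ∃ M : ℝ, ∃ᶠ s in 𝓝[≠] s₀, transferFunction A B C s ∈ Metric.closedBall (0 : ℂ) M := by
    by_contra hne
    push Not at hne
    refine hp ((Metric.hasBasis_cobounded_compl_closedBall (0 : ℂ)).tendsto_right_iff.mpr ?_)
    intro M _
    exact hne M
  obtain ⟨M, hM⟩ := hfreq
  obtain ⟨g, -, hg⟩ := (isCompact_closedBall (0 : ℂ) M).exists_mapClusterPt_of_frequently hM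
  obtain ⟨U, hU, hgU⟩ := mapClusterPt_iff_ultrafilter.mp hg
  have hid : Tendsto id (U : Filter ℂ) (𝓝 s₀) := hU.trans nhdsWithin_le_nhds
  have hr : ∀ᶠ s in (U : Filter ℂ), s • stateResponse A B s =
      cmat A *ᵥ stateResponse A B s + cvec B := by
    filter_upwards [hU (eventually_det_ne_zero A s₀)] with s hs
    exact stateResponse_spec hs
  obtain ⟨x, hx⟩ := h.2.exists_tendsto_state (B := B) (c := fun _ => 1) (c₀ := 1) (g := g)
    hid tendsto_const_nhds hr (hgU.congr fun s => by rw [one_mul]; rfl)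
  simp only [one_smul] at hx
  have hlim : s₀ • x = cmat A *ᵥ x + cvec B := by
    have h1 : Tendsto (fun s => s • stateResponse A B s) (U : Filter ℂ) (𝓝 (s₀ • x)) := hid.smul hx
    have h2 : Tendsto (fun s => cmat A *ᵥ stateResponse A B s + cvec B) (U : Filter ℂ)
        (𝓝 (cmat A *ᵥ x + cvec B)) :=
      ((Continuous.matrix_mulVec continuous_const continuous_id).continuousAt.tendsto.comp
        hx).add_const _
    exact tendsto_nhds_unique (h1.congr' hr) h2
  obtain ⟨p, hp0, hpe⟩ := exists_left_eigenvector hs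
  refine h.1.left_eigenvector_dotProduct_ne_zero hpe hp0 ?_
  have h3 := congrArg (fun y => p ⬝ᵥ y) hlim
  simp only [dotProduct_add, dotProduct_smul] at h3
  rw [Matrix.dotProduct_mulVec, hpe, smul_dotProduct] at h3
  exact (left_eq_add.mp h3)

end Eigenvalues

end

end HIGS

namespace HIGS

/-! ### Storage matrices of negative imaginary plants -/

noncomputable section

open Filter Topology

variable {n : ℕ} {A : Matrix (Fin n) (Fin n) ℝ} {B C : Fin n → ℝ}

theorem IsNegativeImaginary.im_nonpos (hNI : IsNegativeImaginary (transferFunction A B C)) {ω : ℝ}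
    (hω : 0 < ω)
    (hdet : ((Complex.I * ω) • (1 : Matrix (Fin n) (Fin n) ℂ) - cmat A).det ≠ 0) :
    (transferFunction A B C (Complex.I * ω)).im ≤ 0 := by
  have h := (Complex.le_def.mp (hNI.imag_axis ω hω (not_isPole_of_det_ne_zero hdet))).1
  simp at h
  linarith

theorem eq_smul_stateResponse {s u : ℂ} {x : Fin n → ℂ}
    (hdet : (s • (1 : Matrix (Fin n) (Fin n) ℂ) - cmat A).det ≠ 0)
    (hx : s • x = cmat A *ᵥ x + u • cvec B) : x = u • stateResponse A B s := by
  by_contra hne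
  refine hdet (det_eq_zero_of_eigenvector (v := x - u • stateResponse A B s) ?_
    (sub_ne_zero.mpr hne))
  have h1 := stateResponse_spec (B := B) hdet
  rw [Matrix.mulVec_sub, Matrix.mulVec_smul, smul_sub, smul_comm s u, h1, hx, smul_add]
  abel

/-- At an eigenvalue `jω` a left eigenvector forces `u = 0`. Elsewhere `x = u (jω - A)⁻¹ B`, and the
real part equals `-|u|² ω Im G(jω)`. -/
theorem supply_re_nonneg_of_pos (hmin : IsMinimalRealization A B C)
    (hNI : IsNegativeImaginary (transferFunction A B C)) {ω : ℝ} (hω : 0 < ω) (x : Fin n → ℂ)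
    (u : ℂ) (hx : (Complex.I * ω) • x = cmat A *ᵥ x + u • cvec B) :
    0 ≤ ((starRingEnd ℂ) u * (cvec C ⬝ᵥ ((Complex.I * ω) • x))).re := by
  by_cases hdet : ((Complex.I * ω) • (1 : Matrix (Fin n) (Fin n) ℂ) - cmat A).det = 0
  · obtain ⟨p, hp0, hpe⟩ := exists_left_eigenvector hdet
    have h1 := congrArg (fun y => p ⬝ᵥ y) hx
    simp only [dotProduct_add, dotProduct_smul] at h1
    rw [Matrix.dotProduct_mulVec, hpe, smul_dotProduct, left_eq_add, smul_eq_mul, mul_eq_zero] at h1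
    rcases h1 with h1 | h1
    · simp [h1]
    · exact absurd h1 (hmin.1.left_eigenvector_dotProduct_ne_zero hpe hp0)
  · rw [eq_smul_stateResponse hdet hx, dotProduct_smul, dotProduct_smul, ← transferFunction_eq]
    have h1 := hNI.im_nonpos hω hdet
    set G := transferFunction A B C (Complex.I * ω)
    have : (starRingEnd ℂ) u * ((Complex.I * ω) • u • G) =
        ((Complex.normSq u * ω : ℝ) : ℂ) * (Complex.I * G) := by
      rw [smul_eq_mul, smul_eq_mul]
      push_cast
      rw [Complex.normSq_eq_conj_mul_self]
      ring
    rw [this, Complex.re_ofReal_mul]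
    refine mul_nonneg (mul_nonneg (Complex.normSq_nonneg u) hω.le) ?_
    simpa using h1

theorem IsMinimalRealization.frequencyInequality (hmin : IsMinimalRealization A B C)
    (hNI : IsNegativeImaginary (transferFunction A B C)) : FrequencyInequality A B C := by
  intro ω x u hx
  rcases lt_trichotomy ω 0 with h | h | h
  · have hx' := congrArg star hx
    rw [star_add, star_smul, star_smul, star_cmat_mulVec, star_cvec] at hx'
    have e : star (Complex.I * (ω : ℂ)) = Complex.I * ((-ω : ℝ) : ℂ) := by
      simp
    rw [e] at hx'
    have h1 := supply_re_nonneg_of_pos hmin hNI (neg_pos.mpr h) (star x) (star u) hx'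
    have h2 : (starRingEnd ℂ) (star u) * (cvec C ⬝ᵥ ((Complex.I * ((-ω : ℝ) : ℂ)) • star x)) =
        (starRingEnd ℂ) ((starRingEnd ℂ) u * (cvec C ⬝ᵥ ((Complex.I * ω) • x))) := by
      rw [← e, ← star_smul, map_mul]
      congr 1
      simp [dotProduct]
    rw [h2, Complex.conj_re] at h1
    exact h1
  · simp [h]
  · exact supply_re_nonneg_of_pos hmin hNI h x u hx

theorem exists_norm_mulVec_le (M : Matrix (Fin n) (Fin n) ℂ) :
    ∃ a : ℝ, 0 ≤ a ∧ ∀ x, ‖M *ᵥ x‖ ≤ a * ‖x‖ :=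
  ⟨‖M.mulVecLin.toContinuousLinearMap‖, norm_nonneg _,
    fun x => M.mulVecLin.toContinuousLinearMap.le_opNorm x⟩

/-- `C B` is the limit of `Re (jω G(jω)) = -ω Im G(jω)` as `ω → ∞`. -/
theorem dotProduct_nonneg_of_negativeImaginary
    (hNI : IsNegativeImaginary (transferFunction A B C)) : 0 ≤ C ⬝ᵥ B := by
  obtain ⟨a, ha0, ha⟩ := exists_norm_mulVec_le (cmat A)
  have hdet : ∀ ω : ℝ, a < ω →
      ((Complex.I * ω) • (1 : Matrix (Fin n) (Fin n) ℂ) - cmat A).det ≠ 0 := by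
    intro ω hω hdet
    obtain ⟨v, hv, h⟩ := Matrix.exists_mulVec_eq_zero_iff.mpr hdet
    rw [Matrix.sub_mulVec, Matrix.smul_mulVec, Matrix.one_mulVec, sub_eq_zero] at h
    have h1 := ha v
    rw [← h, norm_smul, norm_mul, Complex.norm_I, one_mul, Complex.norm_real, Real.norm_eq_abs,
      abs_of_pos (ha0.trans_lt hω)] at h1
    have h2 : 0 < ‖v‖ := norm_pos_iff.mpr hv
    nlinarith
  have hr : Tendsto (fun ω : ℝ => stateResponse A B (Complex.I * ω)) atTop (𝓝 0) := by
    have hlim : Tendsto (fun ω : ℝ => ‖cvec B‖ / (ω - a)) atTop (𝓝 0) :=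
      (tendsto_atTop_add_const_right _ (-a) tendsto_id).const_div_atTop _
    refine squeeze_zero_norm' ?_ hlim
    filter_upwards [eventually_gt_atTop a] with ω hω
    have h1 := stateResponse_spec (B := B) (hdet ω hω)
    have h2 : ω * ‖stateResponse A B (Complex.I * ω)‖ ≤
        a * ‖stateResponse A B (Complex.I * ω)‖ + ‖cvec B‖ := by
      have h3 := congrArg norm h1
      rw [norm_smul, norm_mul, Complex.norm_I, one_mul, Complex.norm_real, Real.norm_eq_abs,
        abs_of_pos (ha0.trans_lt hω)] at h3
      rw [h3]
      exact (norm_add_le _ _).trans (add_le_add_left (ha _) _)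
    rw [le_div_iff₀ (by linarith)]
    linarith
  have hlim : Tendsto (fun ω : ℝ => (cvec C ⬝ᵥ (cmat A *ᵥ stateResponse A B (Complex.I * ω) +
      cvec B)).re) atTop (𝓝 (C ⬝ᵥ B)) := by
    have hcont : Continuous fun r : Fin n → ℂ => (cvec C ⬝ᵥ (cmat A *ᵥ r + cvec B)).re := by
      refine Complex.continuous_re.comp (Continuous.dotProduct continuous_const ?_)
      exact (Continuous.matrix_mulVec continuous_const continuous_id).add continuous_const
    have h1 := (hcont.tendsto 0).comp hr
    have h2 : (cvec C ⬝ᵥ (cmat A *ᵥ (0 : Fin n → ℂ) + cvec B)).re = C ⬝ᵥ B := by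
      rw [Matrix.mulVec_zero, zero_add, cvec_dotProduct, Complex.ofReal_re]
    rw [h2] at h1
    exact h1
  refine ge_of_tendsto hlim ?_
  filter_upwards [eventually_gt_atTop a] with ω hω
  have hω0 : 0 < ω := ha0.trans_lt hω
  rw [← stateResponse_spec (hdet ω hω), dotProduct_smul, ← transferFunction_eq, smul_eq_mul]
  have h1 := hNI.im_nonpos hω0 (hdet ω hω)
  simp only [Complex.mul_re, Complex.I_re, Complex.ofReal_re, Complex.I_im, Complex.ofReal_im,
    Complex.mul_im]
  nlinarith

theorem eigenvalue_re_nonpos (hmin : IsMinimalRealization A B C)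
    (hNI : IsNegativeImaginary (transferFunction A B C)) {s : ℂ} {v : Fin n → ℂ}
    (hv : cmat A *ᵥ v = s • v) (h0 : v ≠ 0) : s.re ≤ 0 ∧ s ≠ 0 :=
  hNI.poles s (hmin.isPole (det_eq_zero_of_eigenvector hv h0))

theorem det_ne_zero_of_negativeImaginary (hmin : IsMinimalRealization A B C)
    (hNI : IsNegativeImaginary (transferFunction A B C)) : A.det ≠ 0 := by
  intro hdet
  obtain ⟨v, hv, h⟩ := Matrix.exists_mulVec_eq_zero_iff.mpr hdet
  have h1 : cmat A *ᵥ cvec v = (0 : ℂ) • cvec v := by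
    rw [cmat_mulVec_cvec, h, zero_smul]
    funext i
    simp
  refine (eigenvalue_re_nonpos hmin hNI h1 ?_).2 rfl
  intro h2
  refine hv (funext fun i => ?_)
  have := congrFun h2 i
  simpa [cvec] using this

/-- Storage function of a negative imaginary plant: the output and input vectors are matched
through the storage matrix `P`. -/
theorem exists_storage_matrix (hmin : IsMinimalRealization A B C)
    (hNI : IsNegativeImaginary (transferFunction A B C)) :
    ∃ (P : Matrix (Fin n) (Fin n) ℝ) (b : Fin n → ℝ), Pᵀ = P ∧
      (∀ x, x ⬝ᵥ P *ᵥ (A *ᵥ x) ≤ 0) ∧ B = -(A *ᵥ b) ∧ P *ᵥ b = C := by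
  obtain ⟨P, hPs, hP⟩ := kalman_yakubovich_popov hmin.1 (hmin.frequencyInequality hNI)
    (dotProduct_nonneg_of_negativeImaginary hNI)
  have hu : IsUnit A.det := isUnit_iff_ne_zero.mpr (det_ne_zero_of_negativeImaginary hmin hNI)
  set b : Fin n → ℝ := -(A⁻¹ *ᵥ B) with hb
  have hAb : A *ᵥ b = -B := by
    rw [hb, Matrix.mulVec_neg, Matrix.mulVec_mulVec, Matrix.mul_nonsing_inv _ hu, Matrix.one_mulVec]
  refine ⟨P, b, hPs, fun x => ?_, by rw [hAb, neg_neg], ?_⟩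
  · simpa using hP x 0
  rw [← sub_eq_zero, ← dotProduct_eq_zero_iff]
  intro w
  set x : Fin n → ℝ := A⁻¹ *ᵥ w with hx
  have hAx : A *ᵥ x = w := by
    rw [hx, Matrix.mulVec_mulVec, Matrix.mul_nonsing_inv _ hu, Matrix.one_mulVec]
  rw [sub_dotProduct, ← neg_eq_zero, neg_sub]
  -- The pair `(b, 1)` is an equilibrium. On perturbing it to `(b + t x, 1)`, both sides of the
  -- dissipation inequality vanish at `t = 0`, so their linear terms agree: `bᵀ P w = C w`.
  apply eq_zero_of_quadratic_nonneg (c := -(x ⬝ᵥ P *ᵥ w))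
  intro t
  have h1 := hP (b + t • x) 1
  have e : A *ᵥ (b + t • x) + (1 : ℝ) • B = t • w := by
    rw [Matrix.mulVec_add, hAb, Matrix.mulVec_smul, hAx, one_smul]; abel
  have e2 : b ⬝ᵥ P *ᵥ w = P *ᵥ b ⬝ᵥ w := by
    rw [Matrix.dotProduct_mulVec, ← Matrix.mulVec_transpose, hPs]
  rw [e, Matrix.mulVec_smul, dotProduct_smul, dotProduct_smul, add_dotProduct, smul_dotProduct, e2,
    smul_eq_mul, smul_eq_mul, smul_eq_mul, one_mul] at h1
  nlinarith

end

end HIGS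

namespace HIGS

/-! ### Imaginary eigenvalues -/

noncomputable section

open Filter Topology

variable {n : ℕ} {A P : Matrix (Fin n) (Fin n) ℝ} {B C b : Fin n → ℝ}

theorem re_star_dotProduct (Q : Matrix (Fin n) (Fin n) ℝ) (v w : Fin n → ℂ) :
    (star v ⬝ᵥ cmat Q *ᵥ w).re = (fun i => (v i).re) ⬝ᵥ Q *ᵥ (fun i => (w i).re) +
      (fun i => (v i).im) ⬝ᵥ Q *ᵥ (fun i => (w i).im) := by
  rw [← re_cmat_mulVec, ← im_cmat_mulVec]
  simp only [dotProduct, Complex.re_sum, Pi.star_apply, Complex.mul_re, RCLike.star_def,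
    Complex.conj_re, Complex.conj_im, ← Finset.sum_add_distrib]
  exact Finset.sum_congr rfl fun i _ => by ring

theorem symm_dotProduct (hP : Pᵀ = P) (v w : Fin n → ℂ) :
    cmat P *ᵥ v ⬝ᵥ w = v ⬝ᵥ cmat P *ᵥ w := by
  rw [Matrix.dotProduct_mulVec, ← Matrix.mulVec_transpose, cmat_transpose, hP]

theorem star_form_symm (hP : Pᵀ = P) (v w : Fin n → ℂ) :
    (starRingEnd ℂ) (star v ⬝ᵥ cmat P *ᵥ w) = star w ⬝ᵥ cmat P *ᵥ v := by
  have h : (starRingEnd ℂ) (star v ⬝ᵥ cmat P *ᵥ w) = v ⬝ᵥ cmat P *ᵥ star w := by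
    rw [← star_cmat_mulVec]
    simp [dotProduct]
  rw [h, ← symm_dotProduct hP, dotProduct_comm]

/-- On an imaginary eigenvector the dissipation vanishes, so the gradient does too: `(P A + Aᵀ P) v
= 0`. Conjugating and using `s̄ = -s` gives the left eigenvector `P v̄`. -/
theorem left_eigenvector_of_dissipative (hP : Pᵀ = P) (hd : ∀ x, x ⬝ᵥ P *ᵥ (A *ᵥ x) ≤ 0)
    {s : ℂ} (hs : s.re = 0) {v : Fin n → ℂ} (hv : cmat A *ᵥ v = s • v) :
    (cmat P *ᵥ star v) ᵥ* cmat A = s • (cmat P *ᵥ star v) := by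
  set M := -(P * A) with hM
  have hMpos : ∀ x, 0 ≤ x ⬝ᵥ M *ᵥ x := by
    intro x
    rw [hM, Matrix.neg_mulVec, dotProduct_neg, ← Matrix.mulVec_mulVec]
    linarith [hd x]
  have him : (star v ⬝ᵥ cmat P *ᵥ v).im = 0 := by
    have := congrArg Complex.im (star_form_symm hP v v)
    rw [Complex.conj_im] at this
    linarith
  have h0 : (star v ⬝ᵥ cmat M *ᵥ v).re = 0 := by
    have e : cmat M = -(cmat P * cmat A) := by
      have : cmat (P * A) = cmat P * cmat A :=
        map_mul (RingHom.mapMatrix Complex.ofRealHom) P A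
      rw [← this, hM]
      ext i j
      simp
    rw [e, Matrix.neg_mulVec, ← Matrix.mulVec_mulVec, hv, Matrix.mulVec_smul, dotProduct_neg,
      dotProduct_smul, smul_eq_mul, Complex.neg_re, Complex.mul_re, hs, him]
    simp
  rw [re_star_dotProduct] at h0
  have h1 := hMpos (fun i => (v i).re)
  have h2 := hMpos (fun i => (v i).im)
  have h3 := mulVec_add_transpose_mulVec_eq_zero hMpos (le_antisymm (by linarith) h1)
  have h4 := mulVec_add_transpose_mulVec_eq_zero hMpos (le_antisymm (by linarith) h2)
  have e : ∀ x, M *ᵥ x + Mᵀ *ᵥ x = -(P *ᵥ (A *ᵥ x) + Aᵀ *ᵥ (P *ᵥ x)) := by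
    intro x
    rw [hM, Matrix.transpose_neg, Matrix.transpose_mul, hP, Matrix.neg_mulVec, Matrix.neg_mulVec,
      ← Matrix.mulVec_mulVec, ← Matrix.mulVec_mulVec]
    abel
  rw [e, neg_eq_zero] at h3 h4
  have h5 : cmat P *ᵥ (cmat A *ᵥ v) + cmat Aᵀ *ᵥ (cmat P *ᵥ v) = 0 := by
    refine ext_re_im ?_ ?_
    · have : (fun i => ((cmat P *ᵥ (cmat A *ᵥ v) + cmat Aᵀ *ᵥ (cmat P *ᵥ v)) i).re) =
          (fun i => ((cmat P *ᵥ (cmat A *ᵥ v)) i).re) +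
          fun i => ((cmat Aᵀ *ᵥ (cmat P *ᵥ v)) i).re := by
        funext i; simp
      rw [this, re_cmat_mulVec, re_cmat_mulVec, re_cmat_mulVec, re_cmat_mulVec, h3]
      funext i; simp
    · have : (fun i => ((cmat P *ᵥ (cmat A *ᵥ v) + cmat Aᵀ *ᵥ (cmat P *ᵥ v)) i).im) =
          (fun i => ((cmat P *ᵥ (cmat A *ᵥ v)) i).im) +
          fun i => ((cmat Aᵀ *ᵥ (cmat P *ᵥ v)) i).im := by
        funext i; simp
      rw [this, im_cmat_mulVec, im_cmat_mulVec, im_cmat_mulVec, im_cmat_mulVec, h4]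
      funext i; simp
  rw [hv, Matrix.mulVec_smul] at h5
  have h6 := congrArg star h5
  rw [star_add, star_smul, star_cmat_mulVec, star_cmat_mulVec, star_cmat_mulVec, star_zero] at h6
  have hstar : star s = -s := by
    apply Complex.ext <;> simp [hs]
  rw [hstar, neg_smul, neg_add_eq_zero] at h6
  rw [← Matrix.mulVec_transpose, cmat_transpose, ← h6]

/-- The vector is the limit of `j (s - jω) (s - A)⁻¹ B`. It exists because the output residue does
and the plant is observable. -/
theorem exists_residue_vector (hmin : IsMinimalRealization A B C)
    (hNI : IsNegativeImaginary (transferFunction A B C)) {ω : ℝ} (hω : 0 < ω)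
    {v : Fin n → ℂ} (hv : cmat A *ᵥ v = (Complex.I * ω) • v) (h0 : v ≠ 0) :
    ∃ (x : Fin n → ℂ) (K : ℂ), 0 ≤ K ∧ cmat A *ᵥ x = (Complex.I * ω) • x ∧ cvec C ⬝ᵥ x = K ∧
      ∀ p : Fin n → ℂ, p ᵥ* cmat A = (Complex.I * ω) • p →
        p ⬝ᵥ x = Complex.I * (p ⬝ᵥ cvec B) := by
  set s₀ : ℂ := Complex.I * ω with hs₀
  obtain ⟨K, hK, hlim⟩ := hNI.residue ω hω (hmin.isPole (det_eq_zero_of_eigenvector hv h0))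
  rw [← hs₀] at hlim
  set c : ℂ → ℂ := fun s => (s - s₀) * Complex.I with hcdef
  have hid : Tendsto id (𝓝[≠] s₀) (𝓝 s₀) := nhdsWithin_le_nhds
  have hc : Tendsto c (𝓝[≠] s₀) (𝓝 0) := by
    have : Continuous c := by fun_prop
    have h1 := (this.tendsto s₀).mono_left (nhdsWithin_le_nhds (s := {s₀}ᶜ))
    simpa [hcdef] using h1
  have hr : ∀ᶠ s in 𝓝[≠] s₀, s • stateResponse A B s =
      cmat A *ᵥ stateResponse A B s + cvec B := by
    filter_upwards [eventually_det_ne_zero A s₀] with s hs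
    exact stateResponse_spec hs
  have hlim' : Tendsto (fun s => c s * (cvec C ⬝ᵥ stateResponse A B s)) (𝓝[≠] s₀) (𝓝 K) := by
    refine hlim.congr fun s => ?_
    rw [transferFunction_eq]; ring
  obtain ⟨x, hx⟩ := hmin.2.exists_tendsto_state hid hc hr hlim'
  refine ⟨x, K, hK, ?_, ?_, ?_⟩
  · have h1 : Tendsto (fun s => s • (c s • stateResponse A B s)) (𝓝[≠] s₀) (𝓝 (s₀ • x)) :=
      hid.smul hx
    have h2 : Tendsto (fun s => cmat A *ᵥ (c s • stateResponse A B s) + c s • cvec B) (𝓝[≠] s₀)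
        (𝓝 (cmat A *ᵥ x + (0 : ℂ) • cvec B)) :=
      ((Continuous.matrix_mulVec continuous_const continuous_id).continuousAt.tendsto.comp hx).add
        (hc.smul_const _)
    rw [zero_smul, add_zero] at h2
    refine (tendsto_nhds_unique (h1.congr' ?_) h2).symm
    filter_upwards [hr] with s hs
    rw [smul_comm, hs, smul_add, Matrix.mulVec_smul]
  · have h1 : Tendsto (fun s => cvec C ⬝ᵥ (c s • stateResponse A B s)) (𝓝[≠] s₀)
        (𝓝 (cvec C ⬝ᵥ x)) :=
      (Continuous.dotProduct continuous_const continuous_id).continuousAt.tendsto.comp hx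
    exact tendsto_nhds_unique (h1.congr fun s => by rw [dotProduct_smul, smul_eq_mul]) hlim'
  · intro p hp
    have h1 : Tendsto (fun s => p ⬝ᵥ (c s • stateResponse A B s)) (𝓝[≠] s₀) (𝓝 (p ⬝ᵥ x)) :=
      (Continuous.dotProduct continuous_const continuous_id).continuousAt.tendsto.comp hx
    refine tendsto_nhds_unique (h1.congr' ?_) tendsto_const_nhds
    filter_upwards [hr] with s hs
    have h2 := congrArg (fun y => p ⬝ᵥ y) hs
    simp only [dotProduct_add, dotProduct_smul] at h2
    rw [Matrix.dotProduct_mulVec, hp, smul_dotProduct, smul_eq_mul, smul_eq_mul] at h2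
    rw [dotProduct_smul, smul_eq_mul, hcdef]
    linear_combination Complex.I * h2

/-- On the eigenspace of an eigenvalue `jω`, `ω > 0`, the storage form is nonnegative, and the
eigenvalue is semisimple. -/
theorem imaginary_eigenspace_of_pos (hmin : IsMinimalRealization A B C)
    (hNI : IsNegativeImaginary (transferFunction A B C)) (hP : Pᵀ = P)
    (hd : ∀ x, x ⬝ᵥ P *ᵥ (A *ᵥ x) ≤ 0) (hB : B = -(A *ᵥ b)) (hC : P *ᵥ b = C)
    {ω : ℝ} (hω : 0 < ω) {v : Fin n → ℂ} (hv : cmat A *ᵥ v = (Complex.I * ω) • v) :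
    0 ≤ (star v ⬝ᵥ cmat P *ᵥ v).re ∧
      ∀ w, cmat A *ᵥ w = (Complex.I * ω) • w + v → v = 0 := by
  by_cases h0 : v = 0
  · simp [h0]
  have hs : (Complex.I * (ω : ℂ)).re = 0 := by simp
  obtain ⟨x, K, hK, hxA, hxC, hxp⟩ := exists_residue_vector hmin hNI hω hv h0
  -- The left eigenvector `P ȳ`, applied to the residue vector, gives `j (P ȳ)ᵀ B`; then `B = -A b`
  -- and `P b = C` turn it into the output of `y`. For `y = x` this is `ω` times the residue.
  have hform : ∀ y, cmat A *ᵥ y = (Complex.I * ω) • y →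
      star y ⬝ᵥ cmat P *ᵥ x = ω * (starRingEnd ℂ) (cvec C ⬝ᵥ y) := by
    intro y hy
    have hp := left_eigenvector_of_dissipative hP hd hs hy
    rw [← symm_dotProduct hP, hxp _ hp]
    have h1 : cvec B = -(cmat A *ᵥ cvec b) := by
      rw [cmat_mulVec_cvec, hB]
      funext i; simp [cvec]
    have h2 : cmat P *ᵥ star y ⬝ᵥ cvec b = (starRingEnd ℂ) (cvec C ⬝ᵥ y) := by
      rw [symm_dotProduct hP, cmat_mulVec_cvec, hC]
      simp [dotProduct, mul_comm]
    rw [h1, dotProduct_neg, Matrix.dotProduct_mulVec, hp, smul_dotProduct, h2, smul_eq_mul]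
    linear_combination (-(ω : ℂ) * (starRingEnd ℂ) (cvec C ⬝ᵥ y)) * Complex.I_mul_I
  have hωc : (ω : ℂ) ≠ 0 := by exact_mod_cast hω.ne'
  have hCv := hmin.2.eigenvector_dotProduct_ne_zero hv h0
  have hx0 : x ≠ 0 := by
    intro hx
    have := hform v hv
    rw [hx, Matrix.mulVec_zero, dotProduct_zero] at this
    rcases mul_eq_zero.mp this.symm with h | h
    · exact hωc h
    · exact hCv ((map_eq_zero _).mp h)
  have hCx := hmin.2.eigenvector_dotProduct_ne_zero hxA hx0
  set α := (cvec C ⬝ᵥ v) / (cvec C ⬝ᵥ x) with hα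
  -- The output is injective on an eigenspace by observability, so the eigenspace is a line.
  have hvx : v = α • x := by
    by_contra hne
    refine hmin.2.eigenvector_dotProduct_ne_zero (v := v - α • x) (s := Complex.I * ω) ?_
      (sub_ne_zero.mpr hne) ?_
    · rw [Matrix.mulVec_sub, Matrix.mulVec_smul, hv, hxA, smul_sub, smul_comm α]
    · rw [dotProduct_sub, dotProduct_smul, smul_eq_mul, hα, div_mul_cancel₀ _ hCx, sub_self]
  constructor
  · have h1 := hform x hxA
    have h2 : star v ⬝ᵥ cmat P *ᵥ v = ((Complex.normSq α * ω : ℝ) : ℂ) * (starRingEnd ℂ) K := by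
      rw [hvx, star_smul, Matrix.mulVec_smul, smul_dotProduct, dotProduct_smul, h1, hxC,
        smul_eq_mul, smul_eq_mul]
      push_cast
      rw [Complex.normSq_eq_conj_mul_self, RCLike.star_def]
      ring
    rw [h2, Complex.re_ofReal_mul, Complex.conj_re]
    exact mul_nonneg (mul_nonneg (Complex.normSq_nonneg _) hω.le) (Complex.le_def.mp hK).1
  -- Semisimplicity: applied to `A w = jω w + v`, the left eigenvector `P x̄` gives `(P x̄)ᵀ v = 0`,
  -- hence `C v = 0`. Thus a nonzero `v` is impossible.
  · intro w hw
    have hp := left_eigenvector_of_dissipative hP hd hs hxA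
    have h1 := congrArg (fun y => (cmat P *ᵥ star x) ⬝ᵥ y) hw
    simp only [dotProduct_add, dotProduct_smul] at h1
    rw [Matrix.dotProduct_mulVec, hp, smul_dotProduct, left_eq_add, symm_dotProduct hP,
      ← star_form_symm hP, hform v hv] at h1
    exfalso
    rcases mul_eq_zero.mp ((map_eq_zero _).mp h1) with h | h
    · exact hωc h
    · exact hCv ((map_eq_zero _).mp h)

theorem imaginary_eigenspace (hmin : IsMinimalRealization A B C)
    (hNI : IsNegativeImaginary (transferFunction A B C)) (hP : Pᵀ = P)
    (hd : ∀ x, x ⬝ᵥ P *ᵥ (A *ᵥ x) ≤ 0) (hB : B = -(A *ᵥ b)) (hC : P *ᵥ b = C)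
    {s : ℂ} (hs : s.re = 0) {v : Fin n → ℂ} (hv : cmat A *ᵥ v = s • v) :
    0 ≤ (star v ⬝ᵥ cmat P *ᵥ v).re ∧ ∀ w, cmat A *ᵥ w = s • w + v → v = 0 := by
  by_cases h0 : v = 0
  · simp [h0]
  have hsI : s = Complex.I * (s.im : ℂ) := by
    apply Complex.ext <;> simp [hs]
  have hs0 := (eigenvalue_re_nonpos hmin hNI hv h0).2
  rcases lt_trichotomy s.im 0 with h | h | h
  · have hstar : star s = Complex.I * ((-s.im : ℝ) : ℂ) := by
      apply Complex.ext <;> simp [hs]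
    have hv' := congrArg star hv
    rw [star_cmat_mulVec, star_smul, hstar] at hv'
    obtain ⟨h1, h2⟩ := imaginary_eigenspace_of_pos hmin hNI hP hd hB hC (neg_pos.mpr h) hv'
    refine ⟨?_, fun w hw => ?_⟩
    · rw [star_star, ← symm_dotProduct hP, dotProduct_comm] at h1
      exact h1
    · refine star_eq_zero.mp (h2 (star w) ?_)
      have hw' := congrArg star hw
      rwa [star_cmat_mulVec, star_add, star_smul, hstar] at hw'
  · exact absurd (hsI.trans (by simp [h])) hs0
  · rw [hsI] at hv ⊢
    exact imaginary_eigenspace_of_pos hmin hNI hP hd hB hC h hv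

/-- Left and right eigenvectors to different eigenvalues annihilate each other. Nonnegativity of the
form thereby passes from the eigenspaces to their span. -/
theorem form_eq_zero_of_ne (hP : Pᵀ = P) (hd : ∀ x, x ⬝ᵥ P *ᵥ (A *ᵥ x) ≤ 0)
    {s t : ℂ} (hs : s.re = 0) (hst : s ≠ t) {v w : Fin n → ℂ} (hv : cmat A *ᵥ v = s • v)
    (hw : cmat A *ᵥ w = t • w) : star v ⬝ᵥ cmat P *ᵥ w = 0 := by
  have hp := left_eigenvector_of_dissipative hP hd hs hv
  rw [← symm_dotProduct hP]
  have h1 : (cmat P *ᵥ star v) ⬝ᵥ (cmat A *ᵥ w) = t * ((cmat P *ᵥ star v) ⬝ᵥ w) := by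
    rw [hw, dotProduct_smul, smul_eq_mul]
  rw [Matrix.dotProduct_mulVec, hp, smul_dotProduct, smul_eq_mul] at h1
  have h2 : (s - t) * ((cmat P *ᵥ star v) ⬝ᵥ w) = 0 := by rw [sub_mul, h1, sub_self]
  exact (mul_eq_zero.mp h2).resolve_left (sub_ne_zero.mpr hst)

/-- The span of the eigenvectors to purely imaginary eigenvalues. -/
def imaginarySpace (A : Matrix (Fin n) (Fin n) ℝ) : Submodule ℂ (Fin n → ℂ) :=
  ⨆ s : {s : ℂ // s.re = 0}, Module.End.eigenspace (cmat A).mulVecLin (s : ℂ)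

theorem form_nonneg_of_mem_imaginarySpace (hmin : IsMinimalRealization A B C)
    (hNI : IsNegativeImaginary (transferFunction A B C)) (hP : Pᵀ = P)
    (hd : ∀ x, x ⬝ᵥ P *ᵥ (A *ᵥ x) ≤ 0) (hB : B = -(A *ᵥ b)) (hC : P *ᵥ b = C)
    {v : Fin n → ℂ} (hv : v ∈ imaginarySpace A) : 0 ≤ (star v ⬝ᵥ cmat P *ᵥ v).re := by
  obtain ⟨z, hz, hs⟩ := (Submodule.mem_iSup_iff_exists_finsupp _ _).mp hv
  have hz' : ∀ s, cmat A *ᵥ z s = (s : ℂ) • z s := fun s =>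
    Module.End.mem_eigenspace_iff.mp (hz s)
  have hsum : v = ∑ s ∈ z.support, z s := hs.symm
  rw [hsum, Matrix.mulVec_sum, dotProduct_sum, Complex.re_sum]
  refine Finset.sum_nonneg fun s hs => ?_
  have : star (∑ s ∈ z.support, z s) ⬝ᵥ cmat P *ᵥ z s = star (z s) ⬝ᵥ cmat P *ᵥ z s := by
    rw [star_sum, sum_dotProduct]
    refine Finset.sum_eq_single s (fun t _ hts => ?_) fun h => absurd hs h
    exact form_eq_zero_of_ne hP hd t.2 (fun h => hts (Subtype.ext h)) (hz' t) (hz' s)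
  rw [this]
  exact (imaginary_eigenspace hmin hNI hP hd hB hC s.2 (hz' s)).1

end

end HIGS

namespace HIGS

/-! ### The negative imaginary lemma -/

noncomputable section

open Filter Topology

variable {n : ℕ} {A P : Matrix (Fin n) (Fin n) ℝ} {B C b : Fin n → ℝ}

theorem HasDerivAt.mulVec {z : ℝ → Fin n → ℂ} {z' : Fin n → ℂ} {t : ℝ} (M : Matrix (Fin n) (Fin n) ℂ)
    (h : HasDerivAt z z' t) : HasDerivAt (fun t => M *ᵥ z t) (M *ᵥ z') t :=
  ((M.mulVecLin.restrictScalars ℝ).toContinuousLinearMap.hasFDerivAt.comp_hasDerivAt t h)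

/-- The partial sums `∑_{j<k} tʲ/j! Dʲ v`. -/
def expPartialSum (D : Matrix (Fin n) (Fin n) ℂ) (v : Fin n → ℂ) (k : ℕ) (t : ℝ) : Fin n → ℂ :=
  ∑ j ∈ Finset.range k, ((t ^ j / (j.factorial : ℝ) : ℝ) : ℂ) • (D ^ j *ᵥ v)

theorem hasDerivAt_expPartialSum (D : Matrix (Fin n) (Fin n) ℂ) (v : Fin n → ℂ) (k : ℕ) (t : ℝ) :
    HasDerivAt (expPartialSum D v (k + 1)) (D *ᵥ expPartialSum D v k t) t := by
  induction k with
  | zero =>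
    have : expPartialSum D v (0 + 1) = fun _ => v := by
      funext t; simp [expPartialSum]
    rw [this]
    simpa [expPartialSum] using hasDerivAt_const t v
  | succ k ih =>
    have h1 : expPartialSum D v (k + 1 + 1) = fun t => expPartialSum D v (k + 1) t +
        ((t ^ (k + 1) / ((k + 1).factorial : ℝ) : ℝ) : ℂ) • (D ^ (k + 1) *ᵥ v) := by
      funext t; rw [expPartialSum, Finset.sum_range_succ]; rfl
    have h2 : expPartialSum D v (k + 1) t = expPartialSum D v k t +
        ((t ^ k / (k.factorial : ℝ) : ℝ) : ℂ) • (D ^ k *ᵥ v) := by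
      rw [expPartialSum, Finset.sum_range_succ]; rfl
    rw [h1, h2, Matrix.mulVec_add, Matrix.mulVec_smul, Matrix.mulVec_mulVec, ← pow_succ']
    refine ih.add (HasDerivAt.smul_const ?_ _)
    have h3 : HasDerivAt (fun t : ℝ => t ^ (k + 1) / ((k + 1).factorial : ℝ))
        (t ^ k / (k.factorial : ℝ)) t := by
      have h4 := (hasDerivAt_pow (k + 1) t).div_const ((k + 1).factorial : ℝ)
      convert! h4 using 1
      rw [Nat.factorial_succ]
      have : (k.factorial : ℝ) ≠ 0 := by positivity
      push_cast
      field_simp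
    exact h3.ofReal_comp

theorem hasDerivAt_cexp_mul (s : ℂ) (t : ℝ) :
    HasDerivAt (fun t : ℝ => Complex.exp (s * t)) (s * Complex.exp (s * t)) t := by
  have h1 : HasDerivAt (fun t : ℝ => s * (t : ℂ)) s t := by
    simpa using (Complex.ofRealCLM.hasDerivAt (x := t)).const_mul s
  simpa [mul_comm] using h1.cexp

theorem exists_decaying_solution {s : ℂ} (hs : s.re < 0) {v : Fin n → ℂ} {k : ℕ}
    (hv : (cmat A - s • 1) ^ k *ᵥ v = 0) :
    ∃ z : ℝ → Fin n → ℂ, z 0 = v ∧ (∀ t, HasDerivAt z (cmat A *ᵥ z t) t) ∧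
      Tendsto z atTop (𝓝 0) := by
  set D := cmat A - s • (1 : Matrix (Fin n) (Fin n) ℂ) with hD
  refine ⟨fun t => Complex.exp (s * t) • expPartialSum D v (k + 1) t, ?_, fun t => ?_, ?_⟩
  · simp [expPartialSum, Finset.sum_range_succ']
  · have h1 := (hasDerivAt_cexp_mul s t).smul (hasDerivAt_expPartialSum D v k t)
    convert! h1 using 1
    beta_reduce
    -- The last term carries `Dᵏ v = 0`; this absorbs the degree lost by differentiation.
    have h2 : expPartialSum D v (k + 1) t = expPartialSum D v k t := by
      rw [expPartialSum, Finset.sum_range_succ, hv, smul_zero, add_zero]; rfl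
    rw [h2, Matrix.mulVec_smul, hD, Matrix.sub_mulVec, Matrix.smul_mulVec, Matrix.one_mulVec,
      smul_sub, mul_smul, smul_comm s]
    abel
  · simp only [expPartialSum, Finset.smul_sum]
    have h0 : (0 : Fin n → ℂ) = ∑ j ∈ Finset.range (k + 1), (0 : Fin n → ℂ) := by simp
    rw [h0]
    refine tendsto_finsetSum _ fun j _ => ?_
    simp only [smul_smul]
    rw [← zero_smul ℂ (D ^ j *ᵥ v)]
    refine Tendsto.smul_const ?_ _
    rw [tendsto_zero_iff_norm_tendsto_zero]
    have h1 : Tendsto (fun t : ℝ => t ^ j / Real.exp (-s.re * t)) atTop (𝓝 0) :=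
      (isLittleO_pow_exp_pos_mul_atTop j (neg_pos.mpr hs)).tendsto_div_nhds_zero
    have h2 := (h1.norm.div_const (j.factorial : ℝ))
    rw [norm_zero, zero_div] at h2
    refine h2.congr fun t => ?_
    rw [norm_mul, Complex.norm_exp, Complex.norm_real, norm_div, norm_div, Real.norm_eq_abs,
      Real.norm_eq_abs, Real.norm_eq_abs, Real.abs_exp, Nat.abs_cast]
    have : (s * (t : ℂ)).re = -(-s.re * t) := by simp
    rw [this, Real.exp_neg]
    ring

/-- A solution of `ż = A z` that splits into a decaying part and a bounded part in the imaginary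
space. -/
def SplitSolution (A : Matrix (Fin n) (Fin n) ℝ) (v : Fin n → ℂ) : Prop :=
  ∃ z zs zi : ℝ → Fin n → ℂ, z 0 = v ∧ (∀ t, HasDerivAt z (cmat A *ᵥ z t) t) ∧
    (∀ t, z t = zs t + zi t) ∧ Tendsto zs atTop (𝓝 0) ∧ (∃ M, ∀ t, ‖zi t‖ ≤ M) ∧
    ∀ t, zi t ∈ imaginarySpace A

theorem SplitSolution.add {v w : Fin n → ℂ} (hv : SplitSolution A v) (hw : SplitSolution A w) :
    SplitSolution A (v + w) := by
  obtain ⟨z, zs, zi, h1, h2, h3, h4, ⟨M, h5⟩, h6⟩ := hv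
  obtain ⟨y, ys, yi, k1, k2, k3, k4, ⟨N, k5⟩, k6⟩ := hw
  refine ⟨z + y, zs + ys, zi + yi, by simp [h1, k1], fun t => ?_, fun t => ?_, ?_,
    ⟨M + N, fun t => ?_⟩, fun t => Submodule.add_mem _ (h6 t) (k6 t)⟩
  · rw [Pi.add_apply, Matrix.mulVec_add]; exact (h2 t).add (k2 t)
  · simp only [Pi.add_apply, h3, k3]; abel
  · have := h4.add k4
    rw [add_zero] at this
    exact this
  · exact (norm_add_le _ _).trans (add_le_add (h5 t) (k5 t))

theorem splitSolution (hmin : IsMinimalRealization A B C)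
    (hNI : IsNegativeImaginary (transferFunction A B C)) (hP : Pᵀ = P)
    (hd : ∀ x, x ⬝ᵥ P *ᵥ (A *ᵥ x) ≤ 0) (hB : B = -(A *ᵥ b)) (hC : P *ᵥ b = C)
    (v : Fin n → ℂ) : SplitSolution A v := by
  have hzero : SplitSolution A 0 :=
    ⟨0, 0, 0, rfl, fun t => by simp, fun t => by simp,
      tendsto_const_nhds, ⟨0, fun t => by simp⟩, fun t => Submodule.zero_mem _⟩
  have htop := Module.End.iSup_maxGenEigenspace_eq_top (cmat A).mulVecLin
  have hv : v ∈ ⨆ s, Module.End.maxGenEigenspace (cmat A).mulVecLin s := by rw [htop]; trivial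
  refine Submodule.iSup_induction _ (motive := SplitSolution A) hv (fun s w hw => ?_) hzero
    (fun x y => SplitSolution.add)
  obtain ⟨k, hk⟩ := (Module.End.mem_maxGenEigenspace _ _ _).mp hw
  have hkM : ∀ (k : ℕ) (w : Fin n → ℂ),
      (((cmat A).mulVecLin - s • (1 : Module.End ℂ (Fin n → ℂ))) ^ k) w =
        (cmat A - s • 1) ^ k *ᵥ w := by
    intro k w
    induction k generalizing w with
    | zero => simp
    | succ k ih =>
      rw [pow_succ, Module.End.mul_apply, ih, pow_succ, ← Matrix.mulVec_mulVec]
      congr 1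
      simp [Matrix.sub_mulVec, Matrix.smul_mulVec]
  rw [hkM] at hk
  by_cases h0 : ∃ u : Fin n → ℂ, u ≠ 0 ∧ cmat A *ᵥ u = s • u
  · obtain ⟨u, hu0, hu⟩ := h0
    rcases (eigenvalue_re_nonpos hmin hNI hu hu0).1.lt_or_eq with hs | hs
    · obtain ⟨z, hz0, hz, hzl⟩ := exists_decaying_solution hs hk
      exact ⟨z, z, 0, hz0, hz, fun t => by simp, hzl, ⟨0, fun t => by simp⟩,
        fun t => Submodule.zero_mem _⟩
    -- Semisimplicity collapses generalized eigenvectors to eigenvectors, so imaginary modes carry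
    -- no polynomial growth.
    · have hred : ∀ (k : ℕ) (w : Fin n → ℂ), (cmat A - s • 1) ^ k *ᵥ w = 0 →
          cmat A *ᵥ w = s • w := by
        intro k
        induction k with
        | zero => intro w hw; simp at hw; simp [hw]
        | succ k ih =>
          intro w hw
          rw [pow_succ, ← Matrix.mulVec_mulVec] at hw
          have h1 := ih _ hw
          have h2 := (imaginary_eigenspace hmin hNI hP hd hB hC hs h1).2 w (by
            rw [Matrix.sub_mulVec, Matrix.smul_mulVec, Matrix.one_mulVec]; abel)
          rw [Matrix.sub_mulVec, Matrix.smul_mulVec, Matrix.one_mulVec, sub_eq_zero] at h2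
          exact h2
      have hws := hred k w hk
      refine ⟨fun t => Complex.exp (s * t) • w, 0, fun t => Complex.exp (s * t) • w, by simp,
        fun t => ?_, fun t => by simp, tendsto_const_nhds, ⟨‖w‖, fun t => ?_⟩, fun t => ?_⟩
      · have h1 := (hasDerivAt_cexp_mul s t).smul_const w
        convert! h1 using 1
        rw [Matrix.mulVec_smul, hws, smul_smul, mul_comm]
      · rw [norm_smul, Complex.norm_exp]
        simp [hs]
      · refine Submodule.smul_mem _ _ ?_
        exact Submodule.mem_iSup_of_mem (⟨s, hs⟩ : {s : ℂ // s.re = 0})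
          (Module.End.mem_eigenspace_iff.mpr hws)
  · have hw0 : w = 0 := by
      have : ∀ (k : ℕ) (w : Fin n → ℂ), (cmat A - s • 1) ^ k *ᵥ w = 0 → w = 0 := by
        intro k
        induction k with
        | zero => intro w hw; simpa using hw
        | succ k ih =>
          intro w hw
          rw [pow_succ, ← Matrix.mulVec_mulVec] at hw
          have h1 := ih _ hw
          by_contra hne
          refine h0 ⟨w, hne, ?_⟩
          rwa [Matrix.sub_mulVec, Matrix.smul_mulVec, Matrix.one_mulVec, sub_eq_zero] at h1
      exact this k w hk
    rw [hw0]; exact hzero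

/-- Along `ż = A z` the form `z* P z` decreases. Its limit inferior is nonnegative: the decaying
part contributes `o(1)`, and the form is nonnegative on the bounded imaginary part. Hence its
initial value is nonnegative. -/
theorem storage_nonneg (hmin : IsMinimalRealization A B C)
    (hNI : IsNegativeImaginary (transferFunction A B C)) (hP : Pᵀ = P)
    (hd : ∀ x, x ⬝ᵥ P *ᵥ (A *ᵥ x) ≤ 0) (hB : B = -(A *ᵥ b)) (hC : P *ᵥ b = C)
    (x : Fin n → ℝ) : 0 ≤ x ⬝ᵥ P *ᵥ x := by
  obtain ⟨z, zs, zi, h0, hz, hsplit, hzs, ⟨M, hM⟩, hzi⟩ :=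
    splitSolution hmin hNI hP hd hB hC (cvec x)
  set h : (Fin n → ℂ) → ℝ := fun v => (star v ⬝ᵥ cmat P *ᵥ v).re with hh
  have hderiv : ∀ t, HasDerivAt (fun t => h (z t))
      (2 * (star (z t) ⬝ᵥ cmat P *ᵥ (cmat A *ᵥ z t)).re) t := by
    intro t
    have h1 : HasDerivAt (fun t => star (z t) ⬝ᵥ cmat P *ᵥ z t)
        (star (cmat A *ᵥ z t) ⬝ᵥ cmat P *ᵥ z t + star (z t) ⬝ᵥ cmat P *ᵥ (cmat A *ᵥ z t)) t := by
      simp only [dotProduct, ← Finset.sum_add_distrib]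
      refine HasDerivAt.fun_sum fun i _ => ?_
      have h2 := (hasDerivAt_pi.mp (hz t) i).star
      have h3 := hasDerivAt_pi.mp (HasDerivAt.mulVec (cmat P) (hz t)) i
      exact h2.mul h3
    have h4 := Complex.reCLM.hasFDerivAt.comp_hasDerivAt t h1
    convert! h4 using 1
    have h5 := congrArg Complex.re (star_form_symm hP (z t) (cmat A *ᵥ z t))
    rw [Complex.conj_re] at h5
    rw [Complex.reCLM_apply, Complex.add_re, ← h5]
    ring
  have hanti : Antitone fun t => h (z t) := by
    refine antitone_of_deriv_nonpos (fun t => (hderiv t).differentiableAt) fun t => ?_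
    rw [(hderiv t).deriv, re_star_dotProduct, re_cmat_mulVec, im_cmat_mulVec]
    linarith [hd fun i => (z t i).re, hd fun i => (z t i).im]
  obtain ⟨a, ha0, ha⟩ := exists_norm_mulVec_le (cmat P)
  have hbound : ∀ v w : Fin n → ℂ, |(star v ⬝ᵥ cmat P *ᵥ w).re| ≤ n * (‖v‖ * (a * ‖w‖)) := by
    intro v w
    refine (Complex.abs_re_le_norm _).trans ?_
    rw [dotProduct]
    refine (norm_sum_le _ _).trans ?_
    have : ∀ i ∈ Finset.univ, ‖star v i * (cmat P *ᵥ w) i‖ ≤ ‖v‖ * (a * ‖w‖) := by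
      intro i _
      rw [norm_mul]
      refine mul_le_mul ?_ ((norm_le_pi_norm _ i).trans (ha w)) (norm_nonneg _) (norm_nonneg _)
      rw [Pi.star_apply, norm_star]
      exact norm_le_pi_norm v i
    refine (Finset.sum_le_card_nsmul _ _ _ this).trans ?_
    simp
  have hlow : ∀ t, -(n * (‖zs t‖ * (a * ‖zs t‖)) + 2 * (n * (‖zs t‖ * (a * M)))) ≤ h (z t) := by
    intro t
    have h1 : h (z t) = h (zs t) + 2 * (star (zs t) ⬝ᵥ cmat P *ᵥ zi t).re + h (zi t) := by
      have h5 := congrArg Complex.re (star_form_symm hP (zs t) (zi t))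
      rw [Complex.conj_re] at h5
      simp only [hh, hsplit t, star_add, Matrix.mulVec_add, add_dotProduct, dotProduct_add,
        Complex.add_re, ← h5]
      ring
    have h2 := form_nonneg_of_mem_imaginarySpace hmin hNI hP hd hB hC (hzi t)
    have h3 := neg_le_of_abs_le (hbound (zs t) (zs t))
    have h4 := neg_le_of_abs_le (hbound (zs t) (zi t))
    have h5 : n * (‖zs t‖ * (a * ‖zi t‖)) ≤ n * (‖zs t‖ * (a * M)) := by
      gcongr
      exact hM t
    rw [h1]
    linarith
  have hlim : Tendsto (fun t => -(n * (‖zs t‖ * (a * ‖zs t‖)) + 2 * (n * (‖zs t‖ * (a * M)))))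
      atTop (𝓝 0) := by
    have h1 := hzs.norm
    rw [norm_zero] at h1
    have hcont : Continuous fun r : ℝ => -(n * (r * (a * r)) + 2 * (n * (r * (a * M)))) := by
      fun_prop
    have h2 := (hcont.tendsto 0).comp h1
    rw [zero_mul, zero_mul, mul_zero, mul_zero, add_zero, neg_zero] at h2
    exact h2
  have hx : h (z 0) = x ⬝ᵥ P *ᵥ x := by
    simp only [hh]
    rw [h0, re_star_dotProduct]
    simp [cvec, dotProduct, Matrix.mulVec]
  rw [← hx]
  refine le_of_tendsto hlim ?_
  filter_upwards [eventually_ge_atTop 0] with t ht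
  exact (hlow t).trans (hanti ht)

/-- The kernel of `P` is `A`-invariant by dissipativity and lies in the kernel of `C = P b`, so
observability makes it trivial. -/
theorem storage_pos (hmin : IsMinimalRealization A B C)
    (hNI : IsNegativeImaginary (transferFunction A B C)) (hP : Pᵀ = P)
    (hd : ∀ x, x ⬝ᵥ P *ᵥ (A *ᵥ x) ≤ 0) (hB : B = -(A *ᵥ b)) (hC : P *ᵥ b = C)
    {x : Fin n → ℝ} (hx : x ≠ 0) : 0 < x ⬝ᵥ P *ᵥ x := by
  have hnn := storage_nonneg hmin hNI hP hd hB hC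
  refine (hnn x).lt_of_ne fun heq => hx ?_
  have hker : ∀ y, y ⬝ᵥ P *ᵥ y = 0 → P *ᵥ y = 0 := by
    intro y hy
    have := mulVec_add_transpose_mulVec_eq_zero hnn hy
    rw [hP, ← two_smul ℝ, smul_eq_zero] at this
    exact this.resolve_left two_ne_zero
  have hinv : ∀ y, P *ᵥ y = 0 → P *ᵥ (A *ᵥ y) = 0 := by
    intro y hy
    have hpos : ∀ x, 0 ≤ x ⬝ᵥ (-(P * A)) *ᵥ x := by
      intro x
      rw [Matrix.neg_mulVec, dotProduct_neg, ← Matrix.mulVec_mulVec]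
      linarith [hd x]
    have h1 := mulVec_add_transpose_mulVec_eq_zero hpos (v := y) (by
      rw [Matrix.neg_mulVec, dotProduct_neg, ← Matrix.mulVec_mulVec, Matrix.dotProduct_mulVec,
        ← Matrix.mulVec_transpose, hP, hy, zero_dotProduct, neg_zero])
    rw [Matrix.transpose_neg, Matrix.transpose_mul, hP, Matrix.neg_mulVec, Matrix.neg_mulVec,
      ← Matrix.mulVec_mulVec, ← Matrix.mulVec_mulVec, hy, Matrix.mulVec_zero, neg_zero, add_zero,
      neg_eq_zero] at h1
    exact h1
  refine hmin.2.eq_zero fun k => ?_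
  have hk : P *ᵥ (A ^ k *ᵥ x) = 0 := by
    induction k with
    | zero => simpa using hker x heq.symm
    | succ k ih => rw [pow_succ', ← Matrix.mulVec_mulVec]; exact hinv _ ih
  rw [← hC, dotProduct_comm, Matrix.dotProduct_mulVec, ← Matrix.mulVec_transpose, hP, hk,
    zero_dotProduct]

/-- The negative imaginary lemma. -/
theorem negative_imaginary_lemma (hmin : IsMinimalRealization A B C)
    (hNI : IsNegativeImaginary (transferFunction A B C)) :
    ∃ (P : Matrix (Fin n) (Fin n) ℝ) (b : Fin n → ℝ), Pᵀ = P ∧ (∀ x ≠ 0, 0 < x ⬝ᵥ P *ᵥ x) ∧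
      (∀ x, x ⬝ᵥ P *ᵥ (A *ᵥ x) ≤ 0) ∧ B = -(A *ᵥ b) ∧ P *ᵥ b = C := by
  obtain ⟨P, b, hP, hd, hB, hC⟩ := exists_storage_matrix hmin hNI
  exact ⟨P, b, hP, fun x hx => storage_pos hmin hNI hP hd hB hC hx, hd, hB, hC⟩

end

end HIGS

namespace HIGS

/-! ### Causal Lipschitz equations -/

noncomputable section

open Filter Topology MeasureTheory

section Volterra

variable {E : Type*} [NormedAddCommGroup E] [NormedSpace ℝ E] [CompleteSpace E]

theorem integral_exp_mul_le {c : ℝ} (hc : 0 < c) (t : ℝ) :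
    ∫ s in (0 : ℝ)..t, Real.exp (c * s) ≤ Real.exp (c * t) / c := by
  rw [intervalIntegral.integral_comp_mul_left (fun s => Real.exp s) hc.ne', integral_exp]
  simp only [mul_zero, Real.exp_zero, smul_eq_mul]
  rw [inv_mul_eq_div]
  gcongr
  linarith

/-- Global solvability of `ẋ = F x`, `x 0 = x₀`, for a causal Lipschitz functional `F`. -/
theorem exists_solution_of_causal_lipschitz (F : (ℝ → E) → ℝ → E) {L M : ℝ} (hL : 0 ≤ L)
    (hcont : ∀ x, Continuous x → Continuous (F x)) (hzero : ∀ t, 0 ≤ t → ‖F 0 t‖ ≤ M)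
    (hlip : ∀ x y : ℝ → E, Continuous x → Continuous y → ∀ c D t : ℝ, 1 ≤ c → 0 ≤ D → 0 ≤ t →
      (∀ s, 0 ≤ s → s ≤ t → ‖x s - y s‖ ≤ D * Real.exp (c * s)) →
      ‖F x t - F y t‖ ≤ L * D * Real.exp (c * t)) (x₀ : E) :
    ∃ x : ℝ → E, Continuous x ∧ x 0 = x₀ ∧ ∀ t, 0 ≤ t → HasDerivAt x (F x t) t := by
  -- In the norm weighted by `exp (-c t)` the Picard map has Lipschitz constant `L / c ≤ 1/2`. The
  -- `+ 1` provides `1 ≤ c`.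
  set c : ℝ := 2 * L + 1 with hc
  have hc1 : 1 ≤ c := by linarith
  have hc0 : 0 < c := by linarith
  have hM : 0 ≤ M := (norm_nonneg _).trans (hzero 0 le_rfl)
  let X : BoundedContinuousFunction ℝ E → ℝ → E := fun y s => Real.exp (c * s) • y s
  have hX : ∀ y, Continuous (X y) := fun y => by
    have := y.continuous
    fun_prop
  have hFX : ∀ y, Continuous (F (X y)) := fun y => hcont _ (hX y)
  have hint : ∀ y z t, 0 ≤ t →
      ‖(∫ s in (0 : ℝ)..t, F (X y) s) - ∫ s in (0 : ℝ)..t, F (X z) s‖ ≤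
        L * ‖y - z‖ * (Real.exp (c * t) / c) := by
    intro y z t ht
    rw [← intervalIntegral.integral_sub ((hFX y).intervalIntegrable _ _)
      ((hFX z).intervalIntegrable _ _)]
    have h1 : ‖∫ s in (0 : ℝ)..t, F (X y) s - F (X z) s‖ ≤
        ∫ s in (0 : ℝ)..t, L * ‖y - z‖ * Real.exp (c * s) := by
      refine intervalIntegral.norm_integral_le_of_norm_le ht ?_
        (Continuous.intervalIntegrable (by fun_prop) _ _)
      refine Eventually.of_forall fun s hs => ?_
      refine hlip _ _ (hX y) (hX z) c ‖y - z‖ s hc1 (norm_nonneg _) hs.1.le fun τ _ _ => ?_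
      simp only [X]
      rw [← smul_sub, norm_smul, Real.norm_eq_abs, Real.abs_exp, mul_comm]
      gcongr
      exact (y - z).norm_coe_le_norm τ
    refine h1.trans ?_
    rw [intervalIntegral.integral_const_mul]
    gcongr
    exact integral_exp_mul_le hc0 t
  have hbound : ∀ y t, 0 ≤ t → ‖∫ s in (0 : ℝ)..t, F (X y) s‖ ≤
      (M + L * ‖y‖) * (Real.exp (c * t) / c) := by
    intro y t ht
    have h1 : ‖∫ s in (0 : ℝ)..t, F (X y) s‖ ≤
        ∫ s in (0 : ℝ)..t, (M + L * ‖y‖) * Real.exp (c * s) := by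
      refine intervalIntegral.norm_integral_le_of_norm_le ht ?_
        (Continuous.intervalIntegrable (by fun_prop) _ _)
      refine Eventually.of_forall fun s hs => ?_
      have h2 := hlip (X y) 0 (hX y) continuous_const c ‖y‖ s hc1 (norm_nonneg _) hs.1.le
        (fun τ _ _ => by
          simp only [X, Pi.zero_apply, sub_zero]
          rw [norm_smul, Real.norm_eq_abs, Real.abs_exp, mul_comm]
          gcongr
          exact y.norm_coe_le_norm τ)
      have h3 := hzero s hs.1.le
      have h4 : 1 ≤ Real.exp (c * s) := Real.one_le_exp (mul_nonneg hc0.le hs.1.le)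
      calc ‖F (X y) s‖ = ‖(F (X y) s - F 0 s) + F 0 s‖ := by rw [sub_add_cancel]
        _ ≤ L * ‖y‖ * Real.exp (c * s) + M := (norm_add_le _ _).trans (add_le_add h2 h3)
        _ ≤ (M + L * ‖y‖) * Real.exp (c * s) := by nlinarith
    refine h1.trans ?_
    rw [intervalIntegral.integral_const_mul]
    gcongr
    exact integral_exp_mul_le hc0 t
  have hprim : ∀ y, Continuous fun t : ℝ => ∫ s in (0 : ℝ)..t, F (X y) s := fun y =>
    intervalIntegral.continuous_primitive (fun a b => (hFX y).intervalIntegrable a b) 0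
  -- This is the Picard map in the rescaled unknown `y = exp (-c t) x`; `max t 0` extends it
  -- constantly to negative times.
  let Φ : BoundedContinuousFunction ℝ E → BoundedContinuousFunction ℝ E := fun y =>
    BoundedContinuousFunction.ofNormedAddCommGroup
      (fun t => Real.exp (-(c * max t 0)) • (x₀ + ∫ s in (0 : ℝ)..(max t 0), F (X y) s))
      (by
        have := (hprim y).comp (continuous_id.max continuous_const : Continuous fun t : ℝ => max t 0)
        simp only [Function.comp_def] at this
        fun_prop)
      (‖x₀‖ + (M + L * ‖y‖) / c)
      (by
        intro t
        have ht : 0 ≤ max t 0 := le_max_right _ _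
        rw [norm_smul, Real.norm_eq_abs, Real.abs_exp]
        have h1 := hbound y _ ht
        have h2 : Real.exp (-(c * max t 0)) ≤ 1 :=
          Real.exp_le_one_iff.mpr (neg_nonpos.mpr (mul_nonneg hc0.le ht))
        have h3 : Real.exp (-(c * max t 0)) * Real.exp (c * max t 0) = 1 := by
          rw [← Real.exp_add]; simp
        calc Real.exp (-(c * max t 0)) * ‖x₀ + ∫ s in (0 : ℝ)..(max t 0), F (X y) s‖
            ≤ Real.exp (-(c * max t 0)) * (‖x₀‖ + (M + L * ‖y‖) * (Real.exp (c * max t 0) / c)) := by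
              gcongr
              exact (norm_add_le _ _).trans (add_le_add_right h1 _)
          _ = Real.exp (-(c * max t 0)) * ‖x₀‖ +
              (Real.exp (-(c * max t 0)) * Real.exp (c * max t 0)) * ((M + L * ‖y‖) / c) := by ring
          _ ≤ ‖x₀‖ + (M + L * ‖y‖) / c := by
              rw [h3, one_mul]
              gcongr
              exact mul_le_of_le_one_left (norm_nonneg _) h2)
  have hΦ : ContractingWith (1 / 2) Φ := by
    refine ⟨by norm_num, LipschitzWith.of_dist_le_mul fun y z => ?_⟩
    rw [BoundedContinuousFunction.dist_le (by positivity)]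
    intro t
    have ht : 0 ≤ max t 0 := le_max_right _ _
    change dist (Real.exp (-(c * max t 0)) • (x₀ + ∫ s in (0 : ℝ)..(max t 0), F (X y) s))
      (Real.exp (-(c * max t 0)) • (x₀ + ∫ s in (0 : ℝ)..(max t 0), F (X z) s)) ≤ _
    rw [dist_eq_norm, ← smul_sub, add_sub_add_left_eq_sub, norm_smul, Real.norm_eq_abs,
      Real.abs_exp, dist_eq_norm]
    have h3 : Real.exp (-(c * max t 0)) * Real.exp (c * max t 0) = 1 := by
      rw [← Real.exp_add]; simp
    have h4 : L / c ≤ 1 / 2 := by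
      rw [div_le_div_iff₀ hc0 two_pos]; linarith
    calc Real.exp (-(c * max t 0)) * _
        ≤ Real.exp (-(c * max t 0)) * (L * ‖y - z‖ * (Real.exp (c * max t 0) / c)) := by
          gcongr
          exact hint y z _ ht
      _ = (Real.exp (-(c * max t 0)) * Real.exp (c * max t 0)) * (L / c * ‖y - z‖) := by ring
      _ ≤ ((1 / 2 : NNReal) : ℝ) * ‖y - z‖ := by
          rw [h3, one_mul]
          push_cast
          gcongr
  let y := hΦ.fixedPoint Φ
  have hy : Φ y = y := hΦ.fixedPoint_isFixedPt
  let x : ℝ → E := fun t => x₀ + ∫ s in (0 : ℝ)..t, F (X y) s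
  have hx : Continuous x := continuous_const.add (hprim y)
  have hxX : ∀ t, 0 ≤ t → x t = X y t := by
    intro t ht
    have h1 : y t = Real.exp (-(c * max t 0)) • (x₀ + ∫ s in (0 : ℝ)..(max t 0), F (X y) s) :=
      (congrArg (fun f : BoundedContinuousFunction ℝ E => f t) hy).symm
    simp only [x, X]
    rw [h1, max_eq_left ht, smul_smul, ← Real.exp_add, add_neg_cancel, Real.exp_zero, one_smul]
  refine ⟨x, hx, by simp [x], fun t ht => ?_⟩
  have h1 : HasDerivAt x (F (X y) t) t :=
    ((hFX y).integral_hasStrictDerivAt 0 t).hasDerivAt.const_add x₀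
  have h2 : F x t = F (X y) t := by
    -- Taking `D = 0` in the Lipschitz estimate is causality: `F` sees only the values on `[0, t]`.
    have h3 := hlip x (X y) hx (hX y) 1 0 t le_rfl le_rfl ht fun s hs _ => by
      rw [hxX s hs]; simp
    rw [← sub_eq_zero, ← norm_le_zero_iff]
    simpa using h3
  rw [h2]
  exact h1

end Volterra

end

end HIGS

namespace HIGS

/-! ### The HIGS operator -/

noncomputable section

open Filter Topology MeasureTheory

section RunningMaximum

/-- The running maximum of `f` on `[0, t]`. -/
def runningMax (f : ℝ → ℝ) (t : ℝ) : ℝ :=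
  sSup ((fun τ => f (t * τ)) '' Set.Icc 0 1)

variable {f g : ℝ → ℝ}

/-- Writing the points of `[0, t]` as `t τ` makes the index set a fixed compact interval, so the
supremum is continuous in `t`. -/
theorem continuous_runningMax (hf : Continuous f) : Continuous (runningMax f) :=
  isCompact_Icc.continuous_sSup (f := fun t τ => f (t * τ)) (by fun_prop)

theorem runningMax_le {t c : ℝ} (ht : 0 ≤ t) (h : ∀ s, 0 ≤ s → s ≤ t → f s ≤ c) :
    runningMax f t ≤ c := by
  refine csSup_le ((Set.nonempty_Icc.mpr zero_le_one).image _) ?_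
  rintro _ ⟨τ, hτ, rfl⟩
  exact h _ (mul_nonneg ht hτ.1) (mul_le_of_le_one_right ht hτ.2)

theorem le_runningMax (hf : Continuous f) {s t : ℝ} (hs : 0 ≤ s) (hst : s ≤ t) :
    f s ≤ runningMax f t := by
  have hc : ContinuousOn (fun τ => f (t * τ)) (Set.Icc 0 1) := by fun_prop
  refine le_csSup (isCompact_Icc.image_of_continuousOn hc).bddAbove ?_
  rcases (hs.trans hst).eq_or_lt with h | h
  · refine ⟨0, by simp, ?_⟩
    simp only [mul_zero]
    rw [le_antisymm (hst.trans h.ge) hs]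
  · refine ⟨s / t, ⟨by positivity, (div_le_one h).mpr hst⟩, ?_⟩
    simp only
    rw [mul_div_cancel₀ _ h.ne']

theorem exists_eq_runningMax (hf : Continuous f) {t : ℝ} (ht : 0 ≤ t) :
    ∃ s, 0 ≤ s ∧ s ≤ t ∧ f s = runningMax f t := by
  obtain ⟨s, hs, hmax⟩ := isCompact_Icc.exists_isMaxOn (Set.nonempty_Icc.mpr ht) hf.continuousOn
  exact ⟨s, hs.1, hs.2, le_antisymm (le_runningMax hf hs.1 hs.2)
    (runningMax_le ht fun τ h0 h1 => hmax ⟨h0, h1⟩)⟩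

theorem runningMax_mono (hf : Continuous f) {s t : ℝ} (hs : 0 ≤ s) (hst : s ≤ t) :
    runningMax f s ≤ runningMax f t :=
  runningMax_le hs fun _ h0 h1 => le_runningMax hf h0 (h1.trans hst)

theorem abs_runningMax_sub_le (hf : Continuous f) (hg : Continuous g) {t c : ℝ} (ht : 0 ≤ t)
    (h : ∀ s, 0 ≤ s → s ≤ t → |f s - g s| ≤ c) : |runningMax f t - runningMax g t| ≤ c := by
  rw [abs_sub_le_iff]
  constructor
  · rw [sub_le_iff_le_add]
    refine runningMax_le ht fun s h0 h1 => ?_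
    linarith [le_runningMax hg h0 h1, (abs_sub_le_iff.mp (h s h0 h1)).1]
  · rw [sub_le_iff_le_add]
    refine runningMax_le ht fun s h0 h1 => ?_
    linarith [le_runningMax hf h0 h1, (abs_sub_le_iff.mp (h s h0 h1)).2]

theorem runningMax_sub_le_of_lipschitz (hf : Continuous f) {T K : ℝ}
    (hK : ∀ a b, 0 ≤ a → a ≤ b → b ≤ T → |f b - f a| ≤ K * (b - a)) {s t : ℝ} (hs : 0 ≤ s)
    (hst : s ≤ t) (htT : t ≤ T) : runningMax f t - runningMax f s ≤ K * (t - s) := by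
  have hK0 : 0 ≤ K * (t - s) := (abs_nonneg _).trans (hK s t hs hst htT)
  rw [sub_le_iff_le_add]
  refine runningMax_le (hs.trans hst) fun τ h0 h1 => ?_
  rcases le_total τ s with h | h
  · linarith [le_runningMax hf h0 h]
  · have h2 := le_of_abs_le (hK s τ hs h (h1.trans htT))
    have h3 : K * (τ - s) ≤ K * (t - s) := by
      rcases h.eq_or_lt with h4 | h4
      · rw [← h4, sub_self, mul_zero]; exact hK0
      · have : 0 ≤ K * (τ - s) := (abs_nonneg _).trans (hK s τ hs h (h1.trans htT))
        have hK1 : 0 ≤ K := nonneg_of_mul_nonneg_left this (sub_pos.mpr h4)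
        gcongr
    linarith [le_runningMax hf hs le_rfl]

end RunningMaximum

/-! ### The HIGS as a reflected integral: sector bounds and Lipschitz continuity. -/

section Operator

/-- The integral of `ω |e|` with initial value `|u₀|`. -/
def freeIntegral (ω u₀ : ℝ) (e : ℝ → ℝ) (t : ℝ) : ℝ := |u₀| + ω * ∫ s in (0 : ℝ)..t, |e s|

/-- The amount by which the free integral exceeds the upper sector bound `k |e|`. -/
def excess (k ω u₀ : ℝ) (e : ℝ → ℝ) (t : ℝ) : ℝ := freeIntegral ω u₀ e t - k * |e t|

/-- The regulator that keeps the integral inside the sector. -/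
def regulator (k ω u₀ : ℝ) (e : ℝ → ℝ) : ℝ → ℝ := runningMax fun t => max 0 (excess k ω u₀ e t)

/-- The modulus of the HIGS output: the integral of `ω |e|`, reflected at the bound `k |e|`. -/
def modulus (k ω u₀ : ℝ) (e : ℝ → ℝ) (t : ℝ) : ℝ :=
  freeIntegral ω u₀ e t - regulator k ω u₀ e t

/-- For `0 ≤ p ≤ |c|` the number of modulus `p` with the sign of `c`. -/
def withSign (p c : ℝ) : ℝ := max 0 (min p c) + min 0 (max (-p) c)

/-- The output of the HIGS with input `e` and initial state `u₀`. -/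
def higsOutput (k ω u₀ : ℝ) (e : ℝ → ℝ) (t : ℝ) : ℝ := withSign (modulus k ω u₀ e t) (k * e t)

theorem withSign_of_nonneg {p c : ℝ} (hp : 0 ≤ p) (hpc : p ≤ c) : withSign p c = p := by
  have h1 : -p ≤ c := by linarith
  rw [withSign, min_eq_left hpc, max_eq_right hp, max_eq_right h1, min_eq_left (hp.trans hpc),
    add_zero]

theorem withSign_of_nonpos {p c : ℝ} (hp : 0 ≤ p) (hpc : p ≤ -c) : withSign p c = -p := by
  have h1 : c ≤ -p := by linarith
  rw [withSign, min_eq_right (by linarith), max_eq_left (by linarith), max_eq_left h1,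
    min_eq_right (by linarith), zero_add]

theorem withSign_zero (p : ℝ) : withSign p 0 = 0 := by
  simp [withSign]

theorem abs_withSign_sub_le (p q c d : ℝ) :
    |withSign p c - withSign q d| ≤ 2 * |p - q| + 2 * |c - d| := by
  have h1 : |max 0 (min p c) - max 0 (min q d)| ≤ |p - q| + |c - d| := by
    refine (abs_max_sub_max_le_max _ _ _ _).trans ?_
    rw [sub_self, abs_zero, max_eq_right (abs_nonneg _)]
    exact (abs_min_sub_min_le_max _ _ _ _).trans
      (max_le_add_of_nonneg (abs_nonneg _) (abs_nonneg _))
  have h2 : |min 0 (max (-p) c) - min 0 (max (-q) d)| ≤ |p - q| + |c - d| := by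
    refine (abs_min_sub_min_le_max _ _ _ _).trans ?_
    rw [sub_self, abs_zero, max_eq_right (abs_nonneg _)]
    refine (abs_max_sub_max_le_max _ _ _ _).trans ?_
    have : |-p - -q| = |p - q| := by rw [neg_sub_neg, abs_sub_comm]
    rw [this]
    exact max_le_add_of_nonneg (abs_nonneg _) (abs_nonneg _)
  have h3 : withSign p c - withSign q d = (max 0 (min p c) - max 0 (min q d)) +
      (min 0 (max (-p) c) - min 0 (max (-q) d)) := by
    simp only [withSign]; ring
  rw [h3]
  refine (abs_add_le _ _).trans ?_
  linarith

theorem continuous_withSign : Continuous fun p : ℝ × ℝ => withSign p.1 p.2 := by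
  unfold withSign
  fun_prop

variable {k ω u₀ : ℝ} {e : ℝ → ℝ}

theorem hasDerivAt_freeIntegral (he : Continuous e) (t : ℝ) :
    HasDerivAt (freeIntegral ω u₀ e) (ω * |e t|) t :=
  ((he.abs.integral_hasStrictDerivAt 0 t).hasDerivAt.const_mul ω).const_add _

theorem continuous_freeIntegral (he : Continuous e) : Continuous (freeIntegral ω u₀ e) :=
  continuous_iff_continuousAt.mpr fun t => (hasDerivAt_freeIntegral he t).continuousAt

theorem continuous_excess (he : Continuous e) : Continuous (excess k ω u₀ e) :=
  (continuous_freeIntegral he).sub (continuous_const.mul he.abs)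

theorem continuous_posExcess (he : Continuous e) :
    Continuous fun t => max 0 (excess k ω u₀ e t) :=
  continuous_const.max (continuous_excess he)

theorem continuous_regulator (he : Continuous e) : Continuous (regulator k ω u₀ e) :=
  continuous_runningMax (continuous_posExcess he)

theorem continuous_modulus (he : Continuous e) : Continuous (modulus k ω u₀ e) :=
  (continuous_freeIntegral he).sub (continuous_regulator he)

theorem continuous_higsOutput (he : Continuous e) : Continuous (higsOutput k ω u₀ e) :=
  continuous_withSign.comp ((continuous_modulus he).prodMk (continuous_const.mul he))

theorem freeIntegral_mono (hω : 0 ≤ ω) (he : Continuous e) : Monotone (freeIntegral ω u₀ e) := by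
  refine monotone_of_deriv_nonneg (fun t => (hasDerivAt_freeIntegral he t).differentiableAt)
    fun t => ?_
  rw [(hasDerivAt_freeIntegral he t).deriv]
  positivity

theorem regulator_nonneg (he : Continuous e) {t : ℝ} (ht : 0 ≤ t) : 0 ≤ regulator k ω u₀ e t :=
  (le_max_left _ _).trans (le_runningMax (continuous_posExcess he) ht le_rfl)

theorem excess_le_regulator (he : Continuous e) {t : ℝ} (ht : 0 ≤ t) :
    excess k ω u₀ e t ≤ regulator k ω u₀ e t :=
  (le_max_right _ _).trans (le_runningMax (continuous_posExcess he) ht le_rfl)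

theorem modulus_le (he : Continuous e) {t : ℝ} (ht : 0 ≤ t) :
    modulus k ω u₀ e t ≤ k * |e t| := by
  have h1 := excess_le_regulator (k := k) (ω := ω) (u₀ := u₀) he ht
  unfold excess at h1
  unfold modulus
  linarith

/-- Each past excess is at most the free integral at that time, which is monotone, so the regulator
never exceeds the free integral. -/
theorem modulus_nonneg (hk : 0 ≤ k) (hω : 0 ≤ ω) (he : Continuous e) {t : ℝ} (ht : 0 ≤ t) :
    0 ≤ modulus k ω u₀ e t := by
  have hfree : 0 ≤ freeIntegral ω u₀ e 0 := by simp [freeIntegral]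
  unfold modulus
  rw [sub_nonneg]
  refine runningMax_le ht fun s h0 h1 => max_le ?_ ?_
  · exact hfree.trans (freeIntegral_mono hω he ht)
  · unfold excess
    have := freeIntegral_mono (u₀ := u₀) hω he h1
    have : 0 ≤ k * |e s| := by positivity
    linarith

theorem higsOutput_of_nonneg (hk : 0 ≤ k) (hω : 0 ≤ ω) (he : Continuous e) {t : ℝ} (ht : 0 ≤ t)
    (h : 0 ≤ e t) : higsOutput k ω u₀ e t = modulus k ω u₀ e t := by
  refine withSign_of_nonneg (modulus_nonneg hk hω he ht) ((modulus_le he ht).trans ?_)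
  rw [abs_of_nonneg h]

theorem higsOutput_of_nonpos (hk : 0 ≤ k) (hω : 0 ≤ ω) (he : Continuous e) {t : ℝ} (ht : 0 ≤ t)
    (h : e t ≤ 0) : higsOutput k ω u₀ e t = -modulus k ω u₀ e t := by
  refine withSign_of_nonpos (modulus_nonneg hk hω he ht) ((modulus_le he ht).trans ?_)
  rw [abs_of_nonpos h, mul_neg]

theorem abs_higsOutput (hk : 0 ≤ k) (hω : 0 ≤ ω) (he : Continuous e) {t : ℝ} (ht : 0 ≤ t) :
    |higsOutput k ω u₀ e t| = modulus k ω u₀ e t := by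
  rcases le_total 0 (e t) with h | h
  · rw [higsOutput_of_nonneg hk hω he ht h, abs_of_nonneg (modulus_nonneg hk hω he ht)]
  · rw [higsOutput_of_nonpos hk hω he ht h, abs_neg, abs_of_nonneg (modulus_nonneg hk hω he ht)]

/-- An admissible initial state has no positive excess, so the regulator starts at zero; the sector
also fixes the sign of `u₀`. -/
theorem higsOutput_zero (hk : 0 < k) (h₀ : e 0 * u₀ ≥ 1 / k * u₀ ^ 2) (hω : 0 ≤ ω)
    (he : Continuous e) : higsOutput k ω u₀ e 0 = u₀ := by
  have hle : |u₀| ≤ k * |e 0| := by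
    have h1 : u₀ ^ 2 ≤ k * (e 0 * u₀) := by
      have := mul_le_mul_of_nonneg_left h₀ hk.le
      rwa [← mul_assoc, mul_one_div_cancel hk.ne', one_mul] at this
    have h2 : |u₀| * |u₀| ≤ (k * |e 0|) * |u₀| := by
      calc |u₀| * |u₀| = u₀ ^ 2 := by rw [abs_mul_abs_self, sq]
        _ ≤ k * (e 0 * u₀) := h1
        _ ≤ k * |e 0 * u₀| := by gcongr; exact le_abs_self _
        _ = (k * |e 0|) * |u₀| := by rw [abs_mul]; ring
    by_contra hne
    push Not at hne
    have h3 : 0 < |u₀| := lt_of_le_of_lt (by positivity) hne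
    exact absurd h2 (not_le.mpr (mul_lt_mul_of_pos_right hne h3))
  have hfree : freeIntegral ω u₀ e 0 = |u₀| := by simp [freeIntegral]
  have hmod : modulus k ω u₀ e 0 = |u₀| := by
    have h1 : regulator k ω u₀ e 0 ≤ 0 := by
      refine runningMax_le le_rfl fun s h0 h1 => ?_
      have hs : s = 0 := le_antisymm h1 h0
      rw [hs, excess, hfree]
      exact max_le le_rfl (by linarith)
    unfold modulus
    rw [hfree, le_antisymm h1 (regulator_nonneg he le_rfl), sub_zero]
  have hsign : 0 ≤ e 0 * u₀ := le_trans (by positivity) h₀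
  rcases lt_trichotomy (e 0) 0 with h | h | h
  · rw [higsOutput_of_nonpos hk.le hω he le_rfl h.le, hmod, abs_of_nonpos, neg_neg]
    exact nonpos_of_mul_nonneg_right hsign h
  · have : |u₀| ≤ 0 := by simpa [h] using hle
    rw [abs_nonpos_iff.mp this, higsOutput_of_nonneg hk.le hω he le_rfl h.ge]
    rw [abs_nonpos_iff.mp this] at hmod
    simpa using hmod
  · rw [higsOutput_of_nonneg hk.le hω he le_rfl h.le, hmod, abs_of_nonneg]
    exact nonneg_of_mul_nonneg_right hsign h

theorem higsOutput_mem_sector (hk : 0 < k) (hω : 0 ≤ ω) (he : Continuous e) {t d : ℝ} (ht : 0 ≤ t) :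
    (e t, higsOutput k ω u₀ e t, d) ∈ sector k := by
  have h1 := modulus_nonneg (u₀ := u₀) hk.le hω he ht
  have h2 := modulus_le (k := k) (ω := ω) (u₀ := u₀) he ht
  change e t * higsOutput k ω u₀ e t ≥ 1 / k * higsOutput k ω u₀ e t ^ 2
  have h3 : e t * higsOutput k ω u₀ e t = |e t| * modulus k ω u₀ e t := by
    rcases le_total 0 (e t) with h | h
    · rw [higsOutput_of_nonneg hk.le hω he ht h, abs_of_nonneg h]
    · rw [higsOutput_of_nonpos hk.le hω he ht h, abs_of_nonpos h]; ring
  rw [h3, ← sq_abs (higsOutput k ω u₀ e t), abs_higsOutput hk.le hω he ht, ge_iff_le, one_div,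
    inv_mul_le_iff₀ hk]
  nlinarith

/-- Causal Lipschitz continuity of the HIGS operator in exponentially weighted norms. -/
theorem abs_higsOutput_sub_le (hk : 0 ≤ k) (hω : 0 ≤ ω) {e' : ℝ → ℝ} (he : Continuous e)
    (he' : Continuous e') {c D t : ℝ} (hc : 1 ≤ c) (hD : 0 ≤ D) (ht : 0 ≤ t)
    (h : ∀ s, 0 ≤ s → s ≤ t → |e s - e' s| ≤ D * Real.exp (c * s)) :
    |higsOutput k ω u₀ e t - higsOutput k ω u₀ e' t| ≤ (4 * ω + 4 * k) * D * Real.exp (c * t) := by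
  have hc0 : 0 < c := by linarith
  have hfree : ∀ s, 0 ≤ s → s ≤ t →
      |freeIntegral ω u₀ e s - freeIntegral ω u₀ e' s| ≤ ω * (D * Real.exp (c * s)) := by
    intro s hs hst
    have h1 : freeIntegral ω u₀ e s - freeIntegral ω u₀ e' s =
        ω * ∫ τ in (0 : ℝ)..s, (|e τ| - |e' τ|) := by
      rw [intervalIntegral.integral_sub (he.abs.intervalIntegrable _ _)
        (he'.abs.intervalIntegrable _ _)]
      simp only [freeIntegral]; ring
    have h2 : |∫ τ in (0 : ℝ)..s, (|e τ| - |e' τ|)| ≤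
        ∫ τ in (0 : ℝ)..s, D * Real.exp (c * τ) := by
      rw [← Real.norm_eq_abs]
      refine intervalIntegral.norm_integral_le_of_norm_le hs ?_
        (Continuous.intervalIntegrable (by fun_prop) _ _)
      refine Eventually.of_forall fun τ hτ => ?_
      exact (abs_abs_sub_abs_le_abs_sub _ _).trans (h τ hτ.1.le (hτ.2.trans hst))
    rw [h1, abs_mul, abs_of_nonneg hω]
    refine mul_le_mul_of_nonneg_left (h2.trans ?_) hω
    rw [intervalIntegral.integral_const_mul]
    refine mul_le_mul_of_nonneg_left ((integral_exp_mul_le hc0 s).trans ?_) hD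
    exact div_le_self (Real.exp_pos _).le hc
  have habs : ∀ s, 0 ≤ s → s ≤ t → abs (k * |e s| - k * |e' s|) ≤ k * (D * Real.exp (c * s)) := by
    intro s hs hst
    rw [← mul_sub, abs_mul, abs_of_nonneg hk]
    exact mul_le_mul_of_nonneg_left ((abs_abs_sub_abs_le_abs_sub _ _).trans (h s hs hst)) hk
  have hreg : |regulator k ω u₀ e t - regulator k ω u₀ e' t| ≤
      (ω + k) * (D * Real.exp (c * t)) := by
    refine abs_runningMax_sub_le (continuous_posExcess he) (continuous_posExcess he') ht
      fun s hs hst => ?_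
    have h1 : |excess k ω u₀ e s - excess k ω u₀ e' s| ≤ (ω + k) * (D * Real.exp (c * s)) := by
      have h2 : excess k ω u₀ e s - excess k ω u₀ e' s =
          (freeIntegral ω u₀ e s - freeIntegral ω u₀ e' s) - (k * |e s| - k * |e' s|) := by
        simp only [excess]; ring
      rw [h2]
      refine (abs_sub _ _).trans ?_
      linarith [hfree s hs hst, habs s hs hst]
    have h3 : |max 0 (excess k ω u₀ e s) - max 0 (excess k ω u₀ e' s)| ≤
        |excess k ω u₀ e s - excess k ω u₀ e' s| := by
      refine (abs_max_sub_max_le_max _ _ _ _).trans ?_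
      rw [sub_self, abs_zero, max_eq_right (abs_nonneg _)]
    refine h3.trans (h1.trans ?_)
    gcongr
  have hmod : |modulus k ω u₀ e t - modulus k ω u₀ e' t| ≤
      (2 * ω + k) * (D * Real.exp (c * t)) := by
    have h2 : modulus k ω u₀ e t - modulus k ω u₀ e' t =
        (freeIntegral ω u₀ e t - freeIntegral ω u₀ e' t) -
          (regulator k ω u₀ e t - regulator k ω u₀ e' t) := by
      simp only [modulus]; ring
    rw [h2]
    refine (abs_sub _ _).trans ?_
    linarith [hfree t ht le_rfl]
  have hlast : |k * e t - k * e' t| ≤ k * (D * Real.exp (c * t)) := by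
    rw [← mul_sub, abs_mul, abs_of_nonneg hk]
    exact mul_le_mul_of_nonneg_left (h t ht le_rfl) hk
  -- The constant is `2 (2ω + k) + 2k`, from the modulus and from the argument that sets the sign.
  refine (abs_withSign_sub_le _ _ _ _).trans ?_
  linarith

end Operator

end

end HIGS

namespace HIGS

/-! ### Existence of closed-loop trajectories -/

noncomputable section

open Filter Topology MeasureTheory

theorem absolutelyContinuousOnInterval_of_abs_sub_le {f : ℝ → ℝ} {T K : ℝ} (hT : 0 ≤ T)
    (h : ∀ a b, 0 ≤ a → a ≤ b → b ≤ T → |f b - f a| ≤ K * (b - a)) :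
    AbsolutelyContinuousOnInterval f 0 T := by
  refine LipschitzOnWith.absolutelyContinuousOnInterval (K := K.toNNReal) ?_
  refine LipschitzOnWith.of_dist_le_mul fun x hx y hy => ?_
  rw [Set.uIcc_of_le hT] at hx hy
  have key : ∀ a b, 0 ≤ a → a ≤ b → b ≤ T → |f b - f a| ≤ K.toNNReal * (b - a) := by
    intro a b ha hab hb
    refine (h a b ha hab hb).trans (mul_le_mul_of_nonneg_right ?_ (sub_nonneg.mpr hab))
    exact Real.le_coe_toNNReal K
  rw [Real.dist_eq, Real.dist_eq]
  rcases le_total x y with hxy | hxy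
  · rw [abs_sub_comm, abs_sub_comm x, abs_of_nonneg (sub_nonneg.mpr hxy)]
    exact key x y hx.1 hxy hy.2
  · rw [abs_of_nonneg (sub_nonneg.mpr hxy)]
    exact key y x hy.1 hxy hx.2

theorem exists_lipschitz_of_hasDerivAt {e e' : ℝ → ℝ} (he' : Continuous e')
    (hd : ∀ t, 0 ≤ t → HasDerivAt e (e' t) t) (T : ℝ) :
    ∃ K, ∀ a b, 0 ≤ a → a ≤ b → b ≤ T → |e b - e a| ≤ K * (b - a) := by
  obtain ⟨K, hK⟩ := isCompact_Icc.exists_bound_of_continuousOn (s := Set.Icc 0 T) he'.continuousOn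
  refine ⟨K, fun a b ha hab hb => ?_⟩
  have := (convex_Icc (0 : ℝ) T).norm_image_sub_le_of_norm_hasDerivWithin_le
    (fun x hx => (hd x hx.1).hasDerivWithinAt) hK ⟨ha, hab.trans hb⟩ ⟨ha.trans hab, hb⟩
  simpa [abs_of_nonneg (sub_nonneg.mpr hab)] using this

/-! ### The reflected integral satisfies the HIGS mode equations almost everywhere. -/

section Modes

variable {k ω u₀ : ℝ} {e : ℝ → ℝ}

theorem regulator_mono (he : Continuous e) {s t : ℝ} (hs : 0 ≤ s) (hst : s ≤ t) :
    regulator k ω u₀ e s ≤ regulator k ω u₀ e t :=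
  runningMax_mono (continuous_posExcess he) hs hst

/-- Strictly below the barrier the excess stays under the regulator nearby. The running maximum is
then locally constant and only the free integral moves. -/
theorem hasDerivAt_modulus_of_lt (he : Continuous e) {t : ℝ} (ht : 0 < t)
    (h : modulus k ω u₀ e t < k * |e t|) :
    HasDerivAt (modulus k ω u₀ e) (ω * |e t|) t := by
  have hlt : excess k ω u₀ e t < regulator k ω u₀ e t := by
    unfold modulus at h; unfold excess; linarith
  have hnear : ∀ᶠ s in 𝓝 t, excess k ω u₀ e s < regulator k ω u₀ e t :=
    (continuous_excess he).continuousAt.eventually_lt_const hlt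
  obtain ⟨δ, hδ, hball⟩ := Metric.eventually_nhds_iff.mp hnear
  have hconst : ∀ᶠ s in 𝓝 t, regulator k ω u₀ e s = regulator k ω u₀ e t := by
    filter_upwards [Metric.ball_mem_nhds t hδ, lt_mem_nhds ht] with s hs hs0
    have hs' : |s - t| < δ := hs
    have hloc : ∀ τ, |τ - t| ≤ |s - t| →
        max 0 (excess k ω u₀ e τ) ≤ regulator k ω u₀ e t := fun τ hτ =>
      max_le (regulator_nonneg he ht.le) (hball (lt_of_le_of_lt hτ hs')).le
    rcases le_total t s with hts | hst
    · refine le_antisymm (runningMax_le hs0.le fun τ h0 h1 => ?_) (regulator_mono he ht.le hts)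
      rcases le_total τ t with h2 | h2
      · exact le_runningMax (continuous_posExcess he) h0 h2
      · refine hloc τ ?_
        rw [abs_of_nonneg (sub_nonneg.mpr h2), abs_of_nonneg (sub_nonneg.mpr hts)]
        linarith
    · refine le_antisymm (regulator_mono he hs0.le hst) ?_
      obtain ⟨τ, h0, h1, hτ⟩ := exists_eq_runningMax (continuous_posExcess (k := k) (ω := ω)
        (u₀ := u₀) he) ht.le
      change _ = regulator k ω u₀ e t at hτ
      rcases le_total τ s with h2 | h2
      · rw [← hτ]
        exact le_runningMax (continuous_posExcess he) h0 h2
      · have h3 : excess k ω u₀ e τ < regulator k ω u₀ e t := by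
          refine hball (lt_of_le_of_lt ?_ hs')
          rw [Real.dist_eq, abs_of_nonpos (sub_nonpos.mpr h1), abs_of_nonpos (sub_nonpos.mpr hst)]
          linarith
        rcases max_choice 0 (excess k ω u₀ e τ) with h4 | h4
        · rw [← hτ, h4]; exact regulator_nonneg he hs0.le
        · rw [h4] at hτ; exact absurd hτ h3.ne
  have h1 := (hasDerivAt_freeIntegral (ω := ω) (u₀ := u₀) he t).sub_const
    (regulator k ω u₀ e t)
  refine h1.congr_of_eventuallyEq ?_
  filter_upwards [hconst] with s hs
  rw [modulus, hs]

theorem deriv_modulus_le (he : Continuous e) {t d : ℝ} (ht : 0 < t)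
    (hd : HasDerivAt (modulus k ω u₀ e) d t) : d ≤ ω * |e t| := by
  have h1 : HasDerivAt (regulator k ω u₀ e) (ω * |e t| - d) t := by
    refine ((hasDerivAt_freeIntegral (ω := ω) (u₀ := u₀) he t).sub hd).congr_of_eventuallyEq ?_
    exact Eventually.of_forall fun s => by simp [modulus]
  have h2 := (hasDerivWithinAt_iff_tendsto_slope' (s := Set.Ioi t) (by simp)).mp
    h1.hasDerivWithinAt
  have h3 : 0 ≤ ω * |e t| - d := by
    refine ge_of_tendsto h2 ?_
    filter_upwards [self_mem_nhdsWithin] with s hs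
    have hs' : t < s := hs
    rw [slope_def_field]
    exact div_nonneg (sub_nonneg.mpr (regulator_mono he ht.le hs'.le)) (sub_nonneg.mpr hs'.le)
  linarith

theorem deriv_modulus_eq_of_eq (he : Continuous e) {t d m : ℝ} (ht : 0 < t)
    (hd : HasDerivAt (modulus k ω u₀ e) d t) (hm : HasDerivAt (fun s => |e s|) m t)
    (h : modulus k ω u₀ e t = k * |e t|) : d = k * m := by
  have hmin : IsLocalMin (fun s => k * |e s| - modulus k ω u₀ e s) t := by
    filter_upwards [lt_mem_nhds ht] with s hs
    rw [h, sub_self]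
    exact sub_nonneg.mpr (modulus_le he hs.le)
  have := hmin.hasDerivAt_eq_zero ((hm.const_mul k).sub hd)
  linarith

/-- At contact the slope equals that of the barrier and is at most `ω |e|`. When the barrier rises
at least that fast, the slope is exactly `ω |e|`; this is the integrator mode on the boundary. -/
theorem hasDerivAt_modulus_of_eq (he : Continuous e) {t m : ℝ} (ht : 0 < t)
    (hdiff : DifferentiableAt ℝ (modulus k ω u₀ e) t) (hm : HasDerivAt (fun s => |e s|) m t)
    (h : modulus k ω u₀ e t = k * |e t|) (hle : ω * |e t| ≤ k * m) :
    HasDerivAt (modulus k ω u₀ e) (ω * |e t|) t := by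
  have hd := hdiff.hasDerivAt
  have h1 := deriv_modulus_le he ht hd
  have h2 := deriv_modulus_eq_of_eq he ht hd hm h
  have h3 : deriv (modulus k ω u₀ e) t = ω * |e t| := le_antisymm h1 (h2 ▸ hle)
  rwa [h3] at hd

theorem exists_lipschitz_modulus (hk : 0 ≤ k) (he : Continuous e) {T K : ℝ}
    (hK : ∀ a b, 0 ≤ a → a ≤ b → b ≤ T → |e b - e a| ≤ K * (b - a)) :
    ∃ K', ∀ a b, 0 ≤ a → a ≤ b → b ≤ T →
      |modulus k ω u₀ e b - modulus k ω u₀ e a| ≤ K' * (b - a) := by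
  obtain ⟨J, hJ⟩ := exists_lipschitz_of_hasDerivAt (e := freeIntegral ω u₀ e)
    (e' := fun t => ω * |e t|) (by fun_prop) (fun t _ => hasDerivAt_freeIntegral he t) T
  have habs : ∀ a b, 0 ≤ a → a ≤ b → b ≤ T → abs (k * |e b| - k * |e a|) ≤ k * (K * (b - a)) := by
    intro a b ha hab hb
    rw [← mul_sub, abs_mul, abs_of_nonneg hk]
    exact mul_le_mul_of_nonneg_left ((abs_abs_sub_abs_le_abs_sub _ _).trans (hK a b ha hab hb)) hk
  have hpos : ∀ a b, 0 ≤ a → a ≤ b → b ≤ T →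
      |max 0 (excess k ω u₀ e b) - max 0 (excess k ω u₀ e a)| ≤ (J + k * K) * (b - a) := by
    intro a b ha hab hb
    refine (abs_max_sub_max_le_max _ _ _ _).trans ?_
    rw [sub_self, abs_zero, max_eq_right (abs_nonneg _)]
    have h2 : excess k ω u₀ e b - excess k ω u₀ e a =
        (freeIntegral ω u₀ e b - freeIntegral ω u₀ e a) - (k * |e b| - k * |e a|) := by
      simp only [excess]; ring
    rw [h2]
    refine (abs_sub _ _).trans ?_
    linarith [hJ a b ha hab hb, habs a b ha hab hb]
  refine ⟨J + (J + k * K), fun a b ha hab hb => ?_⟩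
  have h1 : modulus k ω u₀ e b - modulus k ω u₀ e a =
      (freeIntegral ω u₀ e b - freeIntegral ω u₀ e a) -
        (regulator k ω u₀ e b - regulator k ω u₀ e a) := by
    simp only [modulus]; ring
  rw [h1]
  refine (abs_sub _ _).trans ?_
  have h3 : regulator k ω u₀ e b - regulator k ω u₀ e a ≤ (J + k * K) * (b - a) :=
    runningMax_sub_le_of_lipschitz (continuous_posExcess he) hpos ha hab hb
  rw [abs_of_nonneg (sub_nonneg.mpr (regulator_mono he ha hab))]
  linarith [hJ a b ha hab hb]

theorem exists_lipschitz_higsOutput (hk : 0 ≤ k) (he : Continuous e) {T K : ℝ}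
    (hK : ∀ a b, 0 ≤ a → a ≤ b → b ≤ T → |e b - e a| ≤ K * (b - a)) :
    ∃ K', ∀ a b, 0 ≤ a → a ≤ b → b ≤ T →
      |higsOutput k ω u₀ e b - higsOutput k ω u₀ e a| ≤ K' * (b - a) := by
  obtain ⟨J, hJ⟩ := exists_lipschitz_modulus (ω := ω) (u₀ := u₀) hk he hK
  refine ⟨2 * J + 2 * (k * K), fun a b ha hab hb => ?_⟩
  refine (abs_withSign_sub_le _ _ _ _).trans ?_
  have : |k * e b - k * e a| ≤ k * (K * (b - a)) := by
    rw [← mul_sub, abs_mul, abs_of_nonneg hk]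
    exact mul_le_mul_of_nonneg_left (hK a b ha hab hb) hk
  linarith [hJ a b ha hab hb]

theorem hasDerivAt_higsOutput_of_integratorRegion (hk : 0 < k) (hω : 0 ≤ ω) (he : Continuous e)
    {t e' : ℝ} (ht : 0 < t) (hd : HasDerivAt e e' t)
    (hdiff : DifferentiableAt ℝ (modulus k ω u₀ e) t)
    (h : (e t, higsOutput k ω u₀ e t, e') ∈ integratorRegion k ω) :
    HasDerivAt (higsOutput k ω u₀ e) (ω * e t) t := by
  have hgain : higsOutput k ω u₀ e t = k * e t → ω * e t ^ 2 ≤ k * e t * e' := by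
    intro h1
    by_contra h2
    push Not at h2
    exact h.2 ⟨h1, h2⟩
  have hpos := fun s (hs : 0 ≤ s) => modulus_nonneg (u₀ := u₀) hk.le hω he hs
  rcases lt_trichotomy (e t) 0 with h0 | h0 | h0
  · have hlocal : higsOutput k ω u₀ e =ᶠ[𝓝 t] fun s => -modulus k ω u₀ e s := by
      filter_upwards [lt_mem_nhds ht, he.continuousAt.eventually_lt_const h0] with s hs hes
      exact higsOutput_of_nonpos hk.le hω he hs.le hes.le
    have hm : HasDerivAt (fun s => |e s|) (-e') t := by
      refine hd.neg.congr_of_eventuallyEq ?_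
      filter_upwards [he.continuousAt.eventually_lt_const h0] with s hes
      exact abs_of_nonpos hes.le
    have hmain : HasDerivAt (modulus k ω u₀ e) (ω * |e t|) t := by
      rcases (modulus_le (k := k) (ω := ω) (u₀ := u₀) he ht.le).lt_or_eq with h1 | h1
      · exact hasDerivAt_modulus_of_lt he ht h1
      · refine hasDerivAt_modulus_of_eq he ht hdiff hm h1 ?_
        have h2 := hgain (by
          rw [higsOutput_of_nonpos hk.le hω he ht.le h0.le, h1, abs_of_neg h0]; ring)
        rw [abs_of_neg h0]
        nlinarith
    have h3 := hmain.neg.congr_of_eventuallyEq hlocal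
    rw [abs_of_neg h0] at h3
    simpa using h3
  -- Where `e = 0` the sign may switch. But the modulus has a minimum there, hence zero derivative,
  -- and it dominates the increment of the output.
  · have hmod : modulus k ω u₀ e t = 0 := by
      refine le_antisymm ((modulus_le he ht.le).trans ?_) (hpos t ht.le)
      rw [h0]; simp
    have hmin : IsLocalMin (modulus k ω u₀ e) t := by
      filter_upwards [lt_mem_nhds ht] with s hs
      rw [hmod]; exact hpos s hs.le
    have hd0 := hdiff.hasDerivAt
    rw [hmin.hasDerivAt_eq_zero hd0, hasDerivAt_iff_isLittleO] at hd0
    rw [h0, mul_zero, hasDerivAt_iff_isLittleO]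
    have hu0 : higsOutput k ω u₀ e t = 0 := by
      rw [← abs_eq_zero, abs_higsOutput hk.le hω he ht.le, hmod]
    refine Asymptotics.IsBigO.trans_isLittleO (Asymptotics.IsBigO.of_bound 1 ?_) hd0
    filter_upwards [lt_mem_nhds ht] with s hs
    simp only [smul_zero, sub_zero, hu0, hmod, one_mul, Real.norm_eq_abs]
    rw [abs_higsOutput hk.le hω he hs.le, abs_of_nonneg (hpos s hs.le)]
  · have hlocal : higsOutput k ω u₀ e =ᶠ[𝓝 t] modulus k ω u₀ e := by
      filter_upwards [lt_mem_nhds ht, he.continuousAt.eventually_const_lt h0] with s hs hes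
      exact higsOutput_of_nonneg hk.le hω he hs.le hes.le
    have hm : HasDerivAt (fun s => |e s|) e' t := by
      refine hd.congr_of_eventuallyEq ?_
      filter_upwards [he.continuousAt.eventually_const_lt h0] with s hes
      exact abs_of_nonneg hes.le
    have hmain : HasDerivAt (modulus k ω u₀ e) (ω * |e t|) t := by
      rcases (modulus_le (k := k) (ω := ω) (u₀ := u₀) he ht.le).lt_or_eq with h1 | h1
      · exact hasDerivAt_modulus_of_lt he ht h1
      · refine hasDerivAt_modulus_of_eq he ht hdiff hm h1 ?_
        have h2 := hgain (by
          rw [higsOutput_of_nonneg hk.le hω he ht.le h0.le, h1, abs_of_pos h0])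
        rw [abs_of_pos h0]
        nlinarith
    have h3 := hmain.congr_of_eventuallyEq hlocal
    rwa [abs_of_pos h0] at h3

/-- The HIGS operator produces Carathéodory trajectories for continuously differentiable inputs. -/
theorem isHIGSTrajectory_higsOutput (hk : 0 < k) (hω : 0 ≤ ω) {e' : ℝ → ℝ} (he : Continuous e)
    (he' : Continuous e') (hd : ∀ t, 0 ≤ t → HasDerivAt e (e' t) t) :
    IsHIGSTrajectory k ω e (higsOutput k ω u₀ e) (higsOutput k ω u₀ e) where
  input_ac T hT := by
    obtain ⟨K, hK⟩ := exists_lipschitz_of_hasDerivAt he' hd T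
    exact absolutelyContinuousOnInterval_of_abs_sub_le hT hK
  state_ac T hT := by
    obtain ⟨K, hK⟩ := exists_lipschitz_of_hasDerivAt he' hd T
    obtain ⟨J, hJ⟩ := exists_lipschitz_higsOutput (ω := ω) (u₀ := u₀) hk.le he hK
    exact absolutelyContinuousOnInterval_of_abs_sub_le hT hJ
  output _ _ := rfl
  sector_mem _ ht := higsOutput_mem_sector hk hω he ht
  modes := by
    have hae : ∀ᵐ t : ℝ, ∀ N : ℕ, t ∈ Set.uIcc (0 : ℝ) N →
        DifferentiableAt ℝ (modulus k ω u₀ e) t := by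
      rw [ae_all_iff]
      intro N
      obtain ⟨K, hK⟩ := exists_lipschitz_of_hasDerivAt he' hd N
      obtain ⟨J, hJ⟩ := exists_lipschitz_modulus (ω := ω) (u₀ := u₀) hk.le he hK
      exact (absolutelyContinuousOnInterval_of_abs_sub_le N.cast_nonneg hJ).ae_differentiableAt
    filter_upwards [hae] with t hdiff ht
    obtain ⟨N, hN⟩ := exists_nat_ge t
    have hdt := hd t ht.le
    refine ⟨fun h => ?_, fun h => h.1⟩
    refine hasDerivAt_higsOutput_of_integratorRegion hk hω he ht hdt (hdiff N ?_)
      (hdt.deriv ▸ h)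
    rw [Set.uIcc_of_le N.cast_nonneg]
    exact ⟨ht.le, hN⟩

end Modes

/-! ### Solving the loop as a causal Lipschitz equation. -/

section ClosedLoop

variable {n : ℕ} (A : Matrix (Fin n) (Fin n) ℝ) (B C : Fin n → ℝ)

theorem exists_norm_mulVec_le_real : ∃ a : ℝ, 0 ≤ a ∧ ∀ x, ‖A *ᵥ x‖ ≤ a * ‖x‖ :=
  ⟨‖A.mulVecLin.toContinuousLinearMap‖, norm_nonneg _,
    fun x => A.mulVecLin.toContinuousLinearMap.le_opNorm x⟩

theorem exists_abs_dotProduct_le : ∃ c : ℝ, 0 ≤ c ∧ ∀ x, |C ⬝ᵥ x| ≤ c * ‖x‖ := by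
  refine ⟨∑ i, |C i|, Finset.sum_nonneg fun i _ => abs_nonneg _, fun x => ?_⟩
  rw [dotProduct, Finset.sum_mul]
  refine (Finset.abs_sum_le_sum_abs _ _).trans (Finset.sum_le_sum fun i _ => ?_)
  rw [abs_mul]
  exact mul_le_mul_of_nonneg_left (norm_le_pi_norm x i) (abs_nonneg _)

theorem hasDerivAt_dotProduct {x : ℝ → Fin n → ℝ} {x' : Fin n → ℝ} {t : ℝ}
    (h : HasDerivAt x x' t) : HasDerivAt (fun t => C ⬝ᵥ x t) (C ⬝ᵥ x') t := by
  simp only [dotProduct]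
  exact HasDerivAt.fun_sum fun i _ => (hasDerivAt_pi.mp h i).const_mul _

theorem exists_closedLoopTrajectory {k ω : ℝ} (hk : 0 < k) (hω : 0 ≤ ω) (x₀ : Fin n → ℝ) (h₀ : ℝ)
    (hadm : (C ⬝ᵥ x₀) * h₀ ≥ 1 / k * h₀ ^ 2) :
    ∃ (x : ℝ → Fin n → ℝ) (xh : ℝ → ℝ),
      IsClosedLoopTrajectory A B C k ω x xh ∧ x 0 = x₀ ∧ xh 0 = h₀ := by
  obtain ⟨a, ha0, ha⟩ := exists_norm_mulVec_le_real A
  obtain ⟨c, hc0, hc⟩ := exists_abs_dotProduct_le C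
  let H : (ℝ → Fin n → ℝ) → ℝ → ℝ := fun x => higsOutput k ω h₀ fun s => C ⬝ᵥ x s
  have hCx : ∀ x : ℝ → Fin n → ℝ, Continuous x → Continuous fun s => C ⬝ᵥ x s := fun x hx =>
    continuous_const.dotProduct hx
  have hH : ∀ x, Continuous x → Continuous (H x) := fun x hx => continuous_higsOutput (hCx x hx)
  let F : (ℝ → Fin n → ℝ) → ℝ → Fin n → ℝ := fun x t => A *ᵥ x t + H x t • B
  have hF : ∀ x, Continuous x → Continuous (F x) := fun x hx =>
    (continuous_const.matrix_mulVec hx).add ((hH x hx).smul continuous_const)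
  obtain ⟨x, hx, hx0, hxd⟩ := exists_solution_of_causal_lipschitz F
    (L := a + (4 * ω + 4 * k) * c * ‖B‖) (M := 0) (by positivity) hF
    (by
      intro t _
      have : H 0 t = 0 := by
        simp only [H, higsOutput, Pi.zero_apply, dotProduct_zero, mul_zero, withSign_zero]
      simp [F, this])
    (by
      intro x y hx hy r D t hr hD ht hxy
      have h1 := abs_higsOutput_sub_le (u₀ := h₀) (D := c * D) hk.le hω (hCx x hx) (hCx y hy) hr
        (by positivity) ht (fun s hs hst => by
          rw [← dotProduct_sub, mul_assoc]
          exact (hc _).trans (mul_le_mul_of_nonneg_left (hxy s hs hst) hc0))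
      have h2 : F x t - F y t = A *ᵥ (x t - y t) + (H x t - H y t) • B := by
        simp only [F, Matrix.mulVec_sub, sub_smul]; abel
      rw [h2]
      refine (norm_add_le _ _).trans ?_
      rw [norm_smul, Real.norm_eq_abs]
      have h3 : ‖A *ᵥ (x t - y t)‖ ≤ a * (D * Real.exp (r * t)) :=
        (ha _).trans (mul_le_mul_of_nonneg_left (hxy t ht le_rfl) ha0)
      have h4 : |H x t - H y t| * ‖B‖ ≤ (4 * ω + 4 * k) * (c * D) * Real.exp (r * t) * ‖B‖ :=
        mul_le_mul_of_nonneg_right h1 (norm_nonneg _)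
      linarith)
    x₀
  refine ⟨x, H x, ⟨H x, fun t => C ⬝ᵥ x t, ⟨fun t ht => (hxd t ht).hasDerivWithinAt, fun _ _ => rfl⟩,
    ?_⟩, hx0, ?_⟩
  · exact isHIGSTrajectory_higsOutput hk hω (e' := fun t => C ⬝ᵥ F x t) (hCx x hx)
      (continuous_const.dotProduct (hF x hx)) fun t ht => hasDerivAt_dotProduct C (hxd t ht)
  · exact higsOutput_zero hk (by simpa only [hx0] using hadm) hω (hCx x hx)

end ClosedLoop

end

end HIGS

namespace HIGS

/-! ### Dissipation along closed-loop trajectories -/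

noncomputable section

open Filter Topology MeasureTheory

section AbsolutelyContinuous

theorem absolutelyContinuousOnInterval_of_hasDerivAt {f f' : ℝ → ℝ} (hf : Continuous f)
    (hf' : Continuous f') (hd : ∀ t, 0 < t → HasDerivAt f (f' t) t) {T : ℝ} (hT : 0 ≤ T) :
    AbsolutelyContinuousOnInterval f 0 T := by
  obtain ⟨K, hK⟩ := isCompact_Icc.exists_bound_of_continuousOn (s := Set.Icc 0 T) hf'.continuousOn
  refine absolutelyContinuousOnInterval_of_abs_sub_le (K := K) hT fun a b ha hab hb => ?_
  rw [← intervalIntegral.integral_eq_sub_of_hasDerivAt_of_le hab hf.continuousOn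
    (fun t ht => hd t (ha.trans_lt ht.1)) (hf'.intervalIntegrable _ _), ← Real.norm_eq_abs]
  have := intervalIntegral.norm_integral_le_of_norm_le_const (a := a) (b := b) (f := f') (C := K)
    fun t ht => by
      rw [Set.uIoc_of_le hab] at ht
      exact hK t ⟨ha.trans ht.1.le, ht.2.trans hb⟩
  rwa [abs_of_nonneg (sub_nonneg.mpr hab)] at this

theorem absolutelyContinuousOnInterval_abs {f : ℝ → ℝ} {a b : ℝ}
    (hf : AbsolutelyContinuousOnInterval f a b) :
    AbsolutelyContinuousOnInterval (fun t => |f t|) a b := by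
  rw [absolutelyContinuousOnInterval_iff] at hf ⊢
  intro ε hε
  obtain ⟨δ, hδ, h⟩ := hf ε hε
  refine ⟨δ, hδ, fun E hE hl => lt_of_le_of_lt (Finset.sum_le_sum fun i _ => ?_) (h E hE hl)⟩
  rw [Real.dist_eq, Real.dist_eq]
  exact abs_abs_sub_abs_le_abs_sub _ _

theorem sub_le_integral_of_ae_deriv_le {f g : ℝ → ℝ} (hf : ∀ T, 0 ≤ T →
    AbsolutelyContinuousOnInterval f 0 T) (hg : Continuous g)
    (h : ∀ᵐ t : ℝ, 0 < t → ∃ d, HasDerivAt f d t ∧ d ≤ g t) {s t : ℝ} (hs : 0 ≤ s) (hst : s ≤ t) :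
    f t - f s ≤ ∫ τ in s..t, g τ := by
  have hac : AbsolutelyContinuousOnInterval f s t := by
    refine (hf t (hs.trans hst)).mono ?_
    rw [Set.uIcc_of_le hst, Set.uIcc_of_le (hs.trans hst)]
    exact Set.Icc_subset_Icc_left hs
  rw [← hac.integral_deriv_eq_sub]
  refine intervalIntegral.integral_mono_ae_restrict hst hac.intervalIntegrable_deriv
    (hg.intervalIntegrable _ _) ?_
  rw [EventuallyLE, ae_restrict_iff' measurableSet_Icc]
  have h0 : ∀ᵐ τ : ℝ, τ ≠ 0 := by
    rw [ae_iff]; simp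
  filter_upwards [h, h0] with τ h1 h2 hτ
  obtain ⟨d, hd, hle⟩ := h1 (lt_of_le_of_ne (hs.trans hτ.1) h2.symm)
  rwa [hd.deriv]

end AbsolutelyContinuous

/-- A closed-loop trajectory, with continuous signals on the whole line. -/
structure LoopTrajectory {n : ℕ} (A : Matrix (Fin n) (Fin n) ℝ) (B C : Fin n → ℝ) (k ω : ℝ)
    (x : ℝ → Fin n → ℝ) (h : ℝ → ℝ) : Prop where
  cont_x : Continuous x
  cont_h : Continuous h
  deriv_x : ∀ t, 0 < t → HasDerivAt x (A *ᵥ x t + h t • B) t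
  sector : ∀ t, 0 ≤ t → 1 / k * h t ^ 2 ≤ (C ⬝ᵥ x t) * h t
  ac : ∀ T, 0 ≤ T → AbsolutelyContinuousOnInterval h 0 T
  modes : ∀ᵐ t : ℝ, 0 < t → HasDerivAt h (ω * (C ⬝ᵥ x t)) t ∨
    (h t = k * (C ⬝ᵥ x t) ∧
      k * (C ⬝ᵥ x t) * (C ⬝ᵥ (A *ᵥ x t + h t • B)) < ω * (C ⬝ᵥ x t) ^ 2)

/-- Freezing the signals before time zero gives globally continuous functions; since the sector
holds, the two mode regions become an exhaustive alternative. -/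
theorem IsClosedLoopTrajectory.loopTrajectory {n : ℕ} {A : Matrix (Fin n) (Fin n) ℝ}
    {B C : Fin n → ℝ} {k ω : ℝ} {x : ℝ → Fin n → ℝ} {xh : ℝ → ℝ}
    (hx : IsClosedLoopTrajectory A B C k ω x xh) :
    LoopTrajectory A B C k ω (fun t => x (max t 0)) fun t => xh (max t 0) := by
  obtain ⟨u, y, hp, hh⟩ := hx
  have hmax : ∀ t : ℝ, 0 < t → ∀ᶠ s in 𝓝 t, max s 0 = s := fun t ht => by
    filter_upwards [lt_mem_nhds ht] with s hs
    exact max_eq_left hs.le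
  have hcm : Continuous fun t : ℝ => max t 0 := continuous_id.max continuous_const
  have hxc : ContinuousOn x (Set.Ici 0) := fun t ht => (hp.state t ht).continuousWithinAt
  have hhc : ContinuousOn xh (Set.Ici 0) := by
    intro t ht
    have h1 := (hh.state_ac (t + 1) (by linarith [show (0 : ℝ) ≤ t from ht])).continuousOn
    rw [Set.uIcc_of_le (by linarith [show (0 : ℝ) ≤ t from ht])] at h1
    refine (h1 t ⟨ht, by linarith⟩).mono_of_mem_nhdsWithin ?_
    have : Set.Icc 0 (t + 1) = Set.Ici 0 ∩ Set.Iic (t + 1) := by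
      rw [Set.Ici_inter_Iic]
    rw [this]
    exact inter_mem_nhdsWithin _ (Iic_mem_nhds (by linarith))
  have hder : ∀ t, 0 < t → HasDerivAt x (A *ᵥ x t + xh t • B) t := fun t ht => by
    have := (hp.state t ht.le).hasDerivAt (Ici_mem_nhds ht)
    rwa [hh.output t ht.le] at this
  refine ⟨?_, ?_, fun t ht => ?_, fun t ht => ?_, fun T hT => ?_, ?_⟩
  · exact hxc.comp_continuous hcm fun t => Set.mem_Ici.mpr (le_max_right _ _)
  · exact hhc.comp_continuous hcm fun t => Set.mem_Ici.mpr (le_max_right _ _)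
  · rw [max_eq_left ht.le]
    refine (hder t ht).congr_of_eventuallyEq ?_
    filter_upwards [hmax t ht] with s hs
    rw [hs]
  · have := hh.sector_mem t ht
    rw [hh.output t ht, hp.output t ht] at this
    rw [max_eq_left ht]
    exact this
  · have h1 := hh.state_ac T hT
    rw [absolutelyContinuousOnInterval_iff] at h1 ⊢
    intro ε hε
    obtain ⟨δ, hδ, h⟩ := h1 ε hε
    refine ⟨δ, hδ, fun E hE hl => lt_of_le_of_lt (le_of_eq ?_) (h E hE hl)⟩
    refine Finset.sum_congr rfl fun i hi => ?_
    have h2 := hE.1 i hi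
    rw [Set.uIcc_of_le hT] at h2
    rw [max_eq_left h2.1.1, max_eq_left h2.2.1]
  · filter_upwards [hh.modes] with t hm ht
    have hy : deriv y t = C ⬝ᵥ (A *ᵥ x t + xh t • B) := by
      refine ((hasDerivAt_dotProduct C (hder t ht)).congr_of_eventuallyEq ?_).deriv
      filter_upwards [lt_mem_nhds ht] with s hs
      exact hp.output s hs.le
    obtain ⟨h1, h2⟩ := hm ht
    have hsec := hh.sector_mem t ht.le
    rw [hy, hh.output t ht.le, hp.output t ht.le] at h1 h2 hsec
    rw [max_eq_left ht.le]
    by_cases hg : (C ⬝ᵥ x t, xh t, C ⬝ᵥ (A *ᵥ x t + xh t • B)) ∈ gainRegion k ω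
    · exact Or.inr ⟨hg.1, hg.2⟩
    · left
      refine (h1 ⟨hsec, hg⟩).congr_of_eventuallyEq ?_
      filter_upwards [hmax t ht] with s hs
      rw [hs]

/-! ### Pointwise inequalities in the two modes. -/

section Pointwise

variable {k ω : ℝ} {e h : ℝ → ℝ} {t d e' : ℝ}

theorem abs_le_of_sector (hk : 0 < k) {a b : ℝ} (hs : 1 / k * b ^ 2 ≤ a * b) :
    |b| ≤ k * |a| ∧ a * b = |a| * |b| := by
  have h0 : 0 ≤ a * b := le_trans (by positivity) hs
  have h1 : a * b = |a| * |b| := by rw [← abs_mul, abs_of_nonneg h0]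
  refine ⟨?_, h1⟩
  rw [h1, ← sq_abs b, one_div, inv_mul_le_iff₀ hk] at hs
  by_contra hne
  push Not at hne
  have : 0 < |b| := lt_of_le_of_lt (by positivity) hne
  nlinarith

theorem abs_deriv_bound_of_pos (hk : 0 < k) (hpos : 0 < e t) (he : HasDerivAt e e' t)
    (hh : HasDerivAt h d t) (hsec : ∀ᶠ s in 𝓝 t, 1 / k * h s ^ 2 ≤ e s * h s)
    (hmode : d = ω * e t ∨ (h t = k * e t ∧ k * e t * e' < ω * e t ^ 2)) :
    HasDerivAt (fun s => |h s|) d t ∧ d ≤ ω * |e t| := by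
  have hep : ∀ᶠ s in 𝓝 t, 0 < e s := he.continuousAt.eventually_const_lt hpos
  have hhp : ∀ᶠ s in 𝓝 t, 0 ≤ h s := by
    filter_upwards [hsec, hep] with s h1 h2
    exact nonneg_of_mul_nonneg_right (le_trans (by positivity) h1) h2
  constructor
  · refine hh.congr_of_eventuallyEq ?_
    filter_upwards [hhp] with s hs
    exact abs_of_nonneg hs
  · rw [abs_of_pos hpos]
    rcases hmode with h1 | ⟨h1, h2⟩
    · exact h1.le
    -- In gain mode `k e - h` touches its lower bound `0`, so `h' = k e'`; the gain-region
    -- inequality then gives `h' ≤ ω e`.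
    · have hmin : IsLocalMin (fun s => k * e s - h s) t := by
        filter_upwards [hsec, hep, hhp] with s h3 h4 h5
        have := (abs_le_of_sector hk h3).1
        rw [abs_of_nonneg h5, abs_of_pos h4] at this
        rw [h1]; linarith
      have := hmin.hasDerivAt_eq_zero ((he.const_mul k).sub hh)
      have h6 : d = k * e' := by linarith
      rw [h6]
      by_contra hne
      push Not at hne
      nlinarith

theorem exists_abs_deriv_bound (hk : 0 < k) (he : HasDerivAt e e' t)
    (hh : HasDerivAt h d t) (hsec : ∀ᶠ s in 𝓝 t, 1 / k * h s ^ 2 ≤ e s * h s)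
    (hmode : d = ω * e t ∨ (h t = k * e t ∧ k * e t * e' < ω * e t ^ 2)) :
    ∃ d', HasDerivAt (fun s => |h s|) d' t ∧ d' ≤ ω * |e t| := by
  rcases lt_trichotomy (e t) 0 with h0 | h0 | h0
  · have := abs_deriv_bound_of_pos (ω := ω) (e := fun s => -e s) (h := fun s => -h s) hk
      (neg_pos.mpr h0) he.neg hh.neg (by
        filter_upwards [hsec] with s hs
        simpa using hs) (by
        rcases hmode with h1 | ⟨h1, h2⟩
        · left; rw [h1]; ring
        · right
          refine ⟨by rw [h1]; ring, ?_⟩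
          simpa using h2)
    simp only [abs_neg] at this
    exact ⟨-d, this⟩
  · have hd : d = 0 := by
      rcases hmode with h1 | ⟨h1, h2⟩
      · rw [h1, h0, mul_zero]
      · rw [h0] at h2; simp at h2
    have hh0 : h t = 0 := by
      have := (abs_le_of_sector hk hsec.self_of_nhds).1
      rw [h0, abs_zero, mul_zero] at this
      exact abs_nonpos_iff.mp this
    refine ⟨0, ?_, by simp [h0]⟩
    rw [hd, hasDerivAt_iff_isLittleO] at hh
    rw [hasDerivAt_iff_isLittleO]
    refine hh.norm_left.congr_left fun s => ?_
    simp [hh0]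
  · exact ⟨d, abs_deriv_bound_of_pos hk h0 he hh hsec hmode⟩

/-- In integrator mode the left side is `-ω |e| (|e| - |h|/k)`, and `|e|` is at least the gap. In
gain mode both sides vanish. -/
theorem dissipation_of_mode (hk : 0 < k) (hω : 0 ≤ ω) {e h d : ℝ}
    (hsec : 1 / k * h ^ 2 ≤ e * h) (hmode : d = ω * e ∨ h = k * e) :
    (h / k - e) * d ≤ -(ω * (|e| - |h| / k) ^ 2) := by
  obtain ⟨h1, h2⟩ := abs_le_of_sector hk hsec
  rcases hmode with h3 | h3
  · have h4 : |h| / k ≤ |e| := by rwa [div_le_iff₀' hk]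
    have h5 : 0 ≤ |h| / k := by positivity
    have h6 : (h / k - e) * d = -(ω * (|e| * (|e| - |h| / k))) := by
      have : |e| * |e| = e * e := abs_mul_abs_self e
      have h7 : |e| * (|h| / k) = e * h / k := by rw [h2]; ring
      rw [h3, mul_sub, this, h7]; ring
    rw [h6, neg_le_neg_iff]
    refine mul_le_mul_of_nonneg_left ?_ hω
    nlinarith
  · have h4 : h / k - e = 0 := by rw [h3]; field_simp; ring
    have h5 : |e| - |h| / k = 0 := by
      rw [h3, abs_mul, abs_of_pos hk]; field_simp; ring
    rw [h4, h5]; simp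

end Pointwise

/-! ### Energy balance of the closed loop. -/

namespace LoopTrajectory

variable {n : ℕ} {A P : Matrix (Fin n) (Fin n) ℝ} {B C b : Fin n → ℝ} {k ω : ℝ}
  {x : ℝ → Fin n → ℝ} {h : ℝ → ℝ}

theorem continuous_output (T : LoopTrajectory A B C k ω x h) : Continuous fun t => C ⬝ᵥ x t :=
  continuous_const.dotProduct T.cont_x

theorem continuous_velocity (T : LoopTrajectory A B C k ω x h) :
    Continuous fun t => A *ᵥ x t + h t • B :=
  (continuous_const.matrix_mulVec T.cont_x).add (T.cont_h.smul continuous_const)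

theorem abs_state_le (T : LoopTrajectory A B C k ω x h) (hk : 0 < k) {t : ℝ} (ht : 0 ≤ t) :
    |h t| ≤ k * |C ⬝ᵥ x t| :=
  (abs_le_of_sector hk (T.sector t ht)).1

theorem ae_derivs (T : LoopTrajectory A B C k ω x h) :
    ∀ᵐ t : ℝ, 0 < t → ∃ d, HasDerivAt h d t ∧ (d = ω * (C ⬝ᵥ x t) ∨ (h t = k * (C ⬝ᵥ x t) ∧
      k * (C ⬝ᵥ x t) * (C ⬝ᵥ (A *ᵥ x t + h t • B)) < ω * (C ⬝ᵥ x t) ^ 2)) := by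
  have hae : ∀ᵐ t : ℝ, ∀ N : ℕ, t ∈ Set.uIcc (0 : ℝ) N → DifferentiableAt ℝ h t := by
    rw [ae_all_iff]
    exact fun N => (T.ac N N.cast_nonneg).ae_differentiableAt
  filter_upwards [hae, T.modes] with t h1 h2 ht
  obtain ⟨N, hN⟩ := exists_nat_ge t
  have hdiff := h1 N (by rw [Set.uIcc_of_le N.cast_nonneg]; exact ⟨ht.le, hN⟩)
  refine ⟨deriv h t, hdiff.hasDerivAt, ?_⟩
  rcases h2 ht with h3 | h3
  · exact Or.inl h3.deriv
  · exact Or.inr h3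

theorem abs_state_sub_le (T : LoopTrajectory A B C k ω x h) (hk : 0 < k) {s t : ℝ} (hs : 0 ≤ s)
    (hst : s ≤ t) : |h t| - |h s| ≤ ω * ∫ τ in s..t, |C ⬝ᵥ x τ| := by
  rw [← intervalIntegral.integral_const_mul]
  refine sub_le_integral_of_ae_deriv_le (f := fun t => |h t|) (fun S hS => absolutelyContinuousOnInterval_abs (T.ac S hS))
    (continuous_const.mul T.continuous_output.abs) ?_ hs hst
  filter_upwards [T.ae_derivs] with τ h1 hτ
  obtain ⟨d, hd, hm⟩ := h1 hτ
  refine exists_abs_deriv_bound hk (hasDerivAt_dotProduct C (T.deriv_x τ hτ)) hd ?_ hm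
  filter_upwards [lt_mem_nhds hτ] with s hs
  exact T.sector s hs.le

/-- The storage function of the closed loop. -/
def storage (P : Matrix (Fin n) (Fin n) ℝ) (C : Fin n → ℝ) (k : ℝ) (x : Fin n → ℝ) (h : ℝ) : ℝ :=
  1 / 2 * (x ⬝ᵥ P *ᵥ x) + 1 / (2 * k) * h ^ 2 - (C ⬝ᵥ x) * h

/-- The distance of the HIGS state to the sector bound. -/
def gap (C : Fin n → ℝ) (k : ℝ) (x : Fin n → ℝ) (h : ℝ) : ℝ := |C ⬝ᵥ x| - |h| / k

theorem continuous_gap (T : LoopTrajectory A B C k ω x h) :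
    Continuous fun t => gap C k (x t) (h t) :=
  T.continuous_output.abs.sub (T.cont_h.abs.div_const k)

theorem storage_sub_le (T : LoopTrajectory A B C k ω x h) (hk : 0 < k) (hω : 0 ≤ ω) (hP : Pᵀ = P)
    (hd : ∀ x, x ⬝ᵥ P *ᵥ (A *ᵥ x) ≤ 0) (hB : B = -(A *ᵥ b)) (hC : P *ᵥ b = C)
    {s t : ℝ} (hs : 0 ≤ s) (hst : s ≤ t) :
    storage P C k (x t) (h t) + ω * ∫ τ in s..t, gap C k (x τ) (h τ) ^ 2 ≤
      storage P C k (x s) (h s) := by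
  have hq : ∀ t, 0 < t → HasDerivAt (fun t => 1 / 2 * (x t ⬝ᵥ P *ᵥ x t))
      (x t ⬝ᵥ P *ᵥ (A *ᵥ x t + h t • B)) t := by
    intro t ht
    have hx := T.deriv_x t ht
    set v := A *ᵥ x t + h t • B
    have h1 : HasDerivAt (fun t => x t ⬝ᵥ P *ᵥ x t) (v ⬝ᵥ P *ᵥ x t + x t ⬝ᵥ P *ᵥ v) t := by
      simp only [dotProduct, ← Finset.sum_add_distrib]
      refine HasDerivAt.fun_sum fun i _ => ?_
      have h2 : HasDerivAt (fun t => (P *ᵥ x t) i) ((P *ᵥ v) i) t :=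
        hasDerivAt_dotProduct (P i) hx
      exact (hasDerivAt_pi.mp hx i).mul h2
    have h3 : v ⬝ᵥ P *ᵥ x t = x t ⬝ᵥ P *ᵥ v := by
      rw [Matrix.dotProduct_mulVec, ← Matrix.mulVec_transpose, hP, dotProduct_comm]
    convert! h1.const_mul (1 / 2) using 1
    rw [h3]; ring
  have hcq : Continuous fun t => x t ⬝ᵥ P *ᵥ (A *ᵥ x t + h t • B) :=
    T.cont_x.dotProduct (continuous_const.matrix_mulVec T.continuous_velocity)
  have hqc : Continuous fun t => 1 / 2 * (x t ⬝ᵥ P *ᵥ x t) :=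
    continuous_const.mul (T.cont_x.dotProduct (continuous_const.matrix_mulVec T.cont_x))
  have hac : ∀ S, 0 ≤ S →
      AbsolutelyContinuousOnInterval (fun t => storage P C k (x t) (h t)) 0 S := by
    intro S hS
    have h1 := absolutelyContinuousOnInterval_of_hasDerivAt hqc hcq hq hS
    have h2 := (((T.ac S hS).fun_mul (T.ac S hS)).const_mul (1 / (2 * k)))
    have h3 := absolutelyContinuousOnInterval_of_hasDerivAt T.continuous_output
      (continuous_const.dotProduct T.continuous_velocity)
      (fun t ht => hasDerivAt_dotProduct C (T.deriv_x t ht)) hS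
    have h4 := (h1.add h2).sub (h3.fun_mul (T.ac S hS))
    have h5 : (fun t => storage P C k (x t) (h t)) =
        ((fun t => 1 / 2 * (x t ⬝ᵥ P *ᵥ x t)) + fun t => 1 / (2 * k) * (h t * h t)) -
          fun t => (C ⬝ᵥ x t) * h t := by
      funext t
      simp only [storage, Pi.add_apply, Pi.sub_apply]
      ring
    rw [h5]
    exact h4
  have hmain := sub_le_integral_of_ae_deriv_le (g := fun t => -(ω * gap C k (x t) (h t) ^ 2)) hac
    (continuous_const.mul (T.continuous_gap.pow 2)).neg (by
      filter_upwards [T.ae_derivs] with t h1 ht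
      obtain ⟨d, hdt, hm⟩ := h1 ht
      have he := hasDerivAt_dotProduct C (T.deriv_x t ht)
      refine ⟨_, ((hq t ht).add ((hdt.pow 2).const_mul (1 / (2 * k)))).sub (he.mul hdt), ?_⟩
      have hdis := dissipation_of_mode hk hω (T.sector t ht.le) (hm.imp_right And.left)
      have hv : A *ᵥ x t + h t • B = A *ᵥ (x t - h t • b) := by
        rw [hB, Matrix.mulVec_sub, Matrix.mulVec_smul, smul_neg]; abel
      -- Since `B = -A b` and `C = P b`, this is the form `zᵀ P A z` at `z = x - h b`.
      have hkyp : x t ⬝ᵥ P *ᵥ (A *ᵥ x t + h t • B) -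
          h t * (C ⬝ᵥ (A *ᵥ x t + h t • B)) ≤ 0 := by
        have h2 := hd (x t - h t • b)
        have h3 : C ⬝ᵥ (A *ᵥ x t + h t • B) = b ⬝ᵥ P *ᵥ (A *ᵥ x t + h t • B) := by
          rw [← hC, Matrix.dotProduct_mulVec b, ← Matrix.mulVec_transpose, hP]
        rw [h3, ← smul_eq_mul, ← smul_dotProduct, ← sub_dotProduct, hv]
        exact h2
      have h6 : 1 / (2 * k) * (((2 : ℕ) : ℝ) * h t ^ (2 - 1) * d) = h t / k * d := by
        push_cast; field_simp
      simp only [gap]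
      rw [h6]
      linarith) hs hst
  rw [intervalIntegral.integral_neg, intervalIntegral.integral_const_mul] at hmain
  linarith

end LoopTrajectory

end

end HIGS

namespace HIGS

/-! ### An observability inequality -/

noncomputable section

open Filter Topology MeasureTheory

section Flow

variable {E : Type*} [NormedAddCommGroup E] [NormedSpace ℝ E]

/-- The flow of the linear equation `ẋ = L x`. -/
def linearFlow (L : E →L[ℝ] E) (t : ℝ) : E →L[ℝ] E := NormedSpace.exp (t • L)

theorem commute_linearFlow (L : E →L[ℝ] E) (t : ℝ) : L * linearFlow L t = linearFlow L t * L :=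
  ((Commute.refl L).smul_right t).exp_right

variable [CompleteSpace E]

theorem hasDerivAt_linearFlow (L : E →L[ℝ] E) (t : ℝ) :
    HasDerivAt (linearFlow L) (L * linearFlow L t) t :=
  hasDerivAt_exp_smul_const' L t

theorem continuous_linearFlow (L : E →L[ℝ] E) : Continuous (linearFlow L) :=
  continuous_iff_continuousAt.mpr fun t => (hasDerivAt_linearFlow L t).continuousAt

theorem linearFlow_mul_neg (L : E →L[ℝ] E) (t : ℝ) : linearFlow L t * linearFlow L (-t) = 1 := by
  let _ : NormedAlgebra ℚ (E →L[ℝ] E) := .restrictScalars ℚ ℝ (E →L[ℝ] E)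
  rw [linearFlow, linearFlow, ← NormedSpace.exp_add_of_commute, ← add_smul, add_neg_cancel,
    zero_smul, NormedSpace.exp_zero]
  exact ((Commute.refl L).smul_right _).smul_left _

theorem linearFlow_neg_mul (L : E →L[ℝ] E) (t : ℝ) : linearFlow L (-t) * linearFlow L t = 1 := by
  simpa using linearFlow_mul_neg L (-t)

theorem eq_zero_of_output_eq_zero {L : E →L[ℝ] E} {ℓ : E →L[ℝ] ℝ}
    (hobs : ∀ x, (∀ j : ℕ, ℓ ((L ^ j) x) = 0) → x = 0) {x : E}
    (h : ∀ t ∈ Set.Ioo (0 : ℝ) 1, ℓ (linearFlow L t x) = 0) : x = 0 := by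
  have key : ∀ j : ℕ, ∀ t ∈ Set.Ioo (0 : ℝ) 1, ℓ ((L ^ j) (linearFlow L t x)) = 0 := by
    intro j
    induction j with
    | zero => simpa using h
    | succ j ih =>
      intro t ht
      have h1 : HasDerivAt (fun t => linearFlow L t x) (L (linearFlow L t x)) t := by
        simpa using (hasDerivAt_linearFlow L t).clm_apply (hasDerivAt_const t x)
      have h2 := (ℓ.comp (L ^ j)).hasFDerivAt.comp_hasDerivAt t h1
      have h3 : HasDerivAt (ℓ.comp (L ^ j) ∘ fun t => linearFlow L t x) 0 t := by
        refine (hasDerivAt_const t (0 : ℝ)).congr_of_eventuallyEq ?_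
        filter_upwards [Ioo_mem_nhds ht.1 ht.2] with s hs
        exact ih s hs
      rw [pow_succ]
      exact h2.unique h3
  have h1 := hobs _ fun j => key j (1 / 2) (by norm_num)
  have h2 := congrArg (fun M : E →L[ℝ] E => M x) (linearFlow_neg_mul L (1 / 2))
  have h3 : linearFlow L (-(1 / 2)) (linearFlow L (1 / 2) x) = x := h2
  rw [← h3, h1, map_zero]

theorem exists_pos_le_of_norm_eq_one {E : Type*} [NormedAddCommGroup E] [NormedSpace ℝ E]
    [FiniteDimensional ℝ E] {f : E → ℝ} (hf : Continuous f) (hpos : ∀ x, x ≠ 0 → 0 < f x) :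
    ∃ γ : ℝ, 0 < γ ∧ ∀ x, ‖x‖ = 1 → γ ≤ f x := by
  have := FiniteDimensional.proper ℝ E
  rcases (Metric.sphere (0 : E) 1).eq_empty_or_nonempty with he | hne
  · refine ⟨1, one_pos, fun x hx => ?_⟩
    have h1 := mem_sphere_zero_iff_norm.mpr hx
    rw [he] at h1
    exact absurd h1 (Set.notMem_empty _)
  · obtain ⟨z, hz, hmin⟩ := (isCompact_sphere (0 : E) 1).exists_isMinOn hne hf.continuousOn
    have hz1 : ‖z‖ = 1 := mem_sphere_zero_iff_norm.mp hz
    exact ⟨f z, hpos z (by rintro rfl; simp at hz1), fun x hx =>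
      hmin (mem_sphere_zero_iff_norm.mpr hx)⟩

/-- The integral is continuous and homogeneous in `x`, and positive off zero by observability;
compactness of the sphere gives `γ`. -/
theorem exists_le_integral_output [FiniteDimensional ℝ E] {L : E →L[ℝ] E} {ℓ : E →L[ℝ] ℝ}
    (hobs : ∀ x, (∀ j : ℕ, ℓ ((L ^ j) x) = 0) → x = 0) :
    ∃ γ : ℝ, 0 < γ ∧ ∀ x, γ * ‖x‖ ≤ ∫ t in (0 : ℝ)..1, |ℓ (linearFlow L t x)| := by
  have hcont : Continuous fun p : E × ℝ => |ℓ (linearFlow L p.2 p.1)| :=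
    (ℓ.continuous.comp (((continuous_linearFlow L).comp continuous_snd).clm_apply
      continuous_fst)).abs
  have hN : Continuous fun x : E => ∫ t in (0 : ℝ)..1, |ℓ (linearFlow L t x)| :=
    intervalIntegral.continuous_parametric_intervalIntegral_of_continuous' hcont 0 1
  have hpos : ∀ x : E, x ≠ 0 → 0 < ∫ t in (0 : ℝ)..1, |ℓ (linearFlow L t x)| := by
    intro x hx
    by_contra hle
    refine hx (eq_zero_of_output_eq_zero hobs fun t ht => ?_)
    by_contra hne
    refine hle (intervalIntegral.integral_pos one_pos ?_ (fun _ _ => abs_nonneg _)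
      ⟨t, Set.Ioo_subset_Icc_self ht, abs_pos.mpr hne⟩)
    exact (hcont.comp (Continuous.prodMk_right x)).continuousOn
  obtain ⟨γ, hγ, hmin⟩ := exists_pos_le_of_norm_eq_one hN hpos
  refine ⟨γ, hγ, fun x => ?_⟩
  by_cases hx : x = 0
  · simp [hx]
  · have h2 := hmin _ (norm_smul_inv_norm (𝕜 := ℝ) hx)
    simp only [RCLike.ofReal_real_eq_id, id_eq, map_smul, smul_eq_mul, abs_mul, abs_inv, abs_norm,
      intervalIntegral.integral_const_mul] at h2
    rwa [← div_eq_inv_mul, le_div_iff₀ (norm_pos_iff.mpr hx)] at h2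

/-- The input is dominated by the output, so by variation of constants the true and free outputs
differ by a multiple of `∫ |ℓ x|`. The inequality for the free flow therefore survives with a larger
constant. -/
theorem norm_le_integral_output [FiniteDimensional ℝ E] {L : E →L[ℝ] E} {ℓ : E →L[ℝ] ℝ} (b : E)
    {k : ℝ} (hk : 0 ≤ k) (hobs : ∀ x, (∀ j : ℕ, ℓ ((L ^ j) x) = 0) → x = 0) :
    ∃ Γ : ℝ, 0 ≤ Γ ∧ ∀ (x : ℝ → E) (u : ℝ → ℝ), Continuous x → Continuous u →
      (∀ t, 0 < t → HasDerivAt x (L (x t) + u t • b) t) →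
      (∀ t, 0 ≤ t → |u t| ≤ k * |ℓ (x t)|) →
      ∀ s, 0 ≤ s → ‖x s‖ ≤ Γ * ∫ t in s..s + 1, |ℓ (x t)| := by
  obtain ⟨γ, hγ, hobs'⟩ := exists_le_integral_output hobs
  obtain ⟨M, hM⟩ := isCompact_Icc.exists_bound_of_continuousOn (s := Set.Icc (-1 : ℝ) 1)
    (continuous_linearFlow L).continuousOn
  have hM0 : 0 ≤ M := (norm_nonneg _).trans (hM 0 (by norm_num))
  refine ⟨(1 + ‖ℓ‖ * M * (M * ‖b‖ * k)) / γ, by positivity, fun x u hx hu hd hb s hs => ?_⟩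
  set I := ∫ t in s..s + 1, |ℓ (x t)| with hI
  have hec : Continuous fun t => |ℓ (x (s + t))| := by fun_prop
  have hI' : I = ∫ t in (0 : ℝ)..1, |ℓ (x (s + t))| := by
    rw [intervalIntegral.integral_comp_add_left (fun t => |ℓ (x t)|), add_zero]
  have hFc : Continuous fun t => linearFlow L (-t) := (continuous_linearFlow L).comp continuous_neg
  set w : ℝ → E := fun t => linearFlow L (-t) (x (s + t)) with hw
  have hwc : Continuous w := hFc.clm_apply (hx.comp (continuous_const.add continuous_id))
  have hwd : ∀ t, 0 < t → HasDerivAt w (linearFlow L (-t) (u (s + t) • b)) t := by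
    intro t ht
    have h1 : HasDerivAt (fun t => linearFlow L (-t)) (-(L * linearFlow L (-t))) t := by
      have := (hasDerivAt_linearFlow L (-t)).scomp t (hasDerivAt_neg t)
      rw [neg_one_smul] at this
      exact this
    have h2 : HasDerivAt (fun t => x (s + t)) (L (x (s + t)) + u (s + t) • b) t := by
      simpa using (hd (s + t) (by linarith)).comp_const_add s t
    have h3 := h1.clm_apply h2
    convert! h3 using 1
    rw [commute_linearFlow, map_add]
    simp
  have hvc : Continuous fun t => linearFlow L (-t) (u (s + t) • b) :=
    hFc.clm_apply (by fun_prop)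
  have hw0 : w 0 = x s := by simp [hw, linearFlow]
  have hwI : ∀ t ∈ Set.Icc (0 : ℝ) 1, ‖w t - x s‖ ≤ M * ‖b‖ * k * I := by
    intro t ht
    rw [← hw0, ← intervalIntegral.integral_eq_sub_of_hasDerivAt_of_le ht.1 hwc.continuousOn
      (fun τ hτ => hwd τ hτ.1) (hvc.intervalIntegrable _ _), hI',
      ← intervalIntegral.integral_const_mul]
    have hgc : Continuous fun τ => M * ‖b‖ * k * |ℓ (x (s + τ))| := continuous_const.mul hec
    refine (intervalIntegral.norm_integral_le_of_norm_le ht.1 (ae_of_all _ fun τ hτ => ?_)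
      (hgc.intervalIntegrable _ _)).trans
      (intervalIntegral.integral_mono_interval le_rfl ht.1 ht.2
        (ae_of_all _ fun τ => by positivity) (hgc.intervalIntegrable _ _))
    have h1 := hM (-τ) ⟨by linarith [hτ.2, ht.2], by linarith [hτ.1]⟩
    have h2 := hb (s + τ) (by linarith [hτ.1])
    calc ‖linearFlow L (-τ) (u (s + τ) • b)‖ ≤ ‖linearFlow L (-τ)‖ * ‖u (s + τ) • b‖ :=
          ContinuousLinearMap.le_opNorm _ _
      _ ≤ M * (k * |ℓ (x (s + τ))| * ‖b‖) := by
          rw [norm_smul, Real.norm_eq_abs]; gcongr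
      _ = M * ‖b‖ * k * |ℓ (x (s + τ))| := by ring
  have hfin : ∫ t in (0 : ℝ)..1, |ℓ (linearFlow L t (x s))| ≤
      ∫ t in (0 : ℝ)..1, (|ℓ (x (s + t))| + ‖ℓ‖ * M * (M * ‖b‖ * k * I)) := by
    refine intervalIntegral.integral_mono_on zero_le_one ?_ ?_ fun t ht => ?_
    · exact (ℓ.continuous.comp ((continuous_linearFlow L).clm_apply
        continuous_const)).abs.intervalIntegrable _ _
    · exact (hec.add continuous_const).intervalIntegrable _ _
    · have h1 : linearFlow L t (w t) = x (s + t) := by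
        have := congrArg (fun Q : E →L[ℝ] E => Q (x (s + t))) (linearFlow_mul_neg L t)
        simpa [hw] using this
      have h2 : linearFlow L t (x s) = x (s + t) - linearFlow L t (w t - x s) := by
        rw [map_sub, h1]; abel
      have h3 := hM t ⟨by linarith [ht.1], ht.2⟩
      rw [h2, map_sub]
      refine (abs_sub _ _).trans (add_le_add_right ?_ _)
      rw [← Real.norm_eq_abs]
      calc ‖ℓ (linearFlow L t (w t - x s))‖ ≤ ‖ℓ‖ * (‖linearFlow L t‖ * ‖w t - x s‖) :=
            (ℓ.le_opNorm _).trans (by gcongr; exact ContinuousLinearMap.le_opNorm _ _)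
        _ ≤ ‖ℓ‖ * (M * (M * ‖b‖ * k * I)) := by
            gcongr
            exact hwI t ht
        _ = _ := by ring
  rw [intervalIntegral.integral_add (hec.intervalIntegrable _ _)
    intervalIntegrable_const, ← hI'] at hfin
  simp only [intervalIntegral.integral_const, sub_zero, one_smul] at hfin
  rw [div_mul_eq_mul_div, le_div_iff₀ hγ]
  linarith [hobs' (x s)]

end Flow

theorem LoopTrajectory.exists_norm_le_integral {n : ℕ} {A : Matrix (Fin n) (Fin n) ℝ}
    {B C : Fin n → ℝ} {k ω : ℝ} (hk : 0 < k) (hobs : IsObservable A C) :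
    ∃ Γ : ℝ, 0 ≤ Γ ∧ ∀ x h, LoopTrajectory A B C k ω x h →
      ∀ s, 0 ≤ s → ‖x s‖ ≤ Γ * ∫ t in s..s + 1, |C ⬝ᵥ x t| := by
  set L : (Fin n → ℝ) →L[ℝ] (Fin n → ℝ) := LinearMap.toContinuousLinearMap A.mulVecLin with hL
  set ℓ : (Fin n → ℝ) →L[ℝ] ℝ := LinearMap.toContinuousLinearMap (dotProductBilin ℝ ℝ C) with hℓ
  have hLx : ∀ x, L x = A *ᵥ x := fun x => rfl
  have hℓx : ∀ x, ℓ x = C ⬝ᵥ x := fun x => rfl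
  have hpow : ∀ (j : ℕ) x, (L ^ j) x = A ^ j *ᵥ x := by
    intro j
    induction j with
    | zero => simp
    | succ j ih =>
      intro x
      rw [pow_succ, mul_apply_eq_comp, ih, hLx, Matrix.mulVec_mulVec, ← pow_succ]
  obtain ⟨Γ, hΓ, h⟩ := norm_le_integral_output (L := L) (ℓ := ℓ) B hk.le fun x hx =>
    hobs.eq_zero fun j => by simpa only [hpow, hℓx] using hx j
  exact ⟨Γ, hΓ, fun x u T => h x u T.cont_x T.cont_h T.deriv_x fun t ht => T.abs_state_le hk ht⟩

end

end HIGS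

namespace HIGS

/-! ### Asymptotic stability -/

noncomputable section

open Filter Topology MeasureTheory

variable {n : ℕ} {A P : Matrix (Fin n) (Fin n) ℝ} {B C b : Fin n → ℝ} {k ω : ℝ}

theorem exists_quadratic_lower_bound (hpos : ∀ x ≠ 0, 0 < x ⬝ᵥ P *ᵥ x) :
    ∃ p : ℝ, 0 < p ∧ ∀ x, p * ‖x‖ ^ 2 ≤ x ⬝ᵥ P *ᵥ x := by
  have hc : Continuous fun x : Fin n → ℝ => x ⬝ᵥ P *ᵥ x :=
    continuous_id.dotProduct (continuous_const.matrix_mulVec continuous_id)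
  obtain ⟨p, hp, h⟩ := exists_pos_le_of_norm_eq_one hc hpos
  refine ⟨p, hp, fun x => ?_⟩
  by_cases hx : x = 0
  · simp [hx]
  · have h2 := h _ (norm_smul_inv_norm (𝕜 := ℝ) hx)
    have h0 : 0 < ‖x‖ := norm_pos_iff.mpr hx
    simp only [RCLike.ofReal_real_eq_id, id_eq, Matrix.mulVec_smul, smul_dotProduct,
      dotProduct_smul, smul_eq_mul] at h2
    rw [← div_eq_inv_mul, le_div_iff₀ h0, ← div_eq_inv_mul, le_div_iff₀ h0] at h2
    linarith

theorem exists_quadratic_upper_bound (P : Matrix (Fin n) (Fin n) ℝ) :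
    ∃ q : ℝ, 0 ≤ q ∧ ∀ x, x ⬝ᵥ P *ᵥ x ≤ q * ‖x‖ ^ 2 := by
  obtain ⟨a, ha0, ha⟩ := exists_norm_mulVec_le_real P
  refine ⟨n * a, by positivity, fun x => ?_⟩
  calc x ⬝ᵥ P *ᵥ x ≤ ∑ _i : Fin n, ‖x‖ * (a * ‖x‖) := by
        refine Finset.sum_le_sum fun i _ => (le_abs_self _).trans ?_
        rw [abs_mul]
        exact mul_le_mul (norm_le_pi_norm x i) ((norm_le_pi_norm (P *ᵥ x) i).trans (ha x))
          (abs_nonneg _) (norm_nonneg _)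
    _ = n * a * ‖x‖ ^ 2 := by
        rw [Finset.sum_const, Finset.card_univ, Fintype.card_fin, nsmul_eq_mul]; ring

namespace LoopTrajectory

/-- Young's inequality gives `(C x) h ≤ c² k ‖x‖² + h² / (4k)`. The choice of `k` makes `c² k ≤
p/4`, leaving a share of each square. -/
theorem exists_storage_lower_bound (hpos : ∀ x ≠ 0, 0 < x ⬝ᵥ P *ᵥ x) (C : Fin n → ℝ) :
    ∃ k μ : ℝ, 0 < k ∧ 0 < μ ∧ ∀ x h, μ * (‖x‖ ^ 2 + h ^ 2) ≤ storage P C k x h := by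
  obtain ⟨p, hp, hP⟩ := exists_quadratic_lower_bound hpos
  obtain ⟨c, hc0, hc⟩ := exists_abs_dotProduct_le C
  have hk : 0 < p / (4 * c ^ 2 + 1) := by positivity
  set k := p / (4 * c ^ 2 + 1) with hkdef
  refine ⟨k, min (p / 4) (1 / (4 * k)), hk, by positivity, fun x h => ?_⟩
  have h1 : (C ⬝ᵥ x) * h ≤ c * ‖x‖ * |h| := by
    refine (le_abs_self _).trans ?_
    rw [abs_mul]
    exact mul_le_mul_of_nonneg_right (hc x) (abs_nonneg _)
  have h2 : c ^ 2 * k ≤ p / 4 := by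
    rw [hkdef, mul_div_assoc', div_le_div_iff₀ (by positivity) (by norm_num)]
    nlinarith
  have h3 : c * ‖x‖ * |h| ≤ c ^ 2 * k * ‖x‖ ^ 2 + 1 / (4 * k) * h ^ 2 := by
    have h4 : c ^ 2 * k * ‖x‖ ^ 2 + 1 / (4 * k) * h ^ 2 - c * ‖x‖ * |h| =
        (2 * k * (c * ‖x‖) - |h|) ^ 2 / (4 * k) := by
      rw [← sq_abs h]; field_simp; ring
    have h5 : 0 ≤ (2 * k * (c * ‖x‖) - |h|) ^ 2 / (4 * k) := by positivity
    linarith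
  have h6 : c ^ 2 * k * ‖x‖ ^ 2 ≤ p / 4 * ‖x‖ ^ 2 := by gcongr
  have h7 : 1 / (2 * k) * h ^ 2 = 1 / (4 * k) * h ^ 2 + 1 / (4 * k) * h ^ 2 := by
    field_simp; ring
  have h8 : min (p / 4) (1 / (4 * k)) * ‖x‖ ^ 2 ≤ p / 4 * ‖x‖ ^ 2 := by
    gcongr; exact min_le_left _ _
  have h9 : min (p / 4) (1 / (4 * k)) * h ^ 2 ≤ 1 / (4 * k) * h ^ 2 := by
    gcongr; exact min_le_right _ _
  rw [storage]
  linarith [hP x]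

/-- Inside the sector the cross term outweighs `h² / (2k)`, so the plant state alone controls the
storage. -/
theorem exists_storage_upper_bound (P : Matrix (Fin n) (Fin n) ℝ) (C : Fin n → ℝ) (hk : 0 < k) :
    ∃ q : ℝ, 0 ≤ q ∧ ∀ x h, 1 / k * h ^ 2 ≤ (C ⬝ᵥ x) * h → storage P C k x h ≤ q * ‖x‖ ^ 2 := by
  obtain ⟨q, hq, hP⟩ := exists_quadratic_upper_bound P
  refine ⟨q, hq, fun x h hs => ?_⟩
  have h1 : 1 / (2 * k) * h ^ 2 ≤ 1 / k * h ^ 2 := by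
    gcongr; linarith
  have h2 : 0 ≤ q * ‖x‖ ^ 2 := by positivity
  rw [storage]
  linarith [hP x]

/-- The gain-mode dynamics `A + k B C` are invertible; this expresses the output through them. -/
theorem exists_output_functional (hA : A.det ≠ 0) (hB : B = -(A *ᵥ b)) (hC : P *ᵥ b = C) {μ : ℝ} (hμ : 0 < μ)
    (hlow : ∀ x h, μ * (‖x‖ ^ 2 + h ^ 2) ≤ storage P C k x h) :
    ∃ r : Fin n → ℝ, ∀ z, r ⬝ᵥ (A *ᵥ z + (k * (C ⬝ᵥ z)) • B) = C ⬝ᵥ z := by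
  set M := A + Matrix.vecMulVec B (k • C) with hM
  have hMz : ∀ z, M *ᵥ z = A *ᵥ z + (k * (C ⬝ᵥ z)) • B := by
    intro z
    rw [hM, Matrix.add_mulVec, Matrix.vecMulVec_mulVec, smul_dotProduct, op_smul_eq_smul,
      smul_eq_mul]
  have hdet : M.det ≠ 0 := by
    intro hdet
    obtain ⟨z, hz, h0⟩ := Matrix.exists_mulVec_eq_zero_iff.mpr hdet
    refine hz ?_
    rw [hMz, hB, smul_neg, ← Matrix.mulVec_smul, ← sub_eq_add_neg, ← Matrix.mulVec_sub] at h0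
    -- A kernel vector would be a gain-mode equilibrium, at which the storage vanishes,
    -- contradicting its lower bound.
    have h1 : z = (k * (C ⬝ᵥ z)) • b := by
      have := Matrix.eq_zero_of_mulVec_eq_zero hA h0
      exact sub_eq_zero.mp this
    have h2 : z ⬝ᵥ P *ᵥ z = k * (C ⬝ᵥ z) ^ 2 := by
      have h3 : P *ᵥ z = (k * (C ⬝ᵥ z)) • C := by
        conv_lhs => rw [h1]
        rw [Matrix.mulVec_smul, hC]
      rw [h3, dotProduct_smul, dotProduct_comm, smul_eq_mul]; ring
    have h4 := hlow z (k * (C ⬝ᵥ z))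
    have h5 : storage P C k z (k * (C ⬝ᵥ z)) = 0 := by
      rw [storage, h2]; field_simp; ring
    rw [h5] at h4
    have h6 : ‖z‖ ^ 2 + (k * (C ⬝ᵥ z)) ^ 2 ≤ 0 := nonpos_of_mul_nonpos_right h4 hμ
    have h7 : ‖z‖ ^ 2 = 0 := le_antisymm (by nlinarith [sq_nonneg (k * (C ⬝ᵥ z))]) (by positivity)
    exact norm_eq_zero.mp (pow_eq_zero_iff two_ne_zero |>.mp h7)
  refine ⟨C ᵥ* M⁻¹, fun z => ?_⟩
  rw [← hMz, ← Matrix.dotProduct_mulVec, Matrix.mulVec_mulVec,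
    Matrix.nonsing_inv_mul _ (isUnit_iff_ne_zero.mpr hdet), Matrix.one_mulVec]

variable {x : ℝ → Fin n → ℝ} {h : ℝ → ℝ}

theorem gap_nonneg (T : LoopTrajectory A B C k ω x h) (hk : 0 < k) {t : ℝ} (ht : 0 ≤ t) :
    0 ≤ gap C k (x t) (h t) := by
  rw [gap, sub_nonneg, div_le_iff₀' hk]
  exact T.abs_state_le hk ht

theorem abs_sub_eq_gap (T : LoopTrajectory A B C k ω x h) (hk : 0 < k) {t : ℝ} (ht : 0 ≤ t) :
    |h t - k * (C ⬝ᵥ x t)| = k * gap C k (x t) (h t) := by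
  obtain ⟨h1, h2⟩ := abs_le_of_sector hk (T.sector t ht)
  have h3 : k * gap C k (x t) (h t) = k * |C ⬝ᵥ x t| - |h t| := by
    rw [gap]; field_simp
  have h4 := T.gap_nonneg hk ht
  rw [h3, ← abs_of_nonneg (sub_nonneg.mpr h1), ← sq_eq_sq_iff_abs_eq_abs]
  have h5 := sq_abs (h t)
  have h6 := sq_abs (C ⬝ᵥ x t)
  linear_combination (-1) * h5 - k ^ 2 * h6 - 2 * k * h2

theorem integral_gap_mono (T : LoopTrajectory A B C k ω x h) (hk : 0 < k) {s s' t t' : ℝ}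
    (h0 : 0 ≤ s) (h1 : s ≤ s') (h2 : s' ≤ t') (h3 : t' ≤ t) :
    ∫ τ in s'..t', gap C k (x τ) (h τ) ≤ ∫ τ in s..t, gap C k (x τ) (h τ) := by
  refine intervalIntegral.integral_mono_interval h1 h2 h3 ?_
    (T.continuous_gap.intervalIntegrable _ _)
  rw [EventuallyLE, ae_restrict_iff' measurableSet_Ioc]
  exact ae_of_all _ fun τ hτ => T.gap_nonneg hk (h0.trans hτ.1.le)

/-- Otherwise, by Cauchy–Schwarz, each window of length `l` would cost `V` at least `ω σ² / l`,
which a nonnegative `V` cannot afford indefinitely. -/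
theorem exists_integral_gap_le (T : LoopTrajectory A B C k ω x h) (hω : 0 < ω)
    {V : ℝ → ℝ} (hV0 : ∀ t, 0 ≤ t → 0 ≤ V t)
    (hV : ∀ s t, 0 ≤ s → s ≤ t → V t + ω * ∫ τ in s..t, gap C k (x τ) (h τ) ^ 2 ≤ V s)
    {l σ : ℝ} (hl : 0 < l) (hσ : 0 < σ) :
    ∃ s, 0 ≤ s ∧ ∫ τ in s..s + l, gap C k (x τ) (h τ) ≤ σ := by
  by_contra! hne
  have hqc : Continuous fun τ => l / (2 * σ) * gap C k (x τ) (h τ) ^ 2 :=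
    continuous_const.mul (T.continuous_gap.pow 2)
  have hstep : ∀ s, 0 ≤ s → V (s + l) ≤ V s - ω * (σ ^ 2 / l) := by
    intro s hs
    have h1 := hne s hs
    have h2 : ∫ τ in s..s + l, gap C k (x τ) (h τ) ≤
        ∫ τ in s..s + l, (σ / (2 * l) + l / (2 * σ) * gap C k (x τ) (h τ) ^ 2) := by
      refine intervalIntegral.integral_mono_on (by linarith)
        (T.continuous_gap.intervalIntegrable _ _)
        ((continuous_const.add hqc).intervalIntegrable _ _) fun τ _ => ?_
      set g := gap C k (x τ) (h τ)
      have h4 : σ / (2 * l) + l / (2 * σ) * g ^ 2 - g = (σ - l * g) ^ 2 / (2 * l * σ) := by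
        field_simp; ring
      have h5 : 0 ≤ (σ - l * g) ^ 2 / (2 * l * σ) := by positivity
      linarith
    rw [intervalIntegral.integral_add intervalIntegrable_const
      (hqc.intervalIntegrable _ _),
      intervalIntegral.integral_const, intervalIntegral.integral_const_mul, add_sub_cancel_left,
      smul_eq_mul] at h2
    have h3 : l * (σ / (2 * l)) = σ / 2 := by field_simp
    have h4 : σ / 2 < l / (2 * σ) * ∫ τ in s..s + l, gap C k (x τ) (h τ) ^ 2 := by linarith
    have h5 : σ ^ 2 / l < ∫ τ in s..s + l, gap C k (x τ) (h τ) ^ 2 := by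
      rw [div_lt_iff₀ hl]
      rw [div_mul_eq_mul_div, lt_div_iff₀ (by positivity)] at h4
      nlinarith
    have h6 := mul_le_mul_of_nonneg_left h5.le hω.le
    linarith [hV s (s + l) hs (by linarith)]
  have hind : ∀ j : ℕ, V (j * l) ≤ V 0 - j * (ω * (σ ^ 2 / l)) := by
    intro j
    induction j with
    | zero => simp
    | succ j ih =>
      have := hstep (j * l) (by positivity)
      push_cast
      rw [add_mul, one_mul]
      linarith
  obtain ⟨j, hj⟩ := exists_nat_gt (V 0 / (ω * (σ ^ 2 / l)))
  rw [div_lt_iff₀ (by positivity)] at hj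
  linarith [hind j, hV0 (j * l) (by positivity)]

/-- The derivative of `r ⬝ᵥ x` is `e + (r ⬝ᵥ B) (h - k e)`, and `|h - k e|` is `k` times the gap.
Integrating bounds `∫ e` by boundary terms and `∫ g`. -/
theorem exists_abs_integral_output_le (hk : 0 < k) {r : Fin n → ℝ}
    (hr : ∀ z, r ⬝ᵥ (A *ᵥ z + (k * (C ⬝ᵥ z)) • B) = C ⬝ᵥ z) :
    ∃ c : ℝ, 0 ≤ c ∧ ∀ x h, LoopTrajectory A B C k ω x h → ∀ s t, 0 ≤ s → s ≤ t →
      |∫ τ in s..t, C ⬝ᵥ x τ| ≤ c * (‖x s‖ + ‖x t‖ + ∫ τ in s..t, gap C k (x τ) (h τ)) := by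
  obtain ⟨c, hc0, hc⟩ := exists_abs_dotProduct_le r
  refine ⟨max c (|r ⬝ᵥ B| * k), le_max_of_le_left hc0, fun x h T s t hs hst => ?_⟩
  set m := max c (|r ⬝ᵥ B| * k)
  set e := fun τ => C ⬝ᵥ x τ with he
  have hec : Continuous e := T.continuous_output
  have hdc : Continuous fun τ => h τ - k * e τ := T.cont_h.sub (continuous_const.mul hec)
  have hrc : Continuous fun τ => (r ⬝ᵥ B) * (h τ - k * e τ) := continuous_const.mul hdc
  have hv : ∀ τ, r ⬝ᵥ (A *ᵥ x τ + h τ • B) = e τ + (r ⬝ᵥ B) * (h τ - k * e τ) := by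
    intro τ
    have h1 : A *ᵥ x τ + h τ • B =
        (A *ᵥ x τ + (k * (C ⬝ᵥ x τ)) • B) + (h τ - k * (C ⬝ᵥ x τ)) • B := by
      rw [sub_smul]; abel
    rw [h1, dotProduct_add, hr, dotProduct_smul, smul_eq_mul, mul_comm (r ⬝ᵥ B)]
  have h2 := intervalIntegral.integral_eq_sub_of_hasDerivAt_of_le hst
    (continuous_const.dotProduct T.cont_x : Continuous fun τ => r ⬝ᵥ x τ).continuousOn
    (fun τ hτ => hasDerivAt_dotProduct r (T.deriv_x τ (hs.trans_lt hτ.1)))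
    ((continuous_const.dotProduct T.continuous_velocity).intervalIntegrable _ _)
  simp only [hv] at h2
  rw [intervalIntegral.integral_add (hec.intervalIntegrable _ _)
    (hrc.intervalIntegrable _ _), intervalIntegral.integral_const_mul] at h2
  have h3 : |∫ τ in s..t, (h τ - k * e τ)| ≤ k * ∫ τ in s..t, gap C k (x τ) (h τ) := by
    rw [← intervalIntegral.integral_const_mul]
    refine (intervalIntegral.abs_integral_le_integral_abs hst).trans (le_of_eq ?_)
    refine intervalIntegral.integral_congr fun τ hτ => ?_
    rw [Set.uIcc_of_le hst] at hτ
    exact T.abs_sub_eq_gap hk (hs.trans hτ.1)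
  have h4 : ∫ τ in s..t, e τ = r ⬝ᵥ x t - r ⬝ᵥ x s -
      (r ⬝ᵥ B) * ∫ τ in s..t, (h τ - k * e τ) := by linarith
  have hg : 0 ≤ ∫ τ in s..t, gap C k (x τ) (h τ) :=
    intervalIntegral.integral_nonneg hst fun τ hτ => T.gap_nonneg hk (hs.trans hτ.1)
  rw [h4]
  calc |r ⬝ᵥ x t - r ⬝ᵥ x s - (r ⬝ᵥ B) * ∫ τ in s..t, (h τ - k * e τ)|
      ≤ |r ⬝ᵥ x t| + |r ⬝ᵥ x s| + |r ⬝ᵥ B| * |∫ τ in s..t, (h τ - k * e τ)| := by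
        rw [← abs_mul]
        exact (abs_sub _ _).trans (by gcongr; exact abs_sub _ _)
    _ ≤ m * ‖x t‖ + m * ‖x s‖ + |r ⬝ᵥ B| * (k * ∫ τ in s..t, gap C k (x τ) (h τ)) := by
        gcongr
        · exact (hc _).trans (by gcongr; exact le_max_left _ _)
        · exact (hc _).trans (by gcongr; exact le_max_left _ _)
    _ ≤ m * ‖x t‖ + m * ‖x s‖ + m * ∫ τ in s..t, gap C k (x τ) (h τ) := by
        rw [← mul_assoc]
        gcongr
        exact le_max_right _ _
    _ = _ := by ring

theorem integral_abs_output_le_of_eq_zero (T : LoopTrajectory A B C k ω x h) (hk : 0 < k)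
    (hω : 0 ≤ ω) {s : ℝ} (hs : 0 ≤ s) (h0 : C ⬝ᵥ x s = 0) :
    ∫ τ in s..s + 1, |C ⬝ᵥ x τ| ≤
      Real.exp (ω / k) * ∫ τ in s..s + 1, gap C k (x τ) (h τ) := by
  set a := ω / k with ha
  have ha0 : 0 ≤ a := div_nonneg hω hk.le
  set e := fun τ => |C ⬝ᵥ x τ| with he
  have hec : Continuous e := T.continuous_output.abs
  set g := fun τ => gap C k (x τ) (h τ) with hg
  have hgc : Continuous g := T.continuous_gap
  have hh : h s = 0 := by
    have := T.abs_state_le hk hs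
    rw [h0, abs_zero, mul_zero] at this
    exact abs_nonpos_iff.mp this
  have hI : ∀ t, HasDerivAt (fun t => ∫ τ in s..t, e τ) (e t) t := fun t =>
    hec.integral_hasStrictDerivAt s t |>.hasDerivAt
  have hG : ∀ t, HasDerivAt (fun t => ∫ τ in s..t, g τ) (g t) t := fun t =>
    hgc.integral_hasStrictDerivAt s t |>.hasDerivAt
  have hE : ∀ t, HasDerivAt (fun t => Real.exp (-(a * (t - s))))
      (Real.exp (-(a * (t - s))) * -(a * 1)) t := fun t =>
    ((((hasDerivAt_id t).sub_const s).const_mul a).neg).exp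
  -- Grönwall with an integrating factor: `h s = 0` gives `|e| ≤ g + a ∫ |e|`, so this function
  -- decreases from zero.
  have hJ := fun t => ((hE t).mul (hI t)).sub (hG t)
  have hanti := antitoneOn_of_hasDerivWithinAt_nonpos (convex_Icc s (s + 1))
    (fun t _ => (hJ t).continuousAt.continuousWithinAt)
    (fun t _ => (hJ t).hasDerivWithinAt) (fun t ht => by
      rw [interior_Icc] at ht
      have h1 := T.abs_state_sub_le hk hs ht.1.le
      rw [hh, abs_zero, sub_zero] at h1
      have h2 : e t ≤ g t + a * ∫ τ in s..t, e τ := by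
        have h3 : g t = e t - |h t| / k := rfl
        have h4 : |h t| / k ≤ a * ∫ τ in s..t, e τ := by
          rw [ha, div_mul_eq_mul_div]
          gcongr
        linarith
      have h5 : Real.exp (-(a * (t - s))) ≤ 1 := by
        rw [Real.exp_le_one_iff]
        have := mul_nonneg ha0 (sub_nonneg.mpr ht.1.le)
        linarith
      have h6 : 0 ≤ g t := T.gap_nonneg hk (hs.trans ht.1.le)
      have h7 := mul_le_mul_of_nonneg_left h2 (Real.exp_pos (-(a * (t - s)))).le
      have h8 := mul_le_mul_of_nonneg_right h5 h6
      linarith)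
  have h1 := hanti (Set.left_mem_Icc.mpr (by linarith)) (Set.right_mem_Icc.mpr (by linarith))
    (by linarith : s ≤ s + 1)
  simp only [Pi.sub_apply, Pi.mul_apply, intervalIntegral.integral_same, mul_zero, sub_zero,
    add_sub_cancel_left, mul_one] at h1
  have h2 : Real.exp (-a) * ∫ τ in s..s + 1, e τ ≤ ∫ τ in s..s + 1, g τ := by linarith
  rwa [Real.exp_neg, ← div_eq_inv_mul, div_le_iff₀' (Real.exp_pos _)] at h2

theorem exists_window_le {f : ℝ → ℝ} (hf : Continuous f) {s c : ℝ} {N : ℕ} (hN : N ≠ 0)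
    (h : ∫ τ in s..s + N, f τ ≤ N * c) : ∃ j : ℕ, ∫ τ in s + j..s + j + 1, f τ ≤ c := by
  have h1 := intervalIntegral.sum_integral_adjacent_intervals (f := f) (μ := volume) (n := N)
    (a := fun j : ℕ => s + j) fun j _ => hf.intervalIntegrable _ _
  simp only [Nat.cast_zero, add_zero] at h1
  rw [← h1] at h
  obtain ⟨j, -, hj⟩ := Finset.exists_le_of_sum_le (s := Finset.range N) (g := fun _ => c)
    (Finset.nonempty_range_iff.mpr hN) (h.trans_eq (by simp))
  refine ⟨j, ?_⟩
  simpa [add_assoc] using hj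

theorem integral_abs_eq_of_ne_zero {f : ℝ → ℝ} (hf : Continuous f) {s t : ℝ} (hst : s ≤ t)
    (h : ∀ τ ∈ Set.Icc s t, f τ ≠ 0) : ∫ τ in s..t, |f τ| = |∫ τ in s..t, f τ| := by
  have hsign : (∀ τ ∈ Set.Icc s t, 0 ≤ f τ) ∨ ∀ τ ∈ Set.Icc s t, f τ ≤ 0 := by
    by_contra! hne
    obtain ⟨⟨a, ha, ha0⟩, c, hc, hc0⟩ := hne
    obtain ⟨z, hz, hz0⟩ := isPreconnected_Icc.intermediate_value ha hc hf.continuousOn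
      ⟨ha0.le, hc0.le⟩
    exact h z hz hz0
  rcases hsign with h1 | h1
  · rw [abs_of_nonneg (intervalIntegral.integral_nonneg hst h1)]
    refine intervalIntegral.integral_congr fun τ hτ => ?_
    rw [Set.uIcc_of_le hst] at hτ
    exact abs_of_nonneg (h1 τ hτ)
  · have h2 : ∫ τ in s..t, |f τ| = -∫ τ in s..t, f τ := by
      rw [← intervalIntegral.integral_neg]
      refine intervalIntegral.integral_congr fun τ hτ => ?_
      rw [Set.uIcc_of_le hst] at hτ
      exact abs_of_nonpos (h1 τ hτ)
    rw [← abs_of_nonneg (intervalIntegral.integral_nonneg hst fun τ _ => abs_nonneg (f τ)), h2,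
      abs_neg]

theorem exists_integral_abs_output_le (T : LoopTrajectory A B C k ω x h) (hk : 0 < k) (hω : 0 ≤ ω)
    {c R : ℝ} (hc : 0 ≤ c) (hR : ∀ t, 0 ≤ t → ‖x t‖ ≤ R)
    (hint : ∀ s t, 0 ≤ s → s ≤ t →
      |∫ τ in s..t, C ⬝ᵥ x τ| ≤ c * (‖x s‖ + ‖x t‖ + ∫ τ in s..t, gap C k (x τ) (h τ)))
    (hgap : ∀ l σ, 0 < l → 0 < σ → ∃ s, 0 ≤ s ∧ ∫ τ in s..s + l, gap C k (x τ) (h τ) ≤ σ)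
    {ε : ℝ} (hε : 0 < ε) : ∃ s, 0 ≤ s ∧ ∫ τ in s..s + 1, |C ⬝ᵥ x τ| ≤ ε := by
  -- For nonvanishing `e`, the bound `c (2R + 1)` on `∫ |e|` is spread over `N` unit windows, so one
  -- of them carries at most `ε`.
  obtain ⟨N, hN⟩ := exists_nat_gt (c * (R + R + 1) / ε)
  have hR0 : 0 ≤ R := (norm_nonneg _).trans (hR 0 le_rfl)
  have hN0 : (0 : ℝ) < N := lt_of_le_of_lt (by positivity) hN
  rw [div_lt_iff₀ hε] at hN
  -- The extra unit of length leaves room after a zero found near the end. The bound `1` serves the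
  -- constant-sign case, the other bound cancels the Grönwall factor.
  obtain ⟨s, hs, hsg⟩ := hgap (N + 1) (min 1 (ε * Real.exp (-(ω / k)))) (by positivity)
    (by positivity)
  by_cases hz : ∃ z ∈ Set.Icc s (s + N), C ⬝ᵥ x z = 0
  · obtain ⟨z, hz, hz0⟩ := hz
    have hz' : 0 ≤ z := hs.trans hz.1
    refine ⟨z, hz', (T.integral_abs_output_le_of_eq_zero hk hω hz' hz0).trans ?_⟩
    have h1 := T.integral_gap_mono hk hs hz.1 (by linarith : z ≤ z + 1)
      (by linarith [hz.2] : z + 1 ≤ s + (N + 1))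
    have h2 := h1.trans (hsg.trans (min_le_right _ _))
    rw [Real.exp_neg, ← div_eq_mul_inv, le_div_iff₀' (Real.exp_pos _)] at h2
    exact h2
  · push Not at hz
    have h1 := hint s (s + N) hs (by linarith)
    have h2 := T.integral_gap_mono hk hs le_rfl (by linarith : s ≤ s + N)
      (by linarith : s + N ≤ s + (N + 1))
    have h3 : ∫ τ in s..s + N, |C ⬝ᵥ x τ| ≤ N * ε := by
      rw [integral_abs_eq_of_ne_zero T.continuous_output (by linarith) hz]
      refine h1.trans (le_trans (mul_le_mul_of_nonneg_left ?_ hc) hN.le)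
      · linarith [hR s hs, hR (s + N) (by linarith), hsg.trans (min_le_left _ _)]
    obtain ⟨j, hj⟩ := exists_window_le T.continuous_output.abs (by exact_mod_cast hN0.ne') h3
    exact ⟨s + j, by positivity, hj⟩

end LoopTrajectory

open LoopTrajectory in
/-- Positive definiteness of the storage function makes the closed loop asymptotically stable. -/
theorem isAsymptoticallyStable_of_storage_pos (hk : 0 < k) (hω : 0 < ω) (hobs : IsObservable A C)
    (hA : A.det ≠ 0) (hP : Pᵀ = P) (hd : ∀ x, x ⬝ᵥ P *ᵥ (A *ᵥ x) ≤ 0) (hB : B = -(A *ᵥ b))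
    (hC : P *ᵥ b = C) {μ : ℝ} (hμ : 0 < μ)
    (hlow : ∀ x h, μ * (‖x‖ ^ 2 + h ^ 2) ≤ storage P C k x h) :
    IsAsymptoticallyStable A B C k ω := by
  obtain ⟨q, hq, hup⟩ := exists_storage_upper_bound P C hk
  obtain ⟨r, hr⟩ := exists_output_functional hA hB hC hμ hlow
  obtain ⟨c, hc, hint⟩ := exists_abs_integral_output_le (ω := ω) hk hr
  obtain ⟨Γ, hΓ, hobs'⟩ := exists_norm_le_integral (B := B) (ω := ω) hk hobs
  have hV : ∀ x h, LoopTrajectory A B C k ω x h → ∀ s t, 0 ≤ s → s ≤ t →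
      storage P C k (x t) (h t) ≤ storage P C k (x s) (h s) := by
    intro x h T s t hs hst
    have h1 := T.storage_sub_le hk hω.le hP hd hB hC hs hst
    have h2 : 0 ≤ ω * ∫ τ in s..t, gap C k (x τ) (h τ) ^ 2 :=
      mul_nonneg hω.le (intervalIntegral.integral_nonneg hst fun τ _ => sq_nonneg _)
    linarith
  have htrap : ∀ ε : ℝ, 0 < ε → ∃ δ : ℝ, 0 < δ ∧ ∀ x h, LoopTrajectory A B C k ω x h →
      ∀ s t, 0 ≤ s → s ≤ t → ‖x s‖ ≤ δ → ‖x t‖ < ε ∧ |h t| < ε := by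
    intro ε hε
    -- The chain is `μ (‖x t‖² + h t²) ≤ V t ≤ V s ≤ q ‖x s‖²`; `q + 1` covers `q = 0` and makes the
    -- final bound strict.
    refine ⟨ε * Real.sqrt (μ / (q + 1)), by positivity, fun x h T s t hs hst hx => ?_⟩
    have h1 := (hlow (x t) (h t)).trans ((hV x h T s t hs hst).trans
      (hup _ _ (T.sector s hs)))
    have h2 : q * ‖x s‖ ^ 2 < μ * ε ^ 2 := by
      have h3 : ‖x s‖ ^ 2 ≤ ε ^ 2 * (μ / (q + 1)) := by
        calc ‖x s‖ ^ 2 ≤ (ε * Real.sqrt (μ / (q + 1))) ^ 2 := by gcongr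
          _ = _ := by rw [mul_pow, Real.sq_sqrt (by positivity)]
      calc q * ‖x s‖ ^ 2 ≤ q * (ε ^ 2 * (μ / (q + 1))) := by gcongr
        _ = μ * ε ^ 2 * (q / (q + 1)) := by ring
        _ < μ * ε ^ 2 * 1 := by
            gcongr
            rw [div_lt_one (by positivity)]; linarith
        _ = _ := mul_one _
    have h4 : ‖x t‖ ^ 2 + h t ^ 2 < ε ^ 2 := lt_of_mul_lt_mul_left (h1.trans_lt h2) hμ.le
    exact ⟨lt_of_pow_lt_pow_left₀ 2 hε.le (by linarith [sq_nonneg (h t)]),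
      abs_lt_of_sq_lt_sq (by linarith [sq_nonneg ‖x t‖]) hε.le⟩
  have hsmall : ∀ x h, LoopTrajectory A B C k ω x h → ∀ η : ℝ, 0 < η → ∃ s, 0 ≤ s ∧ ‖x s‖ ≤ η := by
    intro x h T η hη
    have hV0 : ∀ t, 0 ≤ t → 0 ≤ storage P C k (x t) (h t) := fun t _ =>
      le_trans (by positivity) (hlow _ _)
    have hR : ∀ t, 0 ≤ t → ‖x t‖ ≤ Real.sqrt (storage P C k (x 0) (h 0) / μ) := by
      intro t ht
      refine Real.le_sqrt_of_sq_le ?_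
      rw [le_div_iff₀' hμ]
      have h1 := (hlow (x t) (h t)).trans (hV x h T 0 t le_rfl ht)
      have h2 : 0 ≤ μ * h t ^ 2 := by positivity
      linarith
    obtain ⟨s, hs, hs1⟩ := T.exists_integral_abs_output_le hk hω.le hc hR (hint x h T)
      (fun l σ hl hσ => T.exists_integral_gap_le hω hV0
        (fun s t hs hst => T.storage_sub_le hk hω.le hP hd hB hC hs hst) hl hσ)
      (ε := η / (Γ + 1)) (by positivity)
    refine ⟨s, hs, (hobs' x h T s hs).trans ?_⟩
    calc Γ * ∫ τ in s..s + 1, |C ⬝ᵥ x τ| ≤ (Γ + 1) * (η / (Γ + 1)) := by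
          gcongr
          · exact intervalIntegral.integral_nonneg (by linarith) fun τ _ => abs_nonneg _
          · linarith
      _ = η := by field_simp
  refine ⟨fun x₀ h₀ hadm => exists_closedLoopTrajectory A B C hk hω.le x₀ h₀ hadm, fun ε hε => ?_,
    fun x h hx => ?_⟩
  · obtain ⟨δ, hδ, htr⟩ := htrap ε hε
    refine ⟨δ, hδ, fun x h hx h0 _ t ht => ?_⟩
    have := htr _ _ hx.loopTrajectory 0 t le_rfl ht (by simpa using h0.le)
    simpa only [max_eq_left ht] using this
  · have hlim : ∀ ε : ℝ, 0 < ε → ∃ s, ∀ t, s ≤ t → ‖x t‖ < ε ∧ |h t| < ε := by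
      intro ε hε
      obtain ⟨δ, hδ, htr⟩ := htrap ε hε
      obtain ⟨s, hs, hxs⟩ := hsmall _ _ hx.loopTrajectory δ hδ
      refine ⟨s, fun t ht => ?_⟩
      have := htr _ _ hx.loopTrajectory s t hs ht hxs
      simpa only [max_eq_left (hs.trans ht)] using this
    constructor
    · rw [Metric.tendsto_atTop]
      intro ε hε
      obtain ⟨s, hs⟩ := hlim ε hε
      exact ⟨s, fun t ht => by rw [dist_zero_right]; exact (hs t ht).1⟩
    · rw [Metric.tendsto_atTop]
      intro ε hε
      obtain ⟨s, hs⟩ := hlim ε hε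
      exact ⟨s, fun t ht => by rw [dist_zero_right]; exact (hs t ht).2⟩

end

end HIGS

theorem theorem2 {n : ℕ} (A : Matrix (Fin n) (Fin n) ℝ) (B C : Fin n → ℝ)
    (hmin : HIGS.IsMinimalRealization A B C)
    (hNI : HIGS.IsNegativeImaginary (HIGS.transferFunction A B C)) :
    ∃ k ω : ℝ, 0 < k ∧ 0 ≤ ω ∧ HIGS.IsAsymptoticallyStable A B C k ω := by
  obtain ⟨P, b, hP, hpos, hd, hB, hC⟩ := HIGS.negative_imaginary_lemma hmin hNI
  obtain ⟨k, μ, hk, hμ, hlow⟩ := HIGS.LoopTrajectory.exists_storage_lower_bound hpos C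
  -- Only `k` has to be small; any positive integrator frequency works, here `1`.
  exact ⟨k, 1, hk, zero_le_one, HIGS.isAsymptoticallyStable_of_storage_pos hk one_pos hmin.2
    (HIGS.det_ne_zero_of_negativeImaginary hmin hNI) hP hd hB hC hμ hlow⟩
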